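/- Let $R$ be a commutative ring with $1$ and $A$ an associative $R$-algebra with $1$ that is finitely generated as an $R$-module. For a commutative $R$-algebra $B$ and a left $A$-module $M$ write $A_B=B\otimes_R A$ and $M_B=B\otimes_R M$ (a left $A_B$-module); for $B=R[X],\ R_s,\ R_s[X]$ write $M[X],\ M_s,\ M_s[X]$, and similarly for $A$. Let $P$ be a finitely generated projective left $A$-module of constant rank, where "rank $n$" means that $P_{\mathfrak m}\cong A_{\mathfrak m}^n$ for every maximal ideal $\mathfrak m$ of $R$. Consider three cases. *Linear case.* $P$ has rank $n\ge 2$, $Q=P\oplus A$, and $\mathrm G(Q[X])=\mathrm{Aut}_{A[X]}(Q[X])$. $\mathrm{ET}(Q_B)$ is the subgroup of $\mathrm{Aut}_{A_B}(Q_B)$ generated by the maps $(p,a)\mapsto(p+ax,a)$ with $x\in P_B$ and $(p,a)\mapsto(p,a+\psi(p))$ with $\psi\in \mathrm{Hom}_{A_B}(P_B,A_B)$. *Symplectic ($\varepsilon=-1$) and orthogonal ($\varepsilon=1$) cases.* $2$ is invertible in $R$; $A$ has an $R$-linear involution $a\mapsto\bar a$ (for $A=R$, the identity); $P$ has even rank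 $2r\ge 6$ and carries a non-singular form $\langle\,,\rangle:P\times P\to A$, that is, a biadditive map with $\langle x,ay\rangle=a\langle x,y\rangle$, $\langle ax,y\rangle=\langle x,y\rangle\bar a$, $\langle y,x\rangle=\varepsilon\overline{\langle x,y\rangle}$, such that $x\mapsto\langle x,\cdot\rangle$ is a bijection $P\to \mathrm{Hom}_A(P,A)$. Let $Q=P\perp A^2$, with elements $(p,b,a)$ and form $\langle (p,b,a),(p',b',a')\rangle=\langle p,p'\rangle+a'\bar b+\varepsilon b'\bar a$, let $Q_B$ carry the extended form, and let $\mathrm G(Q[X])$ be the group of $A[X]$-linear isometries of $Q[X]$. $\mathrm{ET}(Q_B)$ is the group generated by those isometries of $Q_B$ that have one of the following forms, with $q\in P_B$: - symplectic case: $(p,b,a)\mapsto(p+aq,\ b+\langle q,p\rangle+a,\ a)$ or $(p,b,a)\mapsto(p+bq,\ b,\ a-\langle q,p\rangle-b)$; - orthogonal case, with $\langle q,q\rangle=0$: $(p,b,a)\mapsto(p-aq,\ b+\langle q,p\rangle,\ a)$ or $(p,b,a)\mapsto(p-bq,\ b,\ a+\langle q,p\rangle)$. In these two cases assume (H2): for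 every $s\in R$ whose image in $A$ is not nilpotent, if $Q_s$ is a free $A_s$-module, then $Q_s$ is isometric to the standard hyperbolic module $\mathbb H(A_s^{r+1})$, the orthogonal sum of $r+1$ copies of the hyperbolic plane $A_s^2$ with the form $\langle(b,a),(b',a')\rangle=a'\bar b+\varepsilon b'\bar a$. Then in each of the three cases the following holds. Let $\tau(X)\in \mathrm G(Q[X])$ with $\tau(0)=\mathrm{Id}$, and let $s,t\in R$ with $Rs+Rt=R$. If the localizations satisfy $\tau_s(X)\in\mathrm{ET}(Q_s[X])$ and $\tau_t(X)\in\mathrm{ET}(Q_t[X])$, then $\tau(X)\in\mathrm{ET}(Q[X])$. -/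

import Mathlib

open scoped TensorProduct Polynomial

noncomputable section

namespace Transvection

/-! ### Involutions, forms, groups and elementary transvections over one ring -/

section OneRing

variable (S : Type*) {C M N : Type*} [CommRing S] [Ring C] [Algebra S C]
  [AddCommGroup M] [Module S M] [Module C M] [AddCommGroup N] [Module C N]

/-- An involution of the `S`-algebra `C` which is trivial on `S`: an `S`-linear
anti-automorphism of order at most two. -/
structure Involution (C : Type*) [Ring C] [Algebra S C] where
  toLin : C →ₗ[S] C
  map_mul : ∀ a b, toLin (a * b) = toLin b * toLin a
  map_map : ∀ a, toLin (toLin a) = a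

variable {S}

/-- `h` is a non-singular `ε`-symmetric form on the left `C`-module `M` with values in `C`.
It is linear in the second variable and semilinear (through the involution `j`) in the first one,
so that `x ↦ h x ·` is a map from `M` to the dual `M* = Hom (M, C)`, which is a left module by
`(a f) v = f v * j a`; non-singular means that this map is bijective.

For `ε = 1` these are the symmetric forms. For `ε = -1` these are the alternating forms when `2` is
invertible (if `j` is the identity, then `h x x = - h x x` and hence `h x x = 0`). -/
structure IsNonsingularForm (ε : ℤ) (j : Involution S C) (h : LinearMap.BilinMap S M C) :
    Prop where
  smul_right : ∀ (a : C) (x y : M), h x (a • y) = a * h x y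
  smul_left : ∀ (a : C) (x y : M), h (a • x) y = h x y * j.toLin a
  symm : ∀ x y : M, h y x = ε • j.toLin (h x y)
  nonsingular : ∀ f : M →ₗ[C] C, ∃! x : M, ∀ y : M, h x y = f y

/-- The form of the orthogonal sum `M ⊥ C²`, with elements written `(p, b, a)`, where `C²` is the
hyperbolic plane: `⟨(b, a), (b', a')⟩ = b a' + ε b' a` (written here for a left module and a
possibly non-commutative `C`). -/
def perpForm (ε : ℤ) (j : Involution S C) (h : LinearMap.BilinMap S M C) (x y : M × C × C) : C :=
  h x.1 y.1 + (y.2.2 * j.toLin x.2.1 + ε • (y.2.1 * j.toLin x.2.2))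

/-- The standard hyperbolic form of `ℍ(C^k)`, the orthogonal sum of `k` hyperbolic planes. -/
def hyperbolicForm (ε : ℤ) (j : Involution S C) (k : ℕ) (x y : Fin k → C × C) : C :=
  ∑ i, ((y i).2 * j.toLin (x i).1 + ε • ((y i).1 * j.toLin (x i).2))

/-- The group of isometries of a module `N` with a form `b`. It is `Sp(N)` for a symplectic and
`O(N)` for an orthogonal module. -/
def isometryGroup (b : N → N → C) : Subgroup (N ≃ₗ[C] N) where
  carrier := {g | ∀ x y, b (g x) (g y) = b x y}
  mul_mem' := fun {f g} hf hg x y => by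
    rw [LinearEquiv.mul_apply, LinearEquiv.mul_apply, hf, hg]
  one_mem' := fun _ _ => rfl
  inv_mem' := fun {g} hg x y => by
    have := hg (g⁻¹ x) (g⁻¹ y)
    rw [← LinearEquiv.mul_apply, ← LinearEquiv.mul_apply, mul_inv_cancel] at this
    exact this.symm

variable (C M) in
/-- `ETrans (M ⊕ C)`: the subgroup generated by the maps `(p, a) ↦ (p + a x, a)` and
`(p, a) ↦ (p, a + ψ p)` with `x ∈ M` and `ψ ∈ M*`. -/
def ETrans : Subgroup ((M × C) ≃ₗ[C] (M × C)) :=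
  Subgroup.closure
    ({g | ∃ x : M, ∀ (p : M) (a : C), g (p, a) = (p + a • x, a)} ∪
     {g | ∃ ψ : M →ₗ[C] C, ∀ (p : M) (a : C), g (p, a) = (p, a + ψ p)})

/-- `ETrans_Sp (M ⊥ C²)`: the subgroup generated by the isometries of the form
`(p, b, a) ↦ (p + a q, b - ⟨p, q⟩ + a, a)` and `(p, b, a) ↦ (p + b q, b, a + ⟨p, q⟩ - b)`
with `q ∈ M`. The term `-⟨p, q⟩` is written `⟨q, p⟩`, which is linear in `p` also when the
involution is not trivial. If the involution is trivial, every `q` gives an isometry. -/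
def ETransSp (j : Involution S C) (h : LinearMap.BilinMap S M C) :
    Subgroup ((M × C × C) ≃ₗ[C] (M × C × C)) :=
  Subgroup.closure
    {g | g ∈ isometryGroup (perpForm (-1) j h) ∧ ∃ q : M,
      ((∀ (p : M) (b a : C), g (p, b, a) = (p + a • q, b + h q p + a, a)) ∨
       (∀ (p : M) (b a : C), g (p, b, a) = (p + b • q, b, a - h q p - b)))}

/-- `ETrans_O (M ⊥ C²)`: the subgroup generated by the isometries of the form
`(p, b, a) ↦ (p - a q, b + ⟨q, p⟩, a)` and `(p, b, a) ↦ (p - b q, b, a + ⟨q, p⟩)`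
with `q ∈ M` isotropic. -/
def ETransO (j : Involution S C) (h : LinearMap.BilinMap S M C) :
    Subgroup ((M × C × C) ≃ₗ[C] (M × C × C)) :=
  Subgroup.closure
    {g | g ∈ isometryGroup (perpForm 1 j h) ∧ ∃ q : M, h q q = 0 ∧
      ((∀ (p : M) (b a : C), g (p, b, a) = (p - a • q, b + h q p, a)) ∨
       (∀ (p : M) (b a : C), g (p, b, a) = (p - b • q, b, a + h q p)))}

end OneRing

/-! ### Extension of scalars along the centre

For a commutative `R`-algebra `B`, the ring `A` becomes `B ⊗[R] A` and the left `A`-module `P`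
becomes the left `B ⊗[R] A`-module `B ⊗[R] P`. With `B = R[X]`, `R_s`, `R_s[X]`, `R_𝔪` these are
`A[X]`, `A_s`, `A_s[X]`, `A_𝔪` and `P[X]`, `P_s`, `P_s[X]`, `P_𝔪`. -/

section BaseChange

variable (R : Type*) [CommRing R] (B : Type*) [CommRing B] [Algebra R B]
  (A : Type*) [Ring A] [Algebra R A]
  (P : Type*) [AddCommGroup P] [Module R P] [Module A P] [IsScalarTower R A P]

/-- `A_B = B ⊗[R] A`. -/
abbrev ExtRing : Type _ := B ⊗[R] A

/-- `P_B = B ⊗[R] P`; a new name, because it carries its structure of a left `A_B`-module. -/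
def ExtMod (P : Type*) [AddCommGroup P] [Module R P] : Type _ := B ⊗[R] P

instance : AddCommGroup (ExtMod R B P) := inferInstanceAs (AddCommGroup (B ⊗[R] P))
instance : Module B (ExtMod R B P) := inferInstanceAs (Module B (B ⊗[R] P))

/-- The action of `A_B` on `P_B`: `b ⊗ a` acts as `(x ↦ b x) ⊗ (p ↦ a p)`. -/
def extAction : ExtRing R B A →ₐ[B] Module.End B (B ⊗[R] P) :=
  (Module.endTensorEndAlgHom (R := R) (S := B) (A := B) (M := B) (N := P)).comp
    (Algebra.TensorProduct.map (Algebra.lmul B B) (Algebra.lsmul R R P : A →ₐ[R] Module.End R P))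

instance : Module (ExtRing R B A) (ExtMod R B P) :=
  Module.compHom (B ⊗[R] P) (extAction R B A P).toRingHom

variable {R A P} in
/-- The involution of `A_B` which extends the one of `A` and is trivial on `B`. -/
def Involution.ext (j : Involution R A) : Involution B (ExtRing R B A) where
  toLin := j.toLin.baseChange B
  map_mul := fun x y => by
    induction x using TensorProduct.induction_on with
    | zero => simp
    | add x₁ x₂ h₁ h₂ => simp only [add_mul, mul_add, map_add, h₁, h₂]
    | tmul b a =>
      induction y using TensorProduct.induction_on with
      | zero => simp
      | add y₁ y₂ h₁ h₂ => simp only [add_mul, mul_add, map_add, h₁, h₂]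
      | tmul b' a' =>
        simp only [Algebra.TensorProduct.tmul_mul_tmul, LinearMap.baseChange_tmul, j.map_mul,
          mul_comm b b']
  map_map := fun x => by
    induction x using TensorProduct.induction_on with
    | zero => simp
    | add x₁ x₂ h₁ h₂ => simp only [map_add, h₁, h₂]
    | tmul b a => simp only [LinearMap.baseChange_tmul, j.map_map]

variable {R A P} in
/-- The form of `P_B` which extends the form `h` of `P`. -/
def extForm (h : LinearMap.BilinMap R P A) :
    LinearMap.BilinMap B (ExtMod R B P) (ExtRing R B A) :=
  LinearMap.BilinMap.baseChange B h

/-- The left `A`-module `P` has (constant) rank `n`: it is locally free of rank `n`. -/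
def HasRank (n : ℕ) : Prop :=
  ∀ (m : Ideal R) [m.IsMaximal],
    Nonempty (ExtMod R (Localization.AtPrime m) P ≃ₗ[ExtRing R (Localization.AtPrime m) A]
      (Fin n → ExtRing R (Localization.AtPrime m) A))

/-- `Q_B` for `Q = P ⊕ A`. -/
abbrev QLin : Type _ := ExtMod R B P × ExtRing R B A

/-- `Q_B` for `Q = P ⊥ A²`. -/
abbrev QPerp : Type _ := ExtMod R B P × ExtRing R B A × ExtRing R B A

variable {R A P} in
/-- The condition on the form `h` of `P`: for every `s ∈ R` not nilpotent in `A`, if the module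
`Q_s` is free over `A_s`, where `Q = P ⊥ A²`, then `Q_s` is isometric to the standard hyperbolic
module `ℍ(A_s^k)`. -/
def HyperbolicWhereFree (ε : ℤ) (j : Involution R A) (h : LinearMap.BilinMap R P A) (k : ℕ) : Prop :=
  ∀ s : R, ¬ IsNilpotent (algebraMap R A s) →
    Module.Free (ExtRing R (Localization.Away s) A) (QPerp R (Localization.Away s) A P) →
    ∃ e : QPerp R (Localization.Away s) A P ≃ₗ[ExtRing R (Localization.Away s) A]
        (Fin k → ExtRing R (Localization.Away s) A × ExtRing R (Localization.Away s) A),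
      ∀ x y, hyperbolicForm ε (j.ext (Localization.Away s)) k (e x) (e y) =
        perpForm ε (j.ext (Localization.Away s)) (extForm (Localization.Away s) h) x y

variable {B} {B' : Type*} [CommRing B'] [Algebra R B'] (φ : B →ₐ[R] B')

/-- `A_B → A_B'`. -/
def extRingMap : ExtRing R B A →ₐ[R] ExtRing R B' A :=
  Algebra.TensorProduct.map φ (AlgHom.id R A)

/-- `P_B → P_B'`. -/
def extModMap : ExtMod R B P → ExtMod R B' P :=
  LinearMap.rTensor P φ.toLinearMap

/-- `Q_B → Q_B'` for `Q = P ⊕ A`. -/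
def qLinMap : QLin R B A P → QLin R B' A P :=
  Prod.map (extModMap R P φ) (extRingMap R A φ)

/-- `Q_B → Q_B'` for `Q = P ⊥ A²`. -/
def qPerpMap : QPerp R B A P → QPerp R B' A P :=
  Prod.map (extModMap R P φ) (Prod.map (extRingMap R A φ) (extRingMap R A φ))

/-- The automorphism `σ` of `Q_B'` is the extension of scalars along `φ` of the automorphism `τ` of
`Q_B` (`Q = P ⊕ A`). As the image of `Q_B` generates `Q_B'`, there is only one such `σ`; see
`IsExtLin.unique`. -/
def IsExtLin (τ : QLin R B A P ≃ₗ[ExtRing R B A] QLin R B A P)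
    (σ : QLin R B' A P ≃ₗ[ExtRing R B' A] QLin R B' A P) : Prop :=
  ∀ x, σ (qLinMap R A P φ x) = qLinMap R A P φ (τ x)

/-- The automorphism `σ` of `Q_B'` is the extension of scalars along `φ` of the automorphism `τ` of
`Q_B` (`Q = P ⊥ A²`). As the image of `Q_B` generates `Q_B'`, there is only one such `σ`; see
`IsExtPerp.unique`. -/
def IsExtPerp (τ : QPerp R B A P ≃ₗ[ExtRing R B A] QPerp R B A P)
    (σ : QPerp R B' A P ≃ₗ[ExtRing R B' A] QPerp R B' A P) : Prop :=
  ∀ x, σ (qPerpMap R A P φ x) = qPerpMap R A P φ (τ x)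

/-- Evaluation at `X = 0`. -/
def evalZero : R[X] →ₐ[R] R := Polynomial.aeval 0

/-- The localization map `R[X] → R_s[X]`. -/
def polyLoc (s : R) : R[X] →ₐ[R] (Localization.Away s)[X] :=
  Polynomial.mapAlgHom (Algebra.ofId R (Localization.Away s))

/-- The element `b ⊗ p` of `P_B`. -/
def ExtMod.tmul {P : Type*} [AddCommGroup P] [Module R P] (b : B) (p : P) : ExtMod R B P :=
  b ⊗ₜ[R] p

variable {R A P φ}

theorem ext_smul_tmul (b b' : B) (a : A) (p : P) :
    (b ⊗ₜ[R] a : ExtRing R B A) • (ExtMod.tmul R b' p) =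
      (ExtMod.tmul R (b * b') (a • p)) := by
  change (extAction R B A P (b ⊗ₜ[R] a)) (b' ⊗ₜ[R] p) = _
  rfl

/-- An `A_B'`-linear map on `P_B'` is determined by its values on the image of `P_B`. -/
theorem extMod_eq {N : Type*} [AddCommGroup N] [Module (ExtRing R B' A) N]
    (f g : ExtMod R B' P →ₗ[ExtRing R B' A] N)
    (H : ∀ x, f (extModMap R P φ x) = g (extModMap R P φ x)) : f = g := by
  ext x
  induction x using TensorProduct.induction_on with
  | zero => exact (map_zero f).trans (map_zero g).symm
  | add x y hx hy => exact (map_add f x y).trans ((congrArg₂ (· + ·) hx hy).trans (map_add g x y).symm)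
  | tmul b p =>
    have h1 : extModMap R P φ (ExtMod.tmul R (1 : B) p) =
        (ExtMod.tmul R (1 : B') p) := by
      change LinearMap.rTensor P φ.toLinearMap ((1 : B) ⊗ₜ[R] p) = (1 : B') ⊗ₜ[R] p
      simp
    have h2 := ext_smul_tmul (R := R) (A := A) (P := P) b (1 : B') 1 p
    rw [one_smul, mul_one] at h2
    have h3 := H (ExtMod.tmul R (1 : B) p)
    rw [h1] at h3
    exact (congrArg f h2.symm).trans ((map_smul f _ _).trans
      ((congrArg _ h3).trans ((map_smul g _ _).symm.trans (congrArg g h2))))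

theorem extRing_eq {N : Type*} [AddCommGroup N] [Module (ExtRing R B' A) N]
    (f g : ExtRing R B' A →ₗ[ExtRing R B' A] N)
    (H : ∀ x, f (extRingMap R A φ x) = g (extRingMap R A φ x)) : f = g := by
  apply LinearMap.ext_ring
  simpa using H 1

theorem IsExtLin.unique {τ : QLin R B A P ≃ₗ[ExtRing R B A] QLin R B A P}
    {σ σ' : QLin R B' A P ≃ₗ[ExtRing R B' A] QLin R B' A P}
    (h : IsExtLin R A P φ τ σ) (h' : IsExtLin R A P φ τ σ') : σ = σ' := by
  apply LinearEquiv.toLinearMap_injective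
  apply LinearMap.prod_ext
  · refine extMod_eq (φ := φ) _ _ fun x => ?_
    simpa [qLinMap] using (h (x, 0)).trans (h' (x, 0)).symm
  · refine extRing_eq (φ := φ) _ _ fun x => ?_
    have h0 : extModMap R P φ 0 = 0 := map_zero (LinearMap.rTensor P φ.toLinearMap)
    simpa [qLinMap, h0] using (h (0, x)).trans (h' (0, x)).symm

theorem IsExtPerp.unique {τ : QPerp R B A P ≃ₗ[ExtRing R B A] QPerp R B A P}
    {σ σ' : QPerp R B' A P ≃ₗ[ExtRing R B' A] QPerp R B' A P}
    (h : IsExtPerp R A P φ τ σ) (h' : IsExtPerp R A P φ τ σ') : σ = σ' := by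
  have h0 : extModMap R P φ 0 = 0 := map_zero (LinearMap.rTensor P φ.toLinearMap)
  apply LinearEquiv.toLinearMap_injective
  apply LinearMap.prod_ext
  · refine extMod_eq (φ := φ) _ _ fun x => ?_
    have h2 := (h (x, 0, 0)).trans (h' (x, 0, 0)).symm
    simp only [qPerpMap, Prod.map_apply, map_zero] at h2
    exact h2
  · apply LinearMap.prod_ext
    · refine extRing_eq (φ := φ) _ _ fun x => ?_
      simpa [qPerpMap, h0] using (h (0, x, 0)).trans (h' (0, x, 0)).symm
    · refine extRing_eq (φ := φ) _ _ fun x => ?_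
      simpa [qPerpMap, h0] using (h (0, 0, x)).trans (h' (0, 0, x)).symm

end BaseChange

end Transvection

end

/-!
# A local-global principle for transvection groups

The argument is Quillen's patching method. For a functorial family of subgroups `E` and a loop `τ`
with `τ(0) = 1`, the elements `b` of `R` such that `τ(T + b X) τ(T)⁻¹` lies in `E(R[T][X])` form an
ideal, and `τ ∈ E(R[X])` follows if this ideal is the unit ideal (`mem_of_locally_mem`). For this it
suffices to find, for every maximal ideal `m` of `R`, some `s ∉ m` such that `τ_s` lies in `E` and
the dilation property holds: for every `θ(X) ∈ E(R_s[T][X])` the quotient `θ(s^N X) θ(0)⁻¹` comes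
from `E(R[T][X])` when `N` is large. The first condition holds for all multiples of one of the two
comaximal elements, so the work lies in the dilation property.

*Local structure of `P`.* Around a maximal ideal there is a dual basis of `P`, defined over `R` and
valid up to a scalar `u ∉ m` (`HasRank.exists_isDualBasisAway`). In the unitary cases a hyperbolic
basis of `P` is needed instead (`HyperbolicWhereFree.exists_isHypBasisAway`). If `u` is nilpotent in
`A`, a power of it kills `P`. Otherwise `P_u` is free, so by hypothesis `P_u ⊥ A_u²` is hyperbolic,
and a hyperbolic plane can be cancelled over `R_m` (`exists_isHypBasis_of_perp`), because `A_m` has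
a semisimple quotient which detects units (`exists_semisimple_quotient`): there, Eichler
transformations move a basis vector to one which pairs with `(0, 1, 0)` to a unit, by a stable range
argument with left ideals (`exists_span_lt_span_add_mul`). The resulting basis over `R_m` spreads
out to one over `R` up to a scalar outside `m` (`exists_isHypBasisAway_of_atPrime`).

*Dilation.* Given such a basis, the transvection group is generated by the root elements along the
basis vectors (`eTrans_le_linCongruence`; `heis_mem_uniCongruence_univ`, where `2` has to be
invertible). Let a congruence subgroup of level `s^m` be generated by the root elements with
coefficients which are `s^m` times elements defined before localization. For a root element `θ`, the
quotient `θ(s^n X) θ(0)⁻¹` lies in the congruence subgroup of level `s^m` for large `n`, and this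
property passes to products because conjugation by any fixed product of root elements maps a
congruence subgroup of high level into one of given level (`exists_conj_linCongruence_le`,
`exists_conj_uniCongruence_le`). For the latter a root element is written as a commutator through a
further index, respectively through a further hyperbolic plane; this is where rank at least two,
respectively six, enters. At level `s^0` the congruence subgroup lifts, which gives
`exists_dilation_lin` and `exists_dilation_perp`.
-/

noncomputable section

namespace Transvection

/-! ### Extension of scalars for automorphisms -/

section BaseChangeAut

variable {R : Type*} [CommRing R] {A : Type*} [Ring A] [Algebra R A]
  {Q : Type*} [AddCommGroup Q] [Module R Q] [Module A Q] [IsScalarTower R A Q]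
  {B : Type*} [CommRing B] [Algebra R B] {B' : Type*} [CommRing B'] [Algebra R B']
  {B'' : Type*} [CommRing B''] [Algebra R B'']

theorem extModMap_add (φ : B →ₐ[R] B') (x y : ExtMod R B Q) :
    extModMap R Q φ (x + y) = extModMap R Q φ x + extModMap R Q φ y :=
  map_add (LinearMap.rTensor Q φ.toLinearMap) x y

theorem extModMap_zero (φ : B →ₐ[R] B') : extModMap R Q φ 0 = 0 :=
  map_zero (LinearMap.rTensor Q φ.toLinearMap)

theorem extModMap_sub (φ : B →ₐ[R] B') (x y : ExtMod R B Q) :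
    extModMap R Q φ (x - y) = extModMap R Q φ x - extModMap R Q φ y :=
  map_sub (LinearMap.rTensor Q φ.toLinearMap) x y

theorem extModMap_tmul (φ : B →ₐ[R] B') (b : B) (q : Q) :
    extModMap R Q φ (ExtMod.tmul R b q) = ExtMod.tmul R (φ b) q := rfl

theorem extModMap_comp (φ : B →ₐ[R] B') (ψ : B' →ₐ[R] B'') (x : ExtMod R B Q) :
    extModMap R Q (ψ.comp φ) x = extModMap R Q ψ (extModMap R Q φ x) :=
  LinearMap.rTensor_comp_apply Q ψ.toLinearMap φ.toLinearMap x

theorem extModMap_id (x : ExtMod R B Q) : extModMap R Q (AlgHom.id R B) x = x :=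
  LinearMap.rTensor_id_apply Q B x

@[elab_as_elim]
theorem ExtMod.induction {motive : ExtMod R B Q → Prop} (x : ExtMod R B Q) (zero : motive 0)
    (add : ∀ x y, motive x → motive y → motive (x + y))
    (tmul : ∀ b q, motive (ExtMod.tmul R b q)) : motive x :=
  TensorProduct.induction_on (motive := motive) x zero tmul add

theorem extModMap_smul (φ : B →ₐ[R] B') (c : ExtRing R B A) (x : ExtMod R B Q) :
    extModMap R Q φ (c • x) = extRingMap R A φ c • extModMap R Q φ x := by
  induction c using TensorProduct.induction_on with
  | zero => rw [zero_smul, map_zero, zero_smul, extModMap_zero]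
  | add c d hc hd => rw [add_smul, extModMap_add, hc, hd, map_add, add_smul]
  | tmul b a =>
    induction x using ExtMod.induction with
    | zero => simp only [smul_zero, extModMap_zero]
    | add x y hx hy => simp only [smul_add, extModMap_add, hx, hy]
    | tmul b' q =>
      rw [ext_smul_tmul, extModMap_tmul, extModMap_tmul, map_mul]
      exact (ext_smul_tmul (φ b) (φ b') a q).symm

theorem tmul_eq_smul (b : B) (q : Q) :
    ExtMod.tmul R b q = (b ⊗ₜ[R] (1 : A) : ExtRing R B A) • ExtMod.tmul R (1 : B) q := by
  rw [ext_smul_tmul, one_smul, mul_one]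

theorem smul_tmul_one (a : A) (q : Q) :
    ((1 : B) ⊗ₜ[R] a : ExtRing R B A) • ExtMod.tmul R (1 : B) q =
      ExtMod.tmul R (1 : B) (a • q) := by
  rw [ext_smul_tmul, mul_one]

/-- Two `A_B`-linear maps on `Q_B` which agree on the elements `1 ⊗ q` are equal. -/
theorem extMod_hom_ext {N : Type*} [AddCommGroup N] [Module (ExtRing R B A) N]
    {f g : ExtMod R B Q →ₗ[ExtRing R B A] N}
    (H : ∀ q : Q, f (ExtMod.tmul R (1 : B) q) = g (ExtMod.tmul R (1 : B) q)) : f = g := by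
  ext x
  induction x using ExtMod.induction with
  | zero => rw [map_zero, map_zero]
  | add x y hx hy => rw [map_add, map_add, hx, hy]
  | tmul b q => rw [tmul_eq_smul (A := A), map_smul, map_smul, H]

/-- An additive map `g : Q → N` into an `A_B`-module which is linear over `A` extends to an
`A_B`-linear map `Q_B → N`. -/
def extLift {N : Type*} [AddCommGroup N] [Module (ExtRing R B A) N] (g : Q →+ N)
    (hg : ∀ (a : A) (q : Q), g (a • q) = ((1 : B) ⊗ₜ[R] a : ExtRing R B A) • g q) :
    ExtMod R B Q →ₗ[ExtRing R B A] N :=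
  let f₀ : B →+ Q →+ N := AddMonoidHom.mk' (fun b => AddMonoidHom.mk'
      (fun q => (b ⊗ₜ[R] (1 : A) : ExtRing R B A) • g q)
      (fun x y => by rw [map_add, smul_add]))
      (fun b b' => by ext q; simp [TensorProduct.add_tmul, add_smul])
  let f : ExtMod R B Q →+ N := TensorProduct.liftAddHom f₀ (fun r b q => by
      change ((r • b) ⊗ₜ[R] (1 : A) : ExtRing R B A) • g q
        = (b ⊗ₜ[R] (1 : A) : ExtRing R B A) • g (r • q)
      rw [← algebraMap_smul A r q, hg, smul_smul, Algebra.TensorProduct.tmul_mul_tmul, mul_one,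
        one_mul, Algebra.algebraMap_eq_smul_one, TensorProduct.smul_tmul])
  { f with
    map_smul' := fun c x => by
      change f (c • x) = c • f x
      have hf : ∀ b q, f (ExtMod.tmul R b q) = (b ⊗ₜ[R] (1 : A) : ExtRing R B A) • g q :=
        fun b q => rfl
      induction x using ExtMod.induction with
      | zero => simp
      | add x y hx hy => simp only [smul_add, map_add, hx, hy]
      | tmul b q =>
        induction c using TensorProduct.induction_on with
        | zero => simp
        | add c d hc hd => simp only [add_smul, map_add, hc, hd]
        | tmul b' a =>
          rw [ext_smul_tmul, hf, hf, hg, smul_smul, smul_smul, Algebra.TensorProduct.tmul_mul_tmul,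
            Algebra.TensorProduct.tmul_mul_tmul, mul_one, one_mul, mul_one] }

theorem extLift_tmul_one {N : Type*} [AddCommGroup N] [Module (ExtRing R B A) N] (g : Q →+ N)
    (hg : ∀ (a : A) (q : Q), g (a • q) = ((1 : B) ⊗ₜ[R] a : ExtRing R B A) • g q) (q : Q) :
    extLift g hg (ExtMod.tmul R (1 : B) q) = g q := by
  change ((1 : B) ⊗ₜ[R] (1 : A) : ExtRing R B A) • g q = g q
  rw [← Algebra.TensorProduct.one_def, one_smul]

/-- The additive map `q ↦ 1 ⊗ q`. -/
def tmulOne (R : Type*) [CommRing R] (B : Type*) [CommRing B] [Algebra R B]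
    (Q : Type*) [AddCommGroup Q] [Module R Q] : Q →+ ExtMod R B Q :=
  AddMonoidHom.mk' (fun q => ExtMod.tmul R (1 : B) q) fun x y => TensorProduct.tmul_add 1 x y

theorem tmulOne_apply (q : Q) : tmulOne R B Q q = ExtMod.tmul R (1 : B) q := rfl

/-- The map `Q_B → Q_B'` as an additive map. -/
def extModMapHom (φ : B →ₐ[R] B') : ExtMod R B Q →+ ExtMod R B' Q :=
  AddMonoidHom.mk' (extModMap R Q φ) (extModMap_add φ)

theorem extRingMap_tmul_one (φ : B →ₐ[R] B') (a : A) :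
    extRingMap R A φ ((1 : B) ⊗ₜ[R] a) = (1 : B') ⊗ₜ[R] a := by
  simp [extRingMap]

/-- Extension of scalars along `φ` of an endomorphism of `Q_B`. -/
def extEnd (φ : B →ₐ[R] B') (f : ExtMod R B Q →ₗ[ExtRing R B A] ExtMod R B Q) :
    ExtMod R B' Q →ₗ[ExtRing R B' A] ExtMod R B' Q :=
  extLift ((extModMapHom φ).comp ((f : ExtMod R B Q →+ ExtMod R B Q).comp (tmulOne R B Q)))
    fun a q => by
      change extModMap R Q φ (f (ExtMod.tmul R 1 (a • q))) =
        _ • extModMap R Q φ (f (ExtMod.tmul R 1 q))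
      rw [← smul_tmul_one, map_smul, extModMap_smul, extRingMap_tmul_one]

theorem extEnd_map (φ : B →ₐ[R] B') (f : ExtMod R B Q →ₗ[ExtRing R B A] ExtMod R B Q)
    (x : ExtMod R B Q) : extEnd φ f (extModMap R Q φ x) = extModMap R Q φ (f x) := by
  induction x using ExtMod.induction with
  | zero => rw [extModMap_zero, map_zero, map_zero, extModMap_zero]
  | add x y hx hy => rw [extModMap_add, map_add, map_add, extModMap_add, hx, hy]
  | tmul b q =>
    rw [tmul_eq_smul (A := A), extModMap_smul, map_smul, map_smul, extModMap_smul, extModMap_tmul,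
      map_one, extEnd, extLift_tmul_one]
    rfl

theorem extEnd_unique {φ : B →ₐ[R] B'} {f : ExtMod R B Q →ₗ[ExtRing R B A] ExtMod R B Q}
    {g : ExtMod R B' Q →ₗ[ExtRing R B' A] ExtMod R B' Q}
    (H : ∀ x, g (extModMap R Q φ x) = extModMap R Q φ (f x)) : g = extEnd φ f :=
  extMod_eq (φ := φ) _ _ fun x => by rw [H, extEnd_map]

variable (R A Q) in
/-- The group `Aut (Q_B)`. -/
abbrev AutExt (B : Type*) [CommRing B] [Algebra R B] : Type _ :=
  ExtMod R B Q ≃ₗ[ExtRing R B A] ExtMod R B Q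

/-- Extension of scalars along `φ` as a homomorphism `Aut (Q_B) → Aut (Q_B')`. -/
def extAut (φ : B →ₐ[R] B') : AutExt R A Q B →* AutExt R A Q B' where
  toFun g := LinearEquiv.ofLinearMap (extEnd φ g.toLinearMap) (extEnd φ (g⁻¹).toLinearMap)
    (extMod_eq (φ := φ) _ _ fun x => by
      simp only [LinearMap.comp_apply, extEnd_map, LinearMap.id_apply]
      exact congrArg _ (g.apply_symm_apply x))
    (extMod_eq (φ := φ) _ _ fun x => by
      simp only [LinearMap.comp_apply, extEnd_map, LinearMap.id_apply]
      exact congrArg _ (g.symm_apply_apply x))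
  map_one' := LinearEquiv.toLinearMap_injective <|
    extMod_eq (φ := φ) _ _ fun x => extEnd_map φ _ x
  map_mul' g h := LinearEquiv.toLinearMap_injective <| extMod_eq (φ := φ) _ _ fun x =>
    (extEnd_map φ _ x).trans
      ((extEnd_map φ g.toLinearMap (h x)).symm.trans
        (congrArg (extEnd φ g.toLinearMap) (extEnd_map φ h.toLinearMap x).symm))

theorem extAut_map (φ : B →ₐ[R] B') (g : AutExt R A Q B) (x : ExtMod R B Q) :
    extAut φ g (extModMap R Q φ x) = extModMap R Q φ (g x) :=
  extEnd_map φ g.toLinearMap x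

/-- To identify `extAut φ g` it suffices to compare with `g` on the image of `Q_B`, which generates
`Q_B'` over `A_B'`. -/
theorem extAut_eq {φ : B →ₐ[R] B'} {g : AutExt R A Q B} {g' : AutExt R A Q B'}
    (H : ∀ x, g' (extModMap R Q φ x) = extModMap R Q φ (g x)) : extAut φ g = g' :=
  LinearEquiv.toLinearMap_injective (extEnd_unique (f := g.toLinearMap) H).symm

theorem extAut_comp (φ : B →ₐ[R] B') (ψ : B' →ₐ[R] B'') (g : AutExt R A Q B) :
    extAut (ψ.comp φ) g = extAut ψ (extAut φ g) :=
  extAut_eq fun x => by rw [extModMap_comp, extAut_map, extAut_map, extModMap_comp]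

theorem extAut_id (g : AutExt R A Q B) : extAut (AlgHom.id R B) g = g :=
  extAut_eq fun x => by rw [extModMap_id, extModMap_id]

/-- An automorphism of `Q_B` is determined by its values on the elements `1 ⊗ q`. -/
theorem autExt_ext {g h : AutExt R A Q B}
    (H : ∀ q : Q, g (ExtMod.tmul R (1 : B) q) = h (ExtMod.tmul R (1 : B) q)) : g = h :=
  LinearEquiv.toLinearMap_injective (extMod_hom_ext H)

theorem extAut_tmul_one (φ : B →ₐ[R] B') (g : AutExt R A Q B) (q : Q) :
    extAut φ g (ExtMod.tmul R (1 : B') q) = extModMap R Q φ (g (ExtMod.tmul R (1 : B) q)) := by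
  rw [← extAut_map, extModMap_tmul, map_one]

end BaseChangeAut

/-! ### Localization of polynomial rings and of extended modules -/

section Localization

variable {R : Type*} [CommRing R]
  {B : Type*} [CommRing B] [Algebra R B] {B' : Type*} [CommRing B'] [Algebra R B']

/-- The homomorphism `φ : B → B'` of `R`-algebras is the localization at the powers of `s ∈ R`. -/
structure IsLocAway (s : R) (φ : B →ₐ[R] B') : Prop where
  unit : IsUnit (algebraMap R B' s)
  surj : ∀ y : B', ∃ k : ℕ, ∃ x : B, s ^ k • y = φ x
  ker : ∀ x : B, φ x = 0 → ∃ k : ℕ, s ^ k • x = 0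

theorem isLocAway_localization (s : R) :
    IsLocAway s (Algebra.ofId R (Localization.Away s)) where
  unit := IsLocalization.Away.algebraMap_isUnit s
  surj y := by
    obtain ⟨k, x, hx⟩ := IsLocalization.Away.surj s y
    refine ⟨k, x, ?_⟩
    rw [Algebra.smul_def, map_pow, mul_comm, hx]
    rfl
  ker x hx := by
    have h0 : algebraMap R (Localization.Away s) x = 0 := hx
    obtain ⟨⟨_, k, rfl⟩, hk⟩ :=
      (IsLocalization.map_eq_zero_iff (Submonoid.powers s) (Localization.Away s) x).1 h0
    exact ⟨k, hk⟩

theorem IsLocAway.polynomial {s : R} {φ : B →ₐ[R] B'} (h : IsLocAway s φ) :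
    IsLocAway s (Polynomial.mapAlgHom φ) where
  unit := by
    rw [Polynomial.algebraMap_apply]
    exact h.unit.map Polynomial.C
  surj y := by
    induction y using Polynomial.induction_on' with
    | add p q hp hq =>
      obtain ⟨k, x, hx⟩ := hp
      obtain ⟨l, y, hy⟩ := hq
      refine ⟨k + l, s ^ l • x + s ^ k • y, ?_⟩
      rw [map_add, map_smul, map_smul, ← hx, ← hy, smul_add, smul_smul, smul_smul, ← pow_add,
        ← pow_add, add_comm l k]
    | monomial n a =>
      obtain ⟨k, x, hx⟩ := h.surj a
      refine ⟨k, Polynomial.monomial n x, ?_⟩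
      rw [Polynomial.smul_monomial, hx]
      simp
  ker x hx := by
    have h1 : ∀ n, ∃ k : ℕ, s ^ k • x.coeff n = 0 := fun n => by
      apply h.ker
      have := congrArg (fun p => Polynomial.coeff p n) hx
      simpa using this
    choose k hk using h1
    refine ⟨∑ n ∈ x.support, k n, ?_⟩
    ext n
    rw [Polynomial.coeff_smul, Polynomial.coeff_zero]
    by_cases hn : n ∈ x.support
    · rw [← Nat.sub_add_cancel (Finset.single_le_sum (f := k) (fun _ _ => Nat.zero_le _) hn),
        pow_add, mul_smul, hk, smul_zero]
    · rw [Polynomial.notMem_support_iff.1 hn, smul_zero]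

theorem IsLocAway.isLocalizedModule {s : R} {φ : B →ₐ[R] B'} (h : IsLocAway s φ) :
    IsLocalizedModule (Submonoid.powers s) φ.toLinearMap where
  map_units := by
    rintro ⟨_, k, rfl⟩
    have h1 : IsUnit (algebraMap R B' (s ^ k)) := by rw [map_pow]; exact h.unit.pow k
    obtain ⟨u, hu⟩ := h1
    rw [Module.End.isUnit_iff]
    have : ∀ y : B', (algebraMap R (Module.End R B') (s ^ k)) y = u • y := fun y => by
      rw [Module.algebraMap_end_apply, Algebra.smul_def, ← hu]; rfl
    constructor
    · intro y z hyz
      have hyz' : (algebraMap R (Module.End R B') (s ^ k)) y =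
        (algebraMap R (Module.End R B') (s ^ k)) z := hyz
      rw [this, this] at hyz'
      exact smul_left_cancel u hyz'
    · intro y
      exact ⟨u⁻¹ • y, (this _).trans (smul_inv_smul u y)⟩
  surj y := by
    obtain ⟨k, x, hx⟩ := h.surj y
    exact ⟨⟨x, ⟨s ^ k, k, rfl⟩⟩, hx⟩
  exists_of_eq {x y} hxy := by
    obtain ⟨k, hk⟩ := h.ker (x - y) (by rw [map_sub]; exact sub_eq_zero.2 hxy)
    refine ⟨⟨s ^ k, k, rfl⟩, ?_⟩
    rw [smul_sub, sub_eq_zero] at hk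
    exact hk

variable {Q : Type*} [AddCommGroup Q] [Module R Q]

/-- The kernel of `B ⊗ Q → B' ⊗ Q` is killed by powers of `s`. No flatness of `Q` is needed, since
this map is again a localization. -/
theorem IsLocAway.rTensor_ker {s : R} {φ : B →ₐ[R] B'} (h : IsLocAway s φ)
    {x : B ⊗[R] Q} (hx : LinearMap.rTensor Q φ.toLinearMap x = 0) :
    ∃ k : ℕ, ∀ l, k ≤ l → s ^ l • x = 0 := by
  have := h.isLocalizedModule
  have h2 := IsLocalizedModule.rTensor (R := R) R (Submonoid.powers s) (N := Q) φ.toLinearMap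
  have h3 : (TensorProduct.AlgebraTensorModule.rTensor R Q φ.toLinearMap) x = 0 := hx
  obtain ⟨⟨_, k, rfl⟩, hk⟩ := (IsLocalizedModule.eq_zero_iff (Submonoid.powers s) _).1 h3
  refine ⟨k, fun l hl => ?_⟩
  have hk' : s ^ k • x = 0 := hk
  rw [← Nat.sub_add_cancel hl, pow_add, mul_smul, hk', smul_zero]

end Localization

/-! ### The dilations `X ↦ b X` -/

section Dilation

variable {R : Type*} [CommRing R]
  {B : Type*} [CommRing B] [Algebra R B] {B' : Type*} [CommRing B'] [Algebra R B']

/-- The endomorphism `X ↦ b X` of `B[X]`. -/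
def dil (B : Type*) [CommRing B] [Algebra R B] (b : R) : B[X] →ₐ[R] B[X] :=
  (Polynomial.aeval (algebraMap R B[X] b * Polynomial.X) : B[X] →ₐ[B] B[X]).restrictScalars R

theorem dil_C (b : R) (c : B) : dil B b (Polynomial.C c) = Polynomial.C c := by
  simp [dil, Polynomial.algebraMap_eq]

theorem dil_X (b : R) : dil B b Polynomial.X = algebraMap R B[X] b * Polynomial.X := by
  simp [dil]

theorem dil_monomial (b : R) (n : ℕ) (c : B) :
    dil B b (Polynomial.monomial n c) = b ^ n • Polynomial.monomial n c := by
  rw [← Polynomial.C_mul_X_pow_eq_monomial, map_mul, map_pow, dil_C, dil_X, mul_pow, ← map_pow,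
    mul_left_comm, ← Algebra.smul_def]

theorem algHom_polynomial_ext {f g : B[X] →ₐ[R] B'}
    (hC : ∀ c : B, f (Polynomial.C c) = g (Polynomial.C c))
    (hX : f Polynomial.X = g Polynomial.X) : f = g :=
  Polynomial.algHom_ext' (AlgHom.ext hC) hX

theorem dil_comp_dil (b c : R) : (dil B b).comp (dil B c) = dil B (b * c) :=
  algHom_polynomial_ext (fun x => by simp [dil_C]) (by
    rw [AlgHom.comp_apply, dil_X, dil_X, map_mul, AlgHom.commutes, dil_X, map_mul]
    ring)

theorem map_comp_dil (φ : B →ₐ[R] B') (b : R) :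
    (Polynomial.mapAlgHom φ).comp (dil B b) = (dil B' b).comp (Polynomial.mapAlgHom φ) :=
  algHom_polynomial_ext (fun x => by simp [dil_C]) (by
    rw [AlgHom.comp_apply, dil_X, map_mul, AlgHom.commutes, AlgHom.comp_apply]
    simp [dil_X])

/-- If an element of `Q_{B[X]}` vanishes both at `X = 0` and after localization at `s`, then it
is killed by the substitution of `s^k X` for `X`. -/
theorem rTensor_dil_eq_zero {Q : Type*} [AddCommGroup Q] [Module R Q] {s : R}
    {φ : B[X] →ₐ[R] B'} (h : IsLocAway s φ) {x : B[X] ⊗[R] Q}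
    (hx : LinearMap.rTensor Q φ.toLinearMap x = 0)
    (hx0 : LinearMap.rTensor Q (dil B (0 : R)).toLinearMap x = 0) :
    ∃ k : ℕ, ∀ l, k ≤ l → LinearMap.rTensor Q (dil B (s ^ l)).toLinearMap x = 0 := by
  obtain ⟨k, hk⟩ := h.rTensor_ker hx
  refine ⟨k, fun l hl => ?_⟩
  -- With `p = p(0) + X q` one has `p(bX) = p(0) + b X q(bX)`, which is linear in `b p`.
  let ψ : B[X] →ₗ[R] B[X] :=
    { toFun := fun p => Polynomial.X * dil B (s ^ l) p.divX
      map_add' := fun p q => by rw [Polynomial.divX_add, map_add, mul_add]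
      map_smul' := fun r p => by
        have : (r • p).divX = r • p.divX := by
          ext n; simp [Polynomial.coeff_divX]
        rw [this, map_smul, mul_smul_comm, RingHom.id_apply] }
  have key : (dil B (s ^ l)).toLinearMap = (dil B (0 : R)).toLinearMap + s ^ l • ψ := by
    ext1 p
    have hp : ∀ b : R, dil B b p =
        b • (Polynomial.X * dil B b p.divX) + Polynomial.C (p.coeff 0) := fun b => by
      conv_lhs => rw [← Polynomial.X_mul_divX_add p]
      rw [map_add, map_mul, dil_X, dil_C, Algebra.smul_def, mul_assoc]
    have h0 := hp 0
    rw [zero_smul, zero_add] at h0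
    change dil B (s ^ l) p = dil B (0 : R) p + s ^ l • (Polynomial.X * dil B (s ^ l) p.divX)
    rw [h0, add_comm]
    exact hp _
  rw [key, LinearMap.rTensor_add, LinearMap.add_apply, hx0, LinearMap.rTensor_smul,
    LinearMap.smul_apply, zero_add, ← map_smul, hk l hl, map_zero]

variable {A : Type*} [Ring A] [Algebra R A]
  {Q : Type*} [AddCommGroup Q] [Module R Q] [Module A Q] [IsScalarTower R A Q]

/-- Two automorphisms of `Q_{B[X]}` which agree at `X = 0` and after localization at `s` agree after
the substitution of `s^k X` for `X`. -/
theorem extAut_dil_eq [Module.Finite A Q] {s : R} {φ : B[X] →ₐ[R] B'} (h : IsLocAway s φ)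
    {g g' : AutExt R A Q B[X]} (hφ : extAut φ g = extAut φ g')
    (h0 : extAut (dil B (0 : R)) g = extAut (dil B (0 : R)) g') :
    ∃ k : ℕ, extAut (dil B (s ^ k)) g = extAut (dil B (s ^ k)) g' := by
  obtain ⟨T, hT⟩ := (Module.Finite.fg_top (R := A) (M := Q))
  have key : ∀ q : Q, ∃ k : ℕ, ∀ l, k ≤ l → extModMap R Q (dil B (s ^ l))
      (g (ExtMod.tmul R 1 q) - g' (ExtMod.tmul R 1 q)) = 0 := fun q => by
    refine rTensor_dil_eq_zero h
      (x := g (ExtMod.tmul R 1 q) - g' (ExtMod.tmul R 1 q)) ?_ ?_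
    · change extModMap R Q φ _ = 0
      rw [extModMap_sub, ← extAut_tmul_one, ← extAut_tmul_one, hφ, sub_self]
    · change extModMap R Q (dil B (0 : R)) _ = 0
      rw [extModMap_sub, ← extAut_tmul_one, ← extAut_tmul_one, h0, sub_self]
  choose k hk using key
  refine ⟨∑ q ∈ T, k q, ?_⟩
  set N := ∑ q ∈ T, k q with hN
  apply autExt_ext
  intro q
  have hq : q ∈ Submodule.span A (T : Set Q) := hT ▸ Submodule.mem_top
  induction hq using Submodule.span_induction with
  | mem x hx =>
    have := hk x N (Finset.single_le_sum (f := k) (fun _ _ => Nat.zero_le _) hx)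
    rw [extModMap_sub, ← extAut_tmul_one, ← extAut_tmul_one, sub_eq_zero] at this
    exact this
  | zero =>
    have : ExtMod.tmul R (1 : B[X]) (0 : Q) = 0 := (tmulOne R B[X] Q).map_zero
    rw [this, map_zero, map_zero]
  | add x y _ _ hx hy =>
    have : ExtMod.tmul R (1 : B[X]) (x + y) = _ := (tmulOne R B[X] Q).map_add x y
    rw [this, map_add, map_add]
    exact congrArg₂ (· + ·) hx hy
  | smul a x _ hx => rw [← smul_tmul_one, map_smul, map_smul, hx]

end Dilation

/-! ### The local-global principle for a functorial family of subgroups -/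

section LocalGlobal

universe u

variable {R : Type u} [CommRing R]

/-- The homomorphism `X ↦ T + b X` from `B[X]` to `B[T][X]`. -/
def shift (B : Type*) [CommRing B] [Algebra R B] (b : R) : B[X] →ₐ[R] B[X][X] :=
  (Polynomial.aeval (Polynomial.C Polynomial.X + algebraMap R B[X][X] b * Polynomial.X) :
    B[X] →ₐ[B] B[X][X]).restrictScalars R

/-- The endomorphism `T ↦ T + b X` of `R[T][X]`. -/
def shiftInner (b : R) : R[X][X] →ₐ[R] R[X][X] :=
  { Polynomial.eval₂RingHom (shift R b).toRingHom Polynomial.X with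
    commutes' := fun r => by
      change Polynomial.eval₂ (shift R b).toRingHom Polynomial.X (algebraMap R R[X][X] r) = _
      rw [Polynomial.algebraMap_apply, Polynomial.eval₂_C]
      exact (shift R b).commutes r }

/-- The homomorphism `T ↦ 0` from `R[T][X]` to `R[X]`. -/
def innerZero (R : Type*) [CommRing R] : R[X][X] →ₐ[R] R[X] :=
  Polynomial.mapAlgHom (Polynomial.aeval 0)

section

variable {B : Type*} [CommRing B] [Algebra R B] {B' : Type*} [CommRing B'] [Algebra R B']

theorem shift_X (b : R) : shift B b Polynomial.X =
    Polynomial.C Polynomial.X + algebraMap R B[X][X] b * Polynomial.X := by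
  simp [shift]

theorem shift_C (b : R) (c : B) : shift B b (Polynomial.C c) =
    Polynomial.C (Polynomial.C c) := by
  simp [shift, Polynomial.algebraMap_eq]

theorem map_comp_shift (φ : B →ₐ[R] B') (b : R) :
    (Polynomial.mapAlgHom (Polynomial.mapAlgHom φ)).comp (shift B b) =
      (shift B' b).comp (Polynomial.mapAlgHom φ) :=
  algHom_polynomial_ext (fun x => by simp [shift_C]) (by
    rw [AlgHom.comp_apply, shift_X, map_add, map_mul, AlgHom.commutes, AlgHom.comp_apply]
    simp [shift_X])

end

theorem shiftInner_X (b : R) : shiftInner b Polynomial.X = Polynomial.X :=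
  Polynomial.eval₂_X _ _

theorem shiftInner_C (b : R) (p : R[X]) : shiftInner b (Polynomial.C p) = shift R b p :=
  Polynomial.eval₂_C _ _

theorem dil_comp_shift (c b : R) : (dil R[X] c).comp (shift R b) = shift R (c * b) :=
  Polynomial.algHom_ext (by
    rw [AlgHom.comp_apply, shift_X, shift_X, map_add, dil_C, map_mul, AlgHom.commutes, dil_X,
      map_mul]
    ring)

theorem shiftInner_comp_shift (c b : R) :
    (shiftInner c).comp (shift R b) = shift R (b + c) :=
  Polynomial.algHom_ext (by
    rw [AlgHom.comp_apply, shift_X, shift_X, map_add, shiftInner_C, map_mul, AlgHom.commutes,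
      shiftInner_X, shift_X, map_add]
    ring)

theorem innerZero_comp_shift_one : (innerZero R).comp (shift R 1) = AlgHom.id R R[X] :=
  Polynomial.algHom_ext (by simp [shift_X, innerZero])

theorem innerZero_comp_shift_zero :
    (innerZero R).comp (shift R 0) = (Algebra.ofId R R[X]).comp (evalZero R) :=
  Polynomial.algHom_ext (by simp [shift_X, innerZero, evalZero])

variable {A : Type*} [Ring A] [Algebra R A]
  {Q : Type*} [AddCommGroup Q] [Module R Q] [Module A Q] [IsScalarTower R A Q]

/-- The map `R[T][X] → R_s[T][X]`. -/
abbrev polyLoc₂ (R : Type*) [CommRing R] (s : R) : R[X][X] →ₐ[R] (Localization.Away s)[X][X] :=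
  Polynomial.mapAlgHom (polyLoc R s)

theorem isLocAway_polyLoc₂ (s : R) :
    IsLocAway (B' := (Localization.Away s)[X][X]) s (polyLoc₂ R s) :=
  (isLocAway_localization s).polynomial.polynomial

/-- A loop `τ(X)` with `τ(0) = 1` lies in a functorial family of subgroups `E` if locally it does so
and the family locally has the dilation property: for `θ(X) ∈ E(R_s[T][X])`, the element
`θ(s^N X) θ(0)⁻¹` comes from `E(R[T][X])` when `N` is large. The proof is that of Quillen: the
`b ∈ R` such that `τ(T + b X) τ(T)⁻¹` lies in `E(R[T][X])` form an ideal. -/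
theorem mem_of_locally_mem [Module.Finite A Q]
    (E : ∀ (B : Type u) [CommRing B] [Algebra R B], Subgroup (AutExt R A Q B))
    (hE : ∀ (B B' : Type u) [CommRing B] [Algebra R B] [CommRing B'] [Algebra R B']
      (φ : B →ₐ[R] B') (g : AutExt R A Q B), g ∈ E B → extAut φ g ∈ E B')
    (τ : AutExt R A Q R[X]) (hτ : extAut (evalZero R) τ = 1)
    (hloc : ∀ m : Ideal R, m.IsMaximal → ∃ s, s ∉ m ∧
      extAut (polyLoc R s) τ ∈ E (Localization.Away s)[X] ∧
      ∀ θ ∈ E (Localization.Away s)[X][X], ∃ N : ℕ, ∃ β ∈ E R[X][X],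
        extAut (polyLoc₂ R s) β = extAut (dil _ (s ^ N)) θ * (extAut (dil _ (0 : R)) θ)⁻¹) :
    τ ∈ E R[X] := by
  have h0 : ∀ c : R, (dil R[X] c).comp (shift R 0) = shift R 0 := fun c => by
    rw [dil_comp_shift, mul_zero]
  let I : Ideal R :=
    { carrier := {b | extAut (shift R b) τ * (extAut (shift R (0 : R)) τ)⁻¹ ∈ E R[X][X]}
      zero_mem' := by
        change extAut (shift R (0 : R)) τ * (extAut (shift R (0 : R)) τ)⁻¹ ∈ E R[X][X]
        rw [mul_inv_cancel]; exact one_mem _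
      -- Substitute `T + c X` for `T` in `τ(T + b X) τ(T)⁻¹` and multiply by `τ(T + c X) τ(T)⁻¹`.
      add_mem' := fun {b c} hb hc => by
        have h1 := hE _ _ (shiftInner c) _ hb
        rw [map_mul, map_inv, ← extAut_comp, ← extAut_comp, shiftInner_comp_shift,
          shiftInner_comp_shift, zero_add] at h1
        have h2 := mul_mem h1 hc
        rwa [mul_assoc, inv_mul_cancel_left] at h2
      smul_mem' := fun c b hb => by
        have h1 := hE _ _ (dil R[X] c) _ hb
        rw [map_mul, map_inv, ← extAut_comp, ← extAut_comp, h0, dil_comp_shift] at h1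
        exact h1 }
  have hI : I = ⊤ := by
    by_contra hne
    obtain ⟨m, hm, hIm⟩ := Ideal.exists_le_maximal I hne
    obtain ⟨s, hs, hτs, hdil⟩ := hloc m hm
    set θ := extAut (shift R (1 : R)) τ * (extAut (shift R (0 : R)) τ)⁻¹ with hθ
    have hcomp : ∀ b : R, extAut (polyLoc₂ R s) (extAut (shift R b) τ) ∈
        E (Localization.Away s)[X][X] := fun b => by
      have : (polyLoc₂ R s).comp (shift R b) =
          (shift (Localization.Away s) b).comp (polyLoc R s) := map_comp_shift _ b
      rw [← extAut_comp, this, extAut_comp]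
      exact hE _ _ _ _ hτs
    have hθs : extAut (polyLoc₂ R s) θ ∈ E (Localization.Away s)[X][X] := by
      rw [hθ, map_mul, map_inv]
      exact mul_mem (hcomp 1) (inv_mem (hcomp 0))
    have hθ0 : ∀ c : R, extAut (dil R[X] c) θ =
        extAut (shift R c) τ * (extAut (shift R (0 : R)) τ)⁻¹ := fun c => by
      rw [hθ, map_mul, map_inv, ← extAut_comp, ← extAut_comp, dil_comp_shift, h0, mul_one]
    obtain ⟨N, β, hβ, hβs⟩ := hdil _ hθs
    have hc : ∀ b : R, (polyLoc₂ R s).comp (dil R[X] b) = (dil _ b).comp (polyLoc₂ R s) :=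
      fun b => map_comp_dil _ b
    rw [← extAut_comp, ← extAut_comp, ← hc, ← hc, extAut_comp, extAut_comp, hθ0 0,
      mul_inv_cancel, map_one, inv_one, mul_one] at hβs
    -- Normalize `β` so that it is trivial at `X = 0`.
    have hd0 : ∀ b c : R, extAut (dil R[X] b) (extAut (dil R[X] c) β) =
        extAut (dil R[X] (b * c)) β := fun b c => by
      rw [← extAut_comp, dil_comp_dil]
    have hβ0 : extAut (B' := (Localization.Away s)[X][X]) (polyLoc₂ R s)
        (extAut (dil R[X] (0 : R)) β) = 1 := by
      rw [← extAut_comp, hc, extAut_comp, hβs, ← extAut_comp, ← extAut_comp, ← hc,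
        AlgHom.comp_assoc, dil_comp_dil, zero_mul, extAut_comp, hθ0 0, mul_inv_cancel,
        map_one]
    obtain ⟨K, hK⟩ := extAut_dil_eq (isLocAway_polyLoc₂ s)
      (g := β * (extAut (dil R[X] (0 : R)) β)⁻¹) (g' := extAut (dil R[X] (s ^ N)) θ)
      (by rw [map_mul, map_inv, hβ0, inv_one, mul_one, hβs])
      (by rw [map_mul, map_inv, hd0, mul_zero, mul_inv_cancel, ← extAut_comp, dil_comp_dil,
        zero_mul, hθ0 0, mul_inv_cancel])
    -- A power of `s` lies in `I`, although `s ∉ m` and `I ≤ m`.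
    have hmem : s ^ K * s ^ N ∈ I := by
      change extAut (shift R (s ^ K * s ^ N)) τ * (extAut (shift R (0 : R)) τ)⁻¹ ∈ E R[X][X]
      rw [← hθ0, ← dil_comp_dil, extAut_comp, ← hK]
      exact hE _ _ _ _ (mul_mem hβ (inv_mem (hE _ _ _ _ hβ)))
    rw [← pow_add] at hmem
    exact hs (hm.isPrime.mem_of_pow_mem _ (hIm hmem))
  -- The substitution `T = 0` in `τ(T + X) τ(T)⁻¹` gives `τ(X) τ(0)⁻¹ = τ(X)`.
  have h1 : (1 : R) ∈ I := hI ▸ Submodule.mem_top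
  have h2 := hE _ _ (innerZero R) _ h1
  rw [map_mul, map_inv, ← extAut_comp, ← extAut_comp, innerZero_comp_shift_one,
    innerZero_comp_shift_zero, extAut_comp _ (Algebra.ofId R R[X]), hτ, map_one, inv_one, mul_one,
    extAut_id] at h2
  exact h2

end LocalGlobal

/-! ### The modules `P ⊕ A` and `P ⊥ A²` after extension of scalars -/

section Transport

/-- Conjugation by a linear equivalence, as an isomorphism of automorphism groups. -/
def conjAut {C M N : Type*} [Ring C] [AddCommGroup M] [Module C M] [AddCommGroup N] [Module C N]
    (e : M ≃ₗ[C] N) : (M ≃ₗ[C] M) ≃* (N ≃ₗ[C] N) where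
  toFun g := e.symm.trans (g.trans e)
  invFun g := e.trans (g.trans e.symm)
  left_inv g := by ext x; simp
  right_inv g := by ext x; simp
  map_mul' g h := by ext x; simp

theorem conjAut_apply {C M N : Type*} [Ring C] [AddCommGroup M] [Module C M] [AddCommGroup N]
    [Module C N] (e : M ≃ₗ[C] N) (g : M ≃ₗ[C] M) (x : N) : conjAut e g x = e (g (e.symm x)) := rfl

variable (R : Type*) [CommRing R] (B : Type*) [CommRing B] [Algebra R B]
  (A : Type*) [Ring A] [Algebra R A]

/-- Extension of scalars commutes with finite products. -/
def extProd (Q₁ Q₂ : Type*) [AddCommGroup Q₁] [Module R Q₁] [Module A Q₁] [IsScalarTower R A Q₁]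
    [AddCommGroup Q₂] [Module R Q₂] [Module A Q₂] [IsScalarTower R A Q₂] :
    ExtMod R B (Q₁ × Q₂) ≃ₗ[ExtRing R B A] ExtMod R B Q₁ × ExtMod R B Q₂ :=
  let e : ExtMod R B (Q₁ × Q₂) ≃+ ExtMod R B Q₁ × ExtMod R B Q₂ :=
    (TensorProduct.prodRight R B B Q₁ Q₂).toAddEquiv
  { e with
    map_smul' := fun c x => by
      change e (c • x) = c • e x
      have he : ∀ b q, e (ExtMod.tmul R b q) = (ExtMod.tmul R b q.1, ExtMod.tmul R b q.2) :=
        fun b q => rfl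
      induction c using TensorProduct.induction_on with
      | zero => rw [zero_smul, map_zero, zero_smul]
      | add c d hc hd => rw [add_smul, map_add, hc, hd, add_smul]
      | tmul b a =>
        induction x using ExtMod.induction with
        | zero => rw [smul_zero, map_zero, smul_zero]
        | add x y hx hy => rw [smul_add, map_add, hx, hy, map_add, smul_add]
        | tmul b' q =>
          rw [ext_smul_tmul, he, he]
          exact Prod.ext (ext_smul_tmul b b' a q.1).symm (ext_smul_tmul b b' a q.2).symm }

theorem extProd_tmul {Q₁ Q₂ : Type*} [AddCommGroup Q₁] [Module R Q₁] [Module A Q₁]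
    [IsScalarTower R A Q₁] [AddCommGroup Q₂] [Module R Q₂] [Module A Q₂] [IsScalarTower R A Q₂]
    (b : B) (q : Q₁ × Q₂) : extProd R B A Q₁ Q₂ (ExtMod.tmul R b q) =
      (ExtMod.tmul R b q.1, ExtMod.tmul R b q.2) :=
  rfl

/-- The two names for `B ⊗[R] A`, as a ring and as the extension of the module `A`. -/
def extSelf : ExtMod R B A ≃ₗ[ExtRing R B A] ExtRing R B A :=
  let e : ExtMod R B A ≃+ ExtRing R B A := AddEquiv.refl (B ⊗[R] A)
  { e with
    map_smul' := fun c x => by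
      change e (c • x) = c • e x
      have he : ∀ (b : B) (a : A), e (ExtMod.tmul R b a) = b ⊗ₜ[R] a := fun b a => rfl
      induction c using TensorProduct.induction_on with
      | zero => rw [zero_smul, map_zero, zero_smul]
      | add c d hc hd => rw [add_smul, map_add, hc, hd, add_smul]
      | tmul b a =>
        induction x using ExtMod.induction with
        | zero => rw [smul_zero, map_zero, smul_zero]
        | add x y hx hy => rw [smul_add, map_add, hx, hy, map_add, smul_add]
        | tmul b' q =>
          rw [ext_smul_tmul, he, he, smul_eq_mul, smul_eq_mul,
            Algebra.TensorProduct.tmul_mul_tmul] }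

section

variable {R B A} {P : Type*} [AddCommGroup P] [Module R P] {B' : Type*} [CommRing B'] [Algebra R B']

theorem qLinMap_add (φ : B →ₐ[R] B') (x y : QLin R B A P) :
    qLinMap R A P φ (x + y) = qLinMap R A P φ x + qLinMap R A P φ y :=
  Prod.ext (extModMap_add φ _ _) (map_add _ _ _)

theorem qPerpMap_add (φ : B →ₐ[R] B') (x y : QPerp R B A P) :
    qPerpMap R A P φ (x + y) = qPerpMap R A P φ x + qPerpMap R A P φ y :=
  Prod.ext (extModMap_add φ _ _) (Prod.ext (map_add _ _ _) (map_add _ _ _))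

end

variable (P : Type*) [AddCommGroup P] [Module R P] [Module A P] [IsScalarTower R A P]

/-- `(P ⊕ A)_B = P_B ⊕ A_B`. -/
def qLinEquiv : QLin R B A P ≃ₗ[ExtRing R B A] ExtMod R B (P × A) :=
  ((extProd R B A P A).trans ((LinearEquiv.refl _ _).prodCongr (extSelf R B A))).symm

/-- `(P ⊕ A²)_B = P_B ⊕ A_B²`. -/
def qPerpEquiv : QPerp R B A P ≃ₗ[ExtRing R B A] ExtMod R B (P × A × A) :=
  ((extProd R B A P (A × A)).trans ((LinearEquiv.refl _ _).prodCongr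
    ((extProd R B A A A).trans ((extSelf R B A).prodCongr (extSelf R B A))))).symm

variable {R B A P} {B' : Type*} [CommRing B'] [Algebra R B'] {B'' : Type*} [CommRing B'']
  [Algebra R B'']

theorem qLinEquiv_symm_map (φ : B →ₐ[R] B') (x : ExtMod R B (P × A)) :
    (qLinEquiv R B' A P).symm (extModMap R _ φ x) =
      qLinMap R A P φ ((qLinEquiv R B A P).symm x) := by
  induction x using ExtMod.induction with
  | zero =>
    rw [extModMap_zero, map_zero, map_zero]
    exact Prod.ext (extModMap_zero φ).symm (map_zero _).symm
  | add x y hx hy => rw [extModMap_add, map_add, map_add, qLinMap_add, hx, hy]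
  | tmul b q =>
    have h : ∀ (D : Type _) [CommRing D] [Algebra R D] (d : D),
        (qLinEquiv R D A P).symm (ExtMod.tmul R d q) = (ExtMod.tmul R d q.1, d ⊗ₜ[R] q.2) :=
      fun D _ _ d => congrArg (Prod.map id (extSelf R D A)) (extProd_tmul R D A d q)
    have h' : (qLinEquiv R B A P).symm (ExtMod.tmul R b q) = (ExtMod.tmul R b q.1, b ⊗ₜ[R] q.2) :=
      congrArg (Prod.map id (extSelf R B A)) (extProd_tmul R B A b q)
    rw [extModMap_tmul, h, h']
    refine Prod.ext rfl ?_
    simp [qLinMap, extRingMap]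

theorem qPerpEquiv_symm_map (φ : B →ₐ[R] B') (x : ExtMod R B (P × A × A)) :
    (qPerpEquiv R B' A P).symm (extModMap R _ φ x) =
      qPerpMap R A P φ ((qPerpEquiv R B A P).symm x) := by
  induction x using ExtMod.induction with
  | zero =>
    rw [extModMap_zero, map_zero, map_zero]
    exact Prod.ext (extModMap_zero φ).symm (Prod.ext (map_zero _).symm (map_zero _).symm)
  | add x y hx hy => rw [extModMap_add, map_add, map_add, qPerpMap_add, hx, hy]
  | tmul b q =>
    have h' : (qPerpEquiv R B A P).symm (ExtMod.tmul R b q) =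
        (ExtMod.tmul R b q.1, b ⊗ₜ[R] q.2.1, b ⊗ₜ[R] q.2.2) := by
      refine (congrArg (Prod.map id _) (extProd_tmul R B A b q)).trans (Prod.ext rfl ?_)
      exact congrArg (Prod.map (extSelf R B A) (extSelf R B A)) (extProd_tmul R B A b q.2)
    have h : (qPerpEquiv R B' A P).symm (ExtMod.tmul R (φ b) q) =
        (ExtMod.tmul R (φ b) q.1, φ b ⊗ₜ[R] q.2.1, φ b ⊗ₜ[R] q.2.2) := by
      refine (congrArg (Prod.map id _) (extProd_tmul R B' A (φ b) q)).trans (Prod.ext rfl ?_)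
      exact congrArg (Prod.map (extSelf R B' A) (extSelf R B' A)) (extProd_tmul R B' A (φ b) q.2)
    rw [extModMap_tmul, h, h']
    refine Prod.ext rfl (Prod.ext ?_ ?_) <;> simp [qPerpMap, extRingMap]

/-- Extension of scalars as a homomorphism `Aut (P_B ⊕ A_B) → Aut (P_B' ⊕ A_B')`. -/
def extLin (φ : B →ₐ[R] B') : (QLin R B A P ≃ₗ[ExtRing R B A] QLin R B A P) →*
    (QLin R B' A P ≃ₗ[ExtRing R B' A] QLin R B' A P) :=
  (conjAut (qLinEquiv R B' A P)).symm.toMonoidHom.comp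
    ((extAut φ).comp (conjAut (qLinEquiv R B A P)).toMonoidHom)

/-- Extension of scalars as a homomorphism `Aut (P_B ⊕ A_B²) → Aut (P_B' ⊕ A_B'²)`. -/
def extPerp (φ : B →ₐ[R] B') : (QPerp R B A P ≃ₗ[ExtRing R B A] QPerp R B A P) →*
    (QPerp R B' A P ≃ₗ[ExtRing R B' A] QPerp R B' A P) :=
  (conjAut (qPerpEquiv R B' A P)).symm.toMonoidHom.comp
    ((extAut φ).comp (conjAut (qPerpEquiv R B A P)).toMonoidHom)

theorem conjAut_extLin (φ : B →ₐ[R] B') (g : QLin R B A P ≃ₗ[ExtRing R B A] QLin R B A P) :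
    conjAut (qLinEquiv R B' A P) (extLin φ g) = extAut φ (conjAut (qLinEquiv R B A P) g) :=
  (conjAut (qLinEquiv R B' A P)).apply_symm_apply _

theorem conjAut_extPerp (φ : B →ₐ[R] B') (g : QPerp R B A P ≃ₗ[ExtRing R B A] QPerp R B A P) :
    conjAut (qPerpEquiv R B' A P) (extPerp φ g) = extAut φ (conjAut (qPerpEquiv R B A P) g) :=
  (conjAut (qPerpEquiv R B' A P)).apply_symm_apply _

theorem isExtLin_extLin (φ : B →ₐ[R] B') (g : QLin R B A P ≃ₗ[ExtRing R B A] QLin R B A P) :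
    IsExtLin R A P φ g (extLin φ g) := fun x => by
  have h := extAut_map φ (conjAut (qLinEquiv R B A P) g) (qLinEquiv R B A P x)
  rw [← conjAut_extLin] at h
  have h2 := congrArg (qLinEquiv R B' A P).symm h
  rwa [conjAut_apply, LinearEquiv.symm_apply_apply, conjAut_apply, qLinEquiv_symm_map,
    qLinEquiv_symm_map, LinearEquiv.symm_apply_apply, LinearEquiv.symm_apply_apply] at h2

theorem isExtPerp_extPerp (φ : B →ₐ[R] B') (g : QPerp R B A P ≃ₗ[ExtRing R B A] QPerp R B A P) :
    IsExtPerp R A P φ g (extPerp φ g) := fun x => by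
  have h := extAut_map φ (conjAut (qPerpEquiv R B A P) g) (qPerpEquiv R B A P x)
  rw [← conjAut_extPerp] at h
  have h2 := congrArg (qPerpEquiv R B' A P).symm h
  rwa [conjAut_apply, LinearEquiv.symm_apply_apply, conjAut_apply, qPerpEquiv_symm_map,
    qPerpEquiv_symm_map, LinearEquiv.symm_apply_apply, LinearEquiv.symm_apply_apply] at h2

theorem IsExtLin.eq_extLin {φ : B →ₐ[R] B'} {τ : QLin R B A P ≃ₗ[ExtRing R B A] QLin R B A P}
    {σ : QLin R B' A P ≃ₗ[ExtRing R B' A] QLin R B' A P} (h : IsExtLin R A P φ τ σ) :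
    extLin φ τ = σ :=
  (isExtLin_extLin φ τ).unique h

theorem IsExtPerp.eq_extPerp {φ : B →ₐ[R] B'}
    {τ : QPerp R B A P ≃ₗ[ExtRing R B A] QPerp R B A P}
    {σ : QPerp R B' A P ≃ₗ[ExtRing R B' A] QPerp R B' A P} (h : IsExtPerp R A P φ τ σ) :
    extPerp φ τ = σ :=
  (isExtPerp_extPerp φ τ).unique h

theorem extLin_comp (φ : B →ₐ[R] B') (ψ : B' →ₐ[R] B'')
    (g : QLin R B A P ≃ₗ[ExtRing R B A] QLin R B A P) :
    extLin (ψ.comp φ) g = extLin ψ (extLin φ g) :=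
  (conjAut (qLinEquiv R B'' A P)).injective (by
    rw [conjAut_extLin, conjAut_extLin, conjAut_extLin, extAut_comp])

theorem extPerp_comp (φ : B →ₐ[R] B') (ψ : B' →ₐ[R] B'')
    (g : QPerp R B A P ≃ₗ[ExtRing R B A] QPerp R B A P) :
    extPerp (ψ.comp φ) g = extPerp ψ (extPerp φ g) :=
  (conjAut (qPerpEquiv R B'' A P)).injective (by
    rw [conjAut_extPerp, conjAut_extPerp, conjAut_extPerp, extAut_comp])

end Transport

section LocalGlobalQ

universe u

variable {R : Type u} [CommRing R] {A : Type*} [Ring A] [Algebra R A]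
  {P : Type*} [AddCommGroup P] [Module R P] [Module A P] [IsScalarTower R A P] [Module.Finite A P]

/-- `mem_of_locally_mem` for the module `P ⊕ A`. -/
theorem mem_of_locally_mem_lin
    (E : ∀ (B : Type u) [CommRing B] [Algebra R B],
      Subgroup (QLin R B A P ≃ₗ[ExtRing R B A] QLin R B A P))
    (hE : ∀ (B B' : Type u) [CommRing B] [Algebra R B] [CommRing B'] [Algebra R B']
      (φ : B →ₐ[R] B'), ∀ g ∈ E B, extLin φ g ∈ E B')
    (τ : QLin R R[X] A P ≃ₗ[ExtRing R R[X] A] QLin R R[X] A P) (hτ : extLin (evalZero R) τ = 1)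
    (hloc : ∀ m : Ideal R, m.IsMaximal → ∃ s, s ∉ m ∧
      extLin (polyLoc R s) τ ∈ E (Localization.Away s)[X] ∧
      ∀ θ ∈ E (Localization.Away s)[X][X], ∃ N : ℕ, ∃ β ∈ E R[X][X],
        extLin (polyLoc₂ R s) β = extLin (dil _ (s ^ N)) θ * (extLin (dil _ (0 : R)) θ)⁻¹) :
    τ ∈ E R[X] := by
  have key := mem_of_locally_mem (Q := P × A)
    (fun B _ _ => (E B).map (conjAut (qLinEquiv R B A P)).toMonoidHom) ?_
    (conjAut (qLinEquiv R R[X] A P) τ) ?_ ?_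
  · obtain ⟨τ', hτ', h⟩ := key
    rwa [(conjAut (qLinEquiv R R[X] A P)).injective h] at hτ'
  · rintro B B' _ _ _ _ φ _ ⟨g, hg, rfl⟩
    exact ⟨extLin φ g, hE B B' φ g hg, conjAut_extLin φ g⟩
  · rw [← conjAut_extLin, hτ, map_one]
  · intro m hm
    obtain ⟨s, hs, hτs, hd⟩ := hloc m hm
    refine ⟨s, hs, ⟨_, hτs, conjAut_extLin _ τ⟩, ?_⟩
    rintro _ ⟨θ, hθ, rfl⟩
    obtain ⟨N, β, hβ, h⟩ := hd θ hθ
    refine ⟨N, _, ⟨β, hβ, rfl⟩, ?_⟩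
    have h2 := congrArg (conjAut (qLinEquiv R _ A P)) h
    rw [map_mul, map_inv, conjAut_extLin, conjAut_extLin, conjAut_extLin] at h2
    exact h2

/-- `mem_of_locally_mem` for the module `P ⊥ A²`. -/
theorem mem_of_locally_mem_perp
    (E : ∀ (B : Type u) [CommRing B] [Algebra R B],
      Subgroup (QPerp R B A P ≃ₗ[ExtRing R B A] QPerp R B A P))
    (hE : ∀ (B B' : Type u) [CommRing B] [Algebra R B] [CommRing B'] [Algebra R B']
      (φ : B →ₐ[R] B'), ∀ g ∈ E B, extPerp φ g ∈ E B')
    (τ : QPerp R R[X] A P ≃ₗ[ExtRing R R[X] A] QPerp R R[X] A P)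
    (hτ : extPerp (evalZero R) τ = 1)
    (hloc : ∀ m : Ideal R, m.IsMaximal → ∃ s, s ∉ m ∧
      extPerp (polyLoc R s) τ ∈ E (Localization.Away s)[X] ∧
      ∀ θ ∈ E (Localization.Away s)[X][X], ∃ N : ℕ, ∃ β ∈ E R[X][X],
        extPerp (polyLoc₂ R s) β = extPerp (dil _ (s ^ N)) θ * (extPerp (dil _ (0 : R)) θ)⁻¹) :
    τ ∈ E R[X] := by
  have key := mem_of_locally_mem (Q := P × A × A)
    (fun B _ _ => (E B).map (conjAut (qPerpEquiv R B A P)).toMonoidHom) ?_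
    (conjAut (qPerpEquiv R R[X] A P) τ) ?_ ?_
  · obtain ⟨τ', hτ', h⟩ := key
    rwa [(conjAut (qPerpEquiv R R[X] A P)).injective h] at hτ'
  · rintro B B' _ _ _ _ φ _ ⟨g, hg, rfl⟩
    exact ⟨extPerp φ g, hE B B' φ g hg, conjAut_extPerp φ g⟩
  · rw [← conjAut_extPerp, hτ, map_one]
  · intro m hm
    obtain ⟨s, hs, hτs, hd⟩ := hloc m hm
    refine ⟨s, hs, ⟨_, hτs, conjAut_extPerp _ τ⟩, ?_⟩
    rintro _ ⟨θ, hθ, rfl⟩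
    obtain ⟨N, β, hβ, h⟩ := hd θ hθ
    refine ⟨N, _, ⟨β, hβ, rfl⟩, ?_⟩
    have h2 := congrArg (conjAut (qPerpEquiv R _ A P)) h
    rw [map_mul, map_inv, conjAut_extPerp, conjAut_extPerp, conjAut_extPerp] at h2
    exact h2

end LocalGlobalQ

/-! ### Linear transvections and conjugation of congruence subgroups -/

section LinearGroup

variable {C M : Type*} [Ring C] [AddCommGroup M] [Module C M]

/-- The transvection `(p, a) ↦ (p + a x, a)` of `M ⊕ C`. -/
def upper (x : M) : (M × C) ≃ₗ[C] (M × C) where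
  toFun v := (v.1 + v.2 • x, v.2)
  invFun v := (v.1 - v.2 • x, v.2)
  map_add' v w := by ext <;> simp [add_smul]; abel
  map_smul' c v := by ext <;> simp [smul_smul]
  left_inv v := by ext <;> simp
  right_inv v := by ext <;> simp

/-- The transvection `(p, a) ↦ (p, a + ψ p)` of `M ⊕ C`. -/
def lower (ψ : M →ₗ[C] C) : (M × C) ≃ₗ[C] (M × C) where
  toFun v := (v.1, v.2 + ψ v.1)
  invFun v := (v.1, v.2 - ψ v.1)
  map_add' v w := by ext <;> simp; abel
  map_smul' c v := by ext <;> simp [mul_add]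
  left_inv v := by ext <;> simp
  right_inv v := by ext <;> simp

theorem upper_apply (x : M) (p : M) (a : C) : upper x (p, a) = (p + a • x, a) := rfl

theorem lower_apply (ψ : M →ₗ[C] C) (p : M) (a : C) : lower ψ (p, a) = (p, a + ψ p) := rfl

theorem upper_inv_apply (x : M) (p : M) (a : C) : (upper x)⁻¹ (p, a) = (p - a • x, a) := rfl

theorem lower_inv_apply (ψ : M →ₗ[C] C) (p : M) (a : C) : (lower ψ)⁻¹ (p, a) = (p, a - ψ p) := rfl

theorem equiv_prod_ext {N : Type*} [AddCommGroup N] [Module C N] {g h : (M × N) ≃ₗ[C] (M × N)}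
    (H : ∀ (p : M) (a : N), g (p, a) = h (p, a)) : g = h :=
  LinearEquiv.ext fun v => H v.1 v.2

theorem upper_add (x y : M) : (upper (x + y) : (M × C) ≃ₗ[C] (M × C)) = upper x * upper y := by
  refine equiv_prod_ext fun p a => ?_
  simp [LinearEquiv.mul_apply, upper_apply, add_comm, add_left_comm]

theorem lower_add (ψ χ : M →ₗ[C] C) : lower (ψ + χ) = lower ψ * lower χ := by
  refine equiv_prod_ext fun p a => ?_
  simp [LinearEquiv.mul_apply, lower_apply, add_comm, add_left_comm]

theorem upper_zero : (upper (0 : M) : (M × C) ≃ₗ[C] (M × C)) = 1 := by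
  exact equiv_prod_ext fun p a => by simp [upper_apply]

theorem lower_zero : lower (0 : M →ₗ[C] C) = 1 := by
  exact equiv_prod_ext fun p a => by simp [lower_apply]

theorem upper_neg (x : M) : (upper (-x) : (M × C) ≃ₗ[C] (M × C)) = (upper x)⁻¹ :=
  eq_inv_of_mul_eq_one_left (by rw [← upper_add, neg_add_cancel, upper_zero])

theorem lower_neg (ψ : M →ₗ[C] C) : lower (-ψ) = (lower ψ)⁻¹ :=
  eq_inv_of_mul_eq_one_left (by rw [← lower_add, neg_add_cancel, lower_zero])

/-- The functional `p ↦ ψ p * c`. -/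
def dualMul (ψ : M →ₗ[C] C) (c : C) : M →ₗ[C] C := (LinearMap.toSpanSingleton C C c).comp ψ

theorem dualMul_apply (ψ : M →ₗ[C] C) (c : C) (p : M) : dualMul ψ c p = ψ p * c := rfl

theorem comm_upper_lower_apply {x : M} {ψ : M →ₗ[C] C} (h : ψ x = 0) (p : M) (a : C) :
    (upper x * lower ψ * (upper x)⁻¹ * (lower ψ)⁻¹ : (M × C) ≃ₗ[C] (M × C)) (p, a) =
      (p + ψ p • x, a) := by
  simp only [LinearEquiv.mul_apply, upper_apply, lower_apply, upper_inv_apply, lower_inv_apply,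
    map_sub, map_smul, h, smul_zero, sub_zero, sub_add_cancel, sub_smul]
  ext
  · simp only
    rw [sub_add, sub_sub_cancel_left, sub_neg_eq_add]
  · rfl

/-- The commutator of `upper x` and `lower ψ`, where `ψ x = 0`, depends only on `ψ ⊗ x`. -/
theorem comm_upper_lower_congr {x y : M} {ψ χ : M →ₗ[C] C} (h : ψ x = 0) (h' : χ y = 0)
    (H : ∀ p, ψ p • x = χ p • y) :
    (upper x * lower ψ * (upper x)⁻¹ * (lower ψ)⁻¹ : (M × C) ≃ₗ[C] (M × C)) =
      upper y * lower χ * (upper y)⁻¹ * (lower χ)⁻¹ := by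
  apply LinearEquiv.ext
  rintro ⟨p, a⟩
  rw [comm_upper_lower_apply h, comm_upper_lower_apply h', H]

theorem mul_upper_of_apply {e : (M × C) ≃ₗ[C] (M × C)} {x : M} {ψ : M →ₗ[C] C}
    (he : ∀ (p : M) (a : C), e (p, a) = (p + ψ p • x, a)) (z : M) :
    e * upper z = upper (z + ψ z • x) * e := by
  apply LinearEquiv.ext
  rintro ⟨p, a⟩
  simp only [LinearEquiv.mul_apply, upper_apply, he, map_add, map_smul, add_smul, smul_add,
    smul_eq_mul, mul_smul]
  ext
  · simp only; abel
  · rfl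

theorem mul_lower_of_apply {e : (M × C) ≃ₗ[C] (M × C)} {x : M} {ψ : M →ₗ[C] C} (h : ψ x = 0)
    (he : ∀ (p : M) (a : C), e (p, a) = (p + ψ p • x, a)) (χ : M →ₗ[C] C) :
    e * lower χ = lower (χ - dualMul ψ (χ x)) * e := by
  apply LinearEquiv.ext
  rintro ⟨p, a⟩
  simp only [LinearEquiv.mul_apply, lower_apply, he, map_add, map_smul, LinearMap.sub_apply,
    dualMul_apply, h, smul_eq_mul, zero_mul]
  ext
  · rfl
  · simp only [sub_zero, sub_add_cancel]

theorem comm_mem {G : Type*} [Group G] {H : Subgroup G} {g h : G} (hg : g ∈ H) (hh : h ∈ H) :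
    g * h * g⁻¹ * h⁻¹ ∈ H :=
  mul_mem (mul_mem (mul_mem hg hh) (inv_mem hg)) (inv_mem hh)

variable {S : Type*} [CommRing S] [Algebra S C]
  {ι : Type*} (x : ι → M) (φ : ι → M →ₗ[C] C)

/-- The subgroup generated by the transvections along the vectors `x i` and the functionals `φ i`
with coefficients in `c C₀`. In the applications `C₀` consists of the elements defined before the
localization at `s`, and `c` is a power of `s`. -/
def linCongruence (C₀ : Set C) (c : S) : Subgroup ((M × C) ≃ₗ[C] (M × C)) :=
  Subgroup.closure ({g | ∃ i, ∃ d ∈ C₀, g = upper ((c • d) • x i)} ∪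
    {g | ∃ i, ∃ d ∈ C₀, g = lower (dualMul (φ i) (c • d))})

variable {x φ}

theorem upper_mem_linCongruence {C₀ : Set C} {c : S} {d : C} (i : ι) (hd : d ∈ C₀) :
    upper ((c • d) • x i) ∈ linCongruence x φ C₀ c :=
  Subgroup.subset_closure (Or.inl ⟨i, d, hd, rfl⟩)

theorem lower_mem_linCongruence {C₀ : Set C} {c : S} {d : C} (i : ι) (hd : d ∈ C₀) :
    lower (dualMul (φ i) (c • d)) ∈ linCongruence x φ C₀ c :=
  Subgroup.subset_closure (Or.inr ⟨i, d, hd, rfl⟩)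

variable {C₀ : Subalgebra S C} {s : S}

theorem upper_mem_linCongruence_of_le {k l : ℕ} (h : k ≤ l) (i : ι) {d : C} (hd : d ∈ C₀) :
    upper ((s ^ l • d) • x i) ∈ linCongruence x φ C₀ (s ^ k) := by
  rw [← Nat.add_sub_cancel' h, pow_add, mul_smul]
  exact upper_mem_linCongruence i (C₀.smul_mem hd _)

theorem lower_mem_linCongruence_of_le {k l : ℕ} (h : k ≤ l) (i : ι) {d : C} (hd : d ∈ C₀) :
    lower (dualMul (φ i) (s ^ l • d)) ∈ linCongruence x φ C₀ (s ^ k) := by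
  rw [← Nat.add_sub_cancel' h, pow_add, mul_smul]
  exact lower_mem_linCongruence i (C₀.smul_mem hd _)

variable [DecidableEq ι]

/-- Conjugation of a root element by one of the other kind at a different index. The denominator
`s ^ k` of `c` is absorbed: the commutator depends on the product of the coefficients only, and so
`s ^ (2 * m + k)` can be distributed over both factors. -/
theorem conj_lower_mem_of_ne (hφ : ∀ i j, φ i (x j) = if i = j then algebraMap S C s else 0)
    {i j : ι} (hij : i ≠ j) {c : C} {k m : ℕ} (hc : s ^ k • c ∈ C₀) {d : C} (hd : d ∈ C₀) :
    upper (c • x j) * lower (dualMul (φ i) (s ^ (2 * m + k) • d)) * (upper (c • x j))⁻¹ ∈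
      linCongruence x φ C₀ (s ^ m) := by
  have h0 : ∀ a b : C, dualMul (φ i) a (b • x j) = 0 := fun a b => by
    rw [dualMul_apply, map_smul, hφ, if_neg hij, smul_zero, zero_mul]
  have h1 := comm_upper_lower_congr (x := c • x j) (ψ := dualMul (φ i) (s ^ (2 * m + k) • d))
    (y := (s ^ m • s ^ k • c) • x j) (χ := dualMul (φ i) (s ^ m • d)) (h0 _ _) (h0 _ _)
    (fun p => by
      rw [dualMul_apply, dualMul_apply, smul_smul, smul_smul]
      congr 1
      simp only [mul_smul_comm, smul_mul_assoc, smul_smul, ← pow_add]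
      congr 2; ring)
  have h2 := mul_mem (comm_mem (upper_mem_linCongruence (x := x) (φ := φ) (c := s ^ m) j hc)
    (lower_mem_linCongruence i hd))
    (lower_mem_linCongruence_of_le (show m ≤ 2 * m + k by omega) i hd)
  rwa [← h1, inv_mul_cancel_right] at h2

theorem conj_upper_mem_of_ne (hφ : ∀ i j, φ i (x j) = if i = j then algebraMap S C s else 0)
    {i j : ι} (hij : i ≠ j) {c : C} {k m : ℕ} (hc : s ^ k • c ∈ C₀) {d : C} (hd : d ∈ C₀) :
    lower (dualMul (φ j) c) * upper ((s ^ (2 * m + k) • d) • x i) * (lower (dualMul (φ j) c))⁻¹ ∈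
      linCongruence x φ C₀ (s ^ m) := by
  have h0 : ∀ a b : C, dualMul (φ j) a (b • x i) = 0 := fun a b => by
    rw [dualMul_apply, map_smul, hφ, if_neg hij.symm, smul_zero, zero_mul]
  have h1 := comm_upper_lower_congr (x := (s ^ (2 * m + k) • d) • x i) (ψ := dualMul (φ j) c)
    (y := (s ^ m • d) • x i) (χ := dualMul (φ j) (s ^ m • s ^ k • c)) (h0 _ _) (h0 _ _)
    (fun p => by
      rw [dualMul_apply, dualMul_apply, smul_smul, smul_smul]
      congr 1
      simp only [mul_smul_comm, smul_mul_assoc, smul_smul, ← pow_add]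
      congr 2; ring)
  have h2 := mul_mem (inv_mem (comm_mem (upper_mem_linCongruence (x := x) (φ := φ) i hd)
    (lower_mem_linCongruence (c := s ^ m) j hc)))
    (upper_mem_linCongruence_of_le (show m ≤ 2 * m + k by omega) i hd)
  rw [← h1] at h2
  simpa [mul_assoc] using h2

/-- Conjugation of a root element by an opposite one. A second index `l` serves to write the root
element as a commutator `e * f * e⁻¹ * f⁻¹`, neither entry of which is opposite to the conjugating
element. -/
theorem conj_lower_mem_self (hφ : ∀ i j, φ i (x j) = if i = j then algebraMap S C s else 0)
    {i l : ι} (hil : i ≠ l) {c : C} {k m : ℕ} (hc : s ^ k • c ∈ C₀) {d : C} (hd : d ∈ C₀) :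
    upper (c • x i) * lower (dualMul (φ i) (s ^ (4 * m + 2 * k + 1) • d)) * (upper (c • x i))⁻¹ ∈
      linCongruence x φ C₀ (s ^ m) := by
  set H := linCongruence x φ C₀ (s ^ m)
  set g : (M × C) ≃ₗ[C] (M × C) := upper (c • x i)
  set n := 2 * m + k with hn
  set y := (-(s ^ n • d)) • x l with hy
  have hφy : φ i y = 0 := by rw [hy, map_smul, hφ, if_neg hil, smul_zero]
  set e : (M × C) ≃ₗ[C] (M × C) := upper y * lower (φ i) * (upper y)⁻¹ * (lower (φ i))⁻¹ with he
  have he_apply : ∀ (p : M) (a : C), e (p, a) = (p + φ i p • y, a) :=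
    comm_upper_lower_apply hφy
  have heH : e ∈ H := by
    have h0 : ∀ a b : C, dualMul (φ i) a (b • x l) = 0 := fun a b => by
      rw [dualMul_apply, map_smul, hφ, if_neg hil, smul_zero, zero_mul]
    have h1 := comm_upper_lower_congr (x := y) (ψ := φ i)
      (y := (s ^ m • (-d)) • x l) (χ := dualMul (φ i) (s ^ m • s ^ k • 1)) hφy (h0 _ _)
      (fun p => by
        rw [dualMul_apply, hy, smul_smul, smul_smul]
        congr 1
        simp only [mul_smul_comm, smul_mul_assoc, smul_smul, ← pow_add, mul_one, mul_neg, smul_neg]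
        congr 3; omega)
    rw [he, h1]
    exact comm_mem (upper_mem_linCongruence l (neg_mem hd))
      (lower_mem_linCongruence i (C₀.smul_mem (one_mem _) _))
  set f := lower (dualMul (φ l) (s ^ n • 1))
  have hf : g * f * g⁻¹ ∈ H := conj_lower_mem_of_ne hφ hil.symm hc (one_mem _)
  have h1 : lower (dualMul (φ i) (s ^ (4 * m + 2 * k + 1) • d)) = e * f * e⁻¹ * f⁻¹ := by
    rw [mul_lower_of_apply hφy he_apply, mul_inv_cancel_right, ← lower_neg, ← lower_add]
    congr 1
    ext p
    simp only [LinearMap.add_apply, LinearMap.sub_apply, LinearMap.neg_apply, dualMul_apply, hy,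
      map_smul, hφ, if_true, Algebra.algebraMap_eq_smul_one, smul_eq_mul, mul_smul_comm,
      smul_smul, mul_one, mul_neg, smul_neg, ← pow_add, ← pow_succ]
    rw [show 4 * m + 2 * k + 1 = n + n + 1 by omega]
    abel_nf
  have h2 : g * e * g⁻¹ ∈ H := by
    have h3 : g * e * g⁻¹ = upper ((s ^ (m + 1) • (s ^ m • (s ^ k • c) * d)) • x l) * e := by
      rw [← upper_neg, mul_assoc, mul_upper_of_apply he_apply, ← mul_assoc, ← upper_add]
      congr 2
      simp only [map_smul, map_neg, hφ, if_true, Algebra.algebraMap_eq_smul_one, smul_eq_mul, hy,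
        smul_smul, mul_smul_comm, smul_mul_assoc, mul_one, neg_mul, smul_neg, neg_smul,
        neg_neg, add_neg_cancel_left, ← pow_add, ← pow_succ]
      congr 3; omega
    rw [h3]
    exact mul_mem (upper_mem_linCongruence_of_le (by omega) l
      (mul_mem (C₀.smul_mem hc _) hd)) heH
  have h4 := comm_mem h2 hf
  rw [h1]
  simpa [mul_assoc] using h4

/-- The analogue of `conj_lower_mem_self` with the roles of vectors and functionals exchanged. -/
theorem conj_upper_mem_self (hφ : ∀ i j, φ i (x j) = if i = j then algebraMap S C s else 0)
    {i l : ι} (hil : i ≠ l) {c : C} {k m : ℕ} (hc : s ^ k • c ∈ C₀) {d : C} (hd : d ∈ C₀) :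
    lower (dualMul (φ i) c) * upper ((s ^ (4 * m + 2 * k + 1) • d) • x i) *
      (lower (dualMul (φ i) c))⁻¹ ∈ linCongruence x φ C₀ (s ^ m) := by
  set H := linCongruence x φ C₀ (s ^ m)
  set g : (M × C) ≃ₗ[C] (M × C) := lower (dualMul (φ i) c)
  set n := 2 * m + k with hn
  set y := (s ^ n • d) • x i with hy
  have hφy : φ l y = 0 := by rw [hy, map_smul, hφ, if_neg hil.symm, smul_zero]
  set e : (M × C) ≃ₗ[C] (M × C) := upper y * lower (φ l) * (upper y)⁻¹ * (lower (φ l))⁻¹ with he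
  have he_apply : ∀ (p : M) (a : C), e (p, a) = (p + φ l p • y, a) :=
    comm_upper_lower_apply hφy
  have heH : e ∈ H := by
    have h0 : ∀ a b : C, dualMul (φ l) a (b • x i) = 0 := fun a b => by
      rw [dualMul_apply, map_smul, hφ, if_neg hil.symm, smul_zero, zero_mul]
    have h1 := comm_upper_lower_congr (x := y) (ψ := φ l)
      (y := (s ^ m • d) • x i) (χ := dualMul (φ l) (s ^ m • s ^ k • 1)) hφy (h0 _ _)
      (fun p => by
        rw [dualMul_apply, hy, smul_smul, smul_smul]
        congr 1
        simp only [mul_smul_comm, smul_mul_assoc, smul_smul, ← pow_add, mul_one]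
        congr 2; omega)
    rw [he, h1]
    exact comm_mem (upper_mem_linCongruence i hd)
      (lower_mem_linCongruence l (C₀.smul_mem (one_mem _) _))
  set f : (M × C) ≃ₗ[C] (M × C) := upper ((s ^ n • (1 : C)) • x l)
  have hf : g * f * g⁻¹ ∈ H := conj_upper_mem_of_ne hφ hil.symm hc (one_mem _)
  have h1 : upper ((s ^ (4 * m + 2 * k + 1) • d) • x i) = e * f * e⁻¹ * f⁻¹ := by
    rw [mul_upper_of_apply he_apply, mul_inv_cancel_right, ← upper_neg, ← upper_add]
    congr 1
    simp only [map_smul, hφ, if_true, Algebra.algebraMap_eq_smul_one, hy, smul_eq_mul,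
      mul_smul_comm, smul_mul_assoc, smul_smul, mul_one, one_mul]
    rw [add_neg_cancel_comm, hn]
    congr 2
    ring
  have h2 : g * e * g⁻¹ ∈ H := by
    have h3 : g * e * g⁻¹ =
        lower (dualMul (φ l) (s ^ (m + 1) • (s ^ m • d * (s ^ k • c)))) * e := by
      rw [← lower_neg, mul_assoc, mul_lower_of_apply hφy he_apply, ← mul_assoc, ← lower_add]
      congr 2
      ext p
      simp only [LinearMap.add_apply, LinearMap.sub_apply, LinearMap.neg_apply, dualMul_apply, hy,
        map_smul, hφ, if_true, Algebra.algebraMap_eq_smul_one, smul_eq_mul, mul_smul_comm,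
        smul_mul_assoc, smul_smul, one_mul, mul_neg, sub_neg_eq_add, add_neg_cancel_left,
        ← pow_add]
      rw [hn]
      congr 2
      ring
    rw [h3]
    exact mul_mem (lower_mem_linCongruence_of_le (by omega) l
      (mul_mem (C₀.smul_mem hd _) hc)) heH
  have h4 := comm_mem h2 hf
  rw [h1]
  simpa [mul_assoc] using h4

/-- Conjugation by a product of root elements maps a deep congruence subgroup into a given one. -/
theorem exists_conj_linCongruence_le [Nontrivial ι]
    (hφ : ∀ i j, φ i (x j) = if i = j then algebraMap S C s else 0)
    (hden : ∀ c : C, ∃ k : ℕ, s ^ k • c ∈ C₀) {g : (M × C) ≃ₗ[C] (M × C)}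
    (hg : g ∈ linCongruence x φ Set.univ (1 : S)) (m : ℕ) :
    ∃ n, ∀ h ∈ linCongruence x φ C₀ (s ^ n), g * h * g⁻¹ ∈ linCongruence x φ C₀ (s ^ m) := by
  have red : ∀ (g : (M × C) ≃ₗ[C] (M × C)) (m n : ℕ),
      (∀ i, ∀ d ∈ C₀, g * upper ((s ^ n • d) • x i) * g⁻¹ ∈ linCongruence x φ C₀ (s ^ m)) →
      (∀ i, ∀ d ∈ C₀, g * lower (dualMul (φ i) (s ^ n • d)) * g⁻¹ ∈
        linCongruence x φ C₀ (s ^ m)) →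
      ∀ h ∈ linCongruence x φ C₀ (s ^ n), g * h * g⁻¹ ∈ linCongruence x φ C₀ (s ^ m) := by
    intro g m n hu hl
    have : linCongruence x φ C₀ (s ^ n) ≤
        (linCongruence x φ C₀ (s ^ m)).comap (MulAut.conj g).toMonoidHom := by
      refine (Subgroup.closure_le _).2 ?_
      rintro _ (⟨i, d, hd, rfl⟩ | ⟨i, d, hd, rfl⟩)
      · exact hu i d hd
      · exact hl i d hd
    exact fun h hh => this hh
  have gen : ∀ g : (M × C) ≃ₗ[C] (M × C),
      ((∃ i, ∃ c : C, g = upper (c • x i)) ∨ ∃ i, ∃ c : C, g = lower (dualMul (φ i) c)) → ∀ m,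
      ∃ n, ∀ h ∈ linCongruence x φ C₀ (s ^ n), g * h * g⁻¹ ∈ linCongruence x φ C₀ (s ^ m) := by
    rintro g (⟨j, c, rfl⟩ | ⟨j, c, rfl⟩) m
    all_goals
      obtain ⟨k, hk⟩ := hden c
      refine ⟨4 * m + 2 * k + 1, red _ _ _ (fun i d hd => ?_) (fun i d hd => ?_)⟩
    · rw [← upper_add, add_comm, upper_add, mul_inv_cancel_right]
      exact upper_mem_linCongruence_of_le (by omega) i hd
    · by_cases hij : i = j
      · subst hij
        obtain ⟨l, hl⟩ := exists_ne i
        exact conj_lower_mem_self hφ hl.symm hk hd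
      · rw [show 4 * m + 2 * k + 1 = 2 * m + k + (2 * m + k + 1) by ring, pow_add, mul_smul]
        exact conj_lower_mem_of_ne hφ hij hk (C₀.smul_mem hd _)
    · by_cases hij : i = j
      · subst hij
        obtain ⟨l, hl⟩ := exists_ne i
        exact conj_upper_mem_self hφ hl.symm hk hd
      · rw [show 4 * m + 2 * k + 1 = 2 * m + k + (2 * m + k + 1) by ring, pow_add, mul_smul]
        exact conj_upper_mem_of_ne hφ hij hk (C₀.smul_mem hd _)
    · rw [← lower_add, add_comm, lower_add, mul_inv_cancel_right]
      exact lower_mem_linCongruence_of_le (by omega) i hd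
  induction hg using Subgroup.closure_induction'' generalizing m with
  | mem g hg =>
    refine gen g ?_ m
    rcases hg with ⟨i, d, -, rfl⟩ | ⟨i, d, -, rfl⟩
    · exact Or.inl ⟨i, _, rfl⟩
    · exact Or.inr ⟨i, _, rfl⟩
  | one => exact ⟨m, fun h hh => by simpa using hh⟩
  | mul g g' _ _ hg hg' =>
    obtain ⟨n, hn⟩ := hg m
    obtain ⟨n', hn'⟩ := hg' n
    refine ⟨n', fun h hh => ?_⟩
    have := hn _ (hn' h hh)
    simpa [mul_assoc] using this
  | inv_mem g hg =>
    refine gen _ ?_ m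
    rcases hg with ⟨i, d, -, rfl⟩ | ⟨i, d, -, rfl⟩
    · exact Or.inl ⟨i, -((1 : S) • d), by rw [neg_smul, upper_neg]⟩
    · refine Or.inr ⟨i, -((1 : S) • d), ?_⟩
      rw [← lower_neg]
      congr 1
      ext p
      simp [dualMul_apply]

end LinearGroup

/-! ### Dilation of linear transvections -/

section Scalars

variable {R : Type*} [CommRing R] {A : Type*} [Ring A] [Algebra R A]
  {B : Type*} [CommRing B] [Algebra R B] {B' : Type*} [CommRing B'] [Algebra R B']

theorem extRingMap_tmul (φ : B →ₐ[R] B') (b : B) (a : A) :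
    extRingMap R A φ (b ⊗ₜ[R] a) = φ b ⊗ₜ[R] a := by
  simp [extRingMap]

/-- Denominators in `A_B'` can be cleared by powers of `s`. -/
theorem IsLocAway.extRing_surj {s : R} {φ : B →ₐ[R] B'} (h : IsLocAway s φ)
    (c : ExtRing R B' A) : ∃ k : ℕ, s ^ k • c ∈ (extRingMap R A φ).range := by
  induction c using TensorProduct.induction_on with
  | zero => exact ⟨0, by rw [smul_zero]; exact zero_mem _⟩
  | add c d hc hd =>
    obtain ⟨k, hk⟩ := hc
    obtain ⟨l, hl⟩ := hd
    refine ⟨k + l, ?_⟩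
    rw [smul_add]
    refine add_mem ?_ ?_
    · rw [add_comm, pow_add, mul_smul]
      exact Subalgebra.smul_mem _ hk _
    · rw [pow_add, mul_smul]
      exact Subalgebra.smul_mem _ hl _
  | tmul b a =>
    obtain ⟨k, x, hx⟩ := h.surj b
    exact ⟨k, x ⊗ₜ a, by
      rw [TensorProduct.smul_tmul', hx]; exact extRingMap_tmul φ x a⟩

/-- For a polynomial `c(X)` with coefficients over the localization, `c(s^n X) - c(0)` is divisible
by `s^m`, with a quotient which comes from `A_B[X]`, when `n` is large: only monomials of positive
degree remain. -/
theorem exists_dil_sub_dil_zero {s : R} {φ : B →ₐ[R] B'} (h : IsLocAway s φ)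
    (c : ExtRing R B'[X] A) (m : ℕ) : ∃ n₀ : ℕ, ∀ n, n₀ ≤ n →
      ∃ d ∈ (extRingMap R A (Polynomial.mapAlgHom φ)).range,
        extRingMap R A (dil B' (s ^ n)) c - extRingMap R A (dil B' (0 : R)) c = s ^ m • d := by
  induction c using TensorProduct.induction_on with
  | zero => exact ⟨0, fun n _ => ⟨0, zero_mem _, by simp⟩⟩
  | add c d hc hd =>
    obtain ⟨k, hk⟩ := hc
    obtain ⟨l, hl⟩ := hd
    refine ⟨k + l, fun n hn => ?_⟩
    obtain ⟨x, hx, hx'⟩ := hk n (by omega)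
    obtain ⟨y, hy, hy'⟩ := hl n (by omega)
    exact ⟨x + y, add_mem hx hy, by rw [map_add, map_add, smul_add, ← hx', ← hy']; abel⟩
  | tmul p a =>
    induction p using Polynomial.induction_on' with
    | add p q hp hq =>
      obtain ⟨k, hk⟩ := hp
      obtain ⟨l, hl⟩ := hq
      refine ⟨k + l, fun n hn => ?_⟩
      obtain ⟨x, hx, hx'⟩ := hk n (by omega)
      obtain ⟨y, hy, hy'⟩ := hl n (by omega)
      exact ⟨x + y, add_mem hx hy, by
        rw [TensorProduct.add_tmul, map_add, map_add, smul_add, ← hx', ← hy']; abel⟩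
    | monomial i b =>
      obtain ⟨k, x, hx⟩ := h.surj b
      refine ⟨m + k, fun n hn => ?_⟩
      rw [extRingMap_tmul, extRingMap_tmul, dil_monomial, dil_monomial]
      rcases Nat.eq_zero_or_pos i with rfl | hi
      · exact ⟨0, zero_mem _, by simp⟩
      · have hi' : m + k ≤ n * i := hn.trans (Nat.le_mul_of_pos_right n hi)
        refine ⟨(s ^ (n * i - (m + k)) • Polynomial.monomial i (φ x)) ⊗ₜ a,
          ⟨(s ^ (n * i - (m + k)) • Polynomial.monomial i x) ⊗ₜ a, ?_⟩, ?_⟩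
        · change extRingMap R A _ _ = _
          rw [extRingMap_tmul, map_smul]
          simp
        · rw [zero_pow hi.ne', zero_smul, TensorProduct.zero_tmul, sub_zero, ← pow_mul,
            TensorProduct.smul_tmul', smul_smul, ← hx, ← Polynomial.smul_monomial, smul_smul,
            ← pow_add, ← pow_add]
          congr 3
          omega

end Scalars

section LinearDilation

variable {C M : Type*} [Ring C] [AddCommGroup M] [Module C M]
  {S : Type*} [CommRing S] [Algebra S C] {ι : Type*} [Fintype ι] {x : ι → M} {φ : ι → M →ₗ[C] C}

/-- If the vectors `x i` and the functionals `φ i` form a dual basis up to the unit `s`, then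
their multiples generate `ETrans`. -/
theorem eTrans_le_linCongruence {s : S} (hs : IsUnit (algebraMap S C s))
    (hx : ∀ p : M, (algebraMap S C s) • p = ∑ i, φ i p • x i) :
    ETrans C M ≤ linCongruence x φ Set.univ (1 : S) := by
  classical
  obtain ⟨u, hu⟩ := hs
  have hcomm : ∀ c : C, (↑u⁻¹ : C) * c = c * ↑u⁻¹ := fun c => by
    have h1 : Commute (u : C) c := by rw [hu]; exact Algebra.commutes s c
    exact h1.units_inv_left
  have hp : ∀ p : M, p = ∑ i, ((↑u⁻¹ : C) * φ i p) • x i := fun p => by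
    simp only [mul_smul, ← Finset.smul_sum, ← hx, ← hu]
    rw [smul_smul, Units.inv_mul, one_smul]
  have hU : ∀ (t : Finset ι) (c : ι → C), upper (∑ i ∈ t, c i • x i) ∈
      linCongruence x φ Set.univ (1 : S) := fun t c => by
    induction t using Finset.induction_on with
    | empty => rw [Finset.sum_empty, upper_zero]; exact one_mem _
    | insert i t hi ih =>
      rw [Finset.sum_insert hi, upper_add]
      have := upper_mem_linCongruence (x := x) (φ := φ) (C₀ := Set.univ) (c := (1 : S)) (d := c i)
        i trivial
      rw [one_smul] at this
      exact mul_mem this ih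
  have hL : ∀ (t : Finset ι) (c : ι → C), lower (∑ i ∈ t, dualMul (φ i) (c i)) ∈
      linCongruence x φ Set.univ (1 : S) := fun t c => by
    induction t using Finset.induction_on with
    | empty => rw [Finset.sum_empty, lower_zero]; exact one_mem _
    | insert i t hi ih =>
      rw [Finset.sum_insert hi, lower_add]
      have := lower_mem_linCongruence (x := x) (φ := φ) (C₀ := Set.univ) (c := (1 : S)) (d := c i)
        i trivial
      rw [one_smul] at this
      exact mul_mem this ih
  refine (Subgroup.closure_le _).2 ?_
  rintro g (⟨v, hg⟩ | ⟨ψ, hg⟩)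
  · have : g = upper v := equiv_prod_ext fun p a => hg p a
    rw [this, hp v]
    exact hU _ _
  · have : g = lower (∑ i, dualMul (φ i) (↑u⁻¹ * ψ (x i))) := equiv_prod_ext fun p a => by
      rw [hg, lower_apply]
      congr 2
      conv_lhs => rw [hp p]
      rw [map_sum, LinearMap.sum_apply]
      refine Finset.sum_congr rfl fun i _ => ?_
      rw [map_smul, dualMul_apply, smul_eq_mul, hcomm, mul_assoc]
    rw [this]
    exact hL _ _

theorem upper_mem_eTrans (v : M) : upper v ∈ ETrans C M :=
  Subgroup.subset_closure (Or.inl ⟨v, fun _ _ => rfl⟩)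

theorem lower_mem_eTrans (ψ : M →ₗ[C] C) : lower ψ ∈ ETrans C M :=
  Subgroup.subset_closure (Or.inr ⟨ψ, fun _ _ => rfl⟩)

end LinearDilation

section LinearExt

variable {R : Type*} [CommRing R] {A : Type*} [Ring A] [Algebra R A]
  {P : Type*} [AddCommGroup P] [Module R P] [Module A P] [IsScalarTower R A P]
  {B : Type*} [CommRing B] [Algebra R B] {B' : Type*} [CommRing B'] [Algebra R B']

/-- Extension of scalars for functionals which are defined over `B`. -/
def extDual (φ : B →ₐ[R] B') (f : ExtMod R B P →ₗ[ExtRing R B A] ExtRing R B A) :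
    ExtMod R B' P →ₗ[ExtRing R B' A] ExtRing R B' A :=
  extLift ((extRingMap R A φ : ExtRing R B A →+ ExtRing R B' A).comp
    ((f : ExtMod R B P →+ ExtRing R B A).comp (tmulOne R B P))) fun a q => by
      change extRingMap R A φ (f (ExtMod.tmul R 1 (a • q))) =
        _ • extRingMap R A φ (f (ExtMod.tmul R 1 q))
      rw [← smul_tmul_one, map_smul, smul_eq_mul, map_mul, extRingMap_tmul_one, smul_eq_mul]

theorem extDual_map (φ : B →ₐ[R] B') (f : ExtMod R B P →ₗ[ExtRing R B A] ExtRing R B A)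
    (x : ExtMod R B P) : extDual φ f (extModMap R P φ x) = extRingMap R A φ (f x) := by
  induction x using ExtMod.induction with
  | zero => rw [extModMap_zero, map_zero, map_zero, map_zero]
  | add x y hx hy => rw [extModMap_add, map_add, map_add, map_add, hx, hy]
  | tmul b q =>
    rw [tmul_eq_smul (A := A), extModMap_smul, map_smul, map_smul, extModMap_tmul,
      map_one, extDual, extLift_tmul_one, smul_eq_mul, smul_eq_mul, map_mul]
    rfl

theorem isExtLin_upper (φ : B →ₐ[R] B') (v : ExtMod R B P) :
    IsExtLin R A P φ (upper v) (upper (extModMap R P φ v)) := fun x => by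
  refine Prod.ext ?_ rfl
  change extModMap R P φ x.1 + extRingMap R A φ x.2 • extModMap R P φ v =
    extModMap R P φ (x.1 + x.2 • v)
  rw [extModMap_add, extModMap_smul]

theorem isExtLin_lower (φ : B →ₐ[R] B') {f : ExtMod R B P →ₗ[ExtRing R B A] ExtRing R B A}
    {f' : ExtMod R B' P →ₗ[ExtRing R B' A] ExtRing R B' A}
    (h : ∀ x, f' (extModMap R P φ x) = extRingMap R A φ (f x)) :
    IsExtLin R A P φ (lower f) (lower f') := fun x => by
  refine Prod.ext rfl ?_
  change extRingMap R A φ x.2 + f' (extModMap R P φ x.1) = extRingMap R A φ (x.2 + f x.1)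
  rw [h, map_add]

theorem extLin_upper (φ : B →ₐ[R] B') (v : ExtMod R B P) :
    extLin (A := A) φ (upper v) = upper (extModMap R P φ v) :=
  (isExtLin_upper φ v).eq_extLin

theorem extLin_mem_eTrans (φ : B →ₐ[R] B') (g : QLin R B A P ≃ₗ[ExtRing R B A] QLin R B A P)
    (hg : g ∈ ETrans (ExtRing R B A) (ExtMod R B P)) :
    extLin φ g ∈ ETrans (ExtRing R B' A) (ExtMod R B' P) := by
  have : ETrans (ExtRing R B A) (ExtMod R B P) ≤
      (ETrans (ExtRing R B' A) (ExtMod R B' P)).comap (extLin φ) := by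
    refine (Subgroup.closure_le _).2 ?_
    rintro g (⟨v, hg⟩ | ⟨ψ, hg⟩)
    · have : g = upper v := equiv_prod_ext fun p a => hg p a
      rw [this]
      rw [SetLike.mem_coe, Subgroup.mem_comap, extLin_upper]
      exact upper_mem_eTrans _
    · have : g = lower ψ := equiv_prod_ext fun p a => hg p a
      rw [this]
      rw [SetLike.mem_coe, Subgroup.mem_comap, (isExtLin_lower φ (extDual_map φ ψ)).eq_extLin]
      exact lower_mem_eTrans _
  exact this hg

/-- The functional on `P_B` which extends a functional on `P`. -/
def extDual₀ (B : Type*) [CommRing B] [Algebra R B] (f : P →ₗ[A] A) :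
    ExtMod R B P →ₗ[ExtRing R B A] ExtRing R B A :=
  extLift (AddMonoidHom.mk' (fun p => (1 : B) ⊗ₜ[R] f p)
    fun p q => by rw [map_add, TensorProduct.tmul_add]) fun a q => by
      change (1 : B) ⊗ₜ[R] f (a • q) = ((1 : B) ⊗ₜ[R] a) * ((1 : B) ⊗ₜ[R] f q)
      rw [map_smul, Algebra.TensorProduct.tmul_mul_tmul, mul_one, smul_eq_mul]

theorem extDual₀_tmul_one (f : P →ₗ[A] A) (p : P) :
    extDual₀ B f (ExtMod.tmul R (1 : B) p) = (1 : B) ⊗ₜ[R] f p :=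
  extLift_tmul_one _ _ _

theorem extDual₀_map (φ : B →ₐ[R] B') (f : P →ₗ[A] A) (x : ExtMod R B P) :
    extDual₀ B' f (extModMap R P φ x) = extRingMap R A φ (extDual₀ B f x) := by
  induction x using ExtMod.induction with
  | zero => rw [extModMap_zero, map_zero, map_zero, map_zero]
  | add x y hx hy => rw [extModMap_add, map_add, map_add, map_add, hx, hy]
  | tmul b q =>
    rw [tmul_eq_smul (A := A), extModMap_smul, map_smul, map_smul, extModMap_tmul,
      map_one, extDual₀_tmul_one, extDual₀_tmul_one, smul_eq_mul, smul_eq_mul, map_mul,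
      extRingMap_tmul_one]

theorem extLin_lower_dualMul (φ : B →ₐ[R] B') (f : P →ₗ[A] A) (c : ExtRing R B A) :
    extLin (P := P) φ (lower (dualMul (extDual₀ B f) c)) =
      lower (dualMul (extDual₀ B' f) (extRingMap R A φ c)) :=
  (isExtLin_lower φ fun x => by
    rw [dualMul_apply, dualMul_apply, extDual₀_map, map_mul]).eq_extLin

/-- Vectors `x i` and functionals `f i`, for `i` in a finite set, which form a dual basis of `P` up
to the scalar `s`. Such data exhibit `P_s` as a free module. -/
structure IsDualBasisAway (s : R) {ι : Type*} [Fintype ι] [DecidableEq ι] (x : ι → P)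
    (f : ι → P →ₗ[A] A) : Prop where
  apply : ∀ i j, f i (x j) = if i = j then algebraMap R A s else 0
  sum : ∀ p : P, s • p = ∑ i, f i p • x i

variable {s : R} {ι : Type*} [Fintype ι] [DecidableEq ι] {x : ι → P} {f : ι → P →ₗ[A] A}

theorem algebraMap_extRing (r : R) :
    algebraMap R (ExtRing R B A) r = (1 : B) ⊗ₜ[R] algebraMap R A r := by
  rw [Algebra.algebraMap_eq_smul_one, Algebra.TensorProduct.one_def, ← TensorProduct.tmul_smul,
    Algebra.algebraMap_eq_smul_one]

theorem IsDualBasisAway.ext_apply (h : IsDualBasisAway s x f) (i j : ι) :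
    extDual₀ B (f i) (ExtMod.tmul R (1 : B) (x j)) =
      if i = j then algebraMap R (ExtRing R B A) s else 0 := by
  rw [extDual₀_tmul_one, h.apply]
  split_ifs
  · rw [algebraMap_extRing]
  · rw [TensorProduct.tmul_zero]

theorem IsDualBasisAway.ext_sum (h : IsDualBasisAway s x f) (p : ExtMod R B P) :
    algebraMap R (ExtRing R B A) s • p =
      ∑ i, extDual₀ B (f i) p • ExtMod.tmul R (1 : B) (x i) := by
  induction p using ExtMod.induction with
  | zero => simp
  | add p q hp hq =>
    rw [smul_add, hp, hq, ← Finset.sum_add_distrib]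
    exact Finset.sum_congr rfl fun i _ => by rw [map_add, add_smul]
  | tmul b q =>
    rw [tmul_eq_smul (A := A)]
    rw [smul_smul, Algebra.commutes, mul_smul, algebraMap_extRing, smul_tmul_one, algebraMap_smul,
      h.sum]
    have h1 : ExtMod.tmul R (1 : B) (∑ i, f i q • x i) = _ := map_sum (tmulOne R B P) _ _
    rw [h1, Finset.smul_sum]
    refine Finset.sum_congr rfl fun i _ => ?_
    rw [tmulOne_apply, ← smul_tmul_one, map_smul, extDual₀_tmul_one, smul_smul, smul_eq_mul]

theorem IsLocAway.isUnit_extRing {φ : B →ₐ[R] B'} (h : IsLocAway s φ) :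
    IsUnit (algebraMap R (ExtRing R B' A) s) := by
  rw [IsScalarTower.algebraMap_apply R B' (ExtRing R B' A)]
  exact h.unit.map _

/-- The dilation property of the groups `ETrans` where `P` is free of rank at least two. The free
basis is defined over `R`, so the congruence subgroup for the scalar `1 = s ^ 0` and the image of
`A_B[X]` lifts to `ETrans` over `B[X]`. -/
theorem exists_dilation_lin [Nontrivial ι] (h : IsDualBasisAway s x f) {φ : B →ₐ[R] B'}
    (hφ : IsLocAway s φ) {θ : QLin R B'[X] A P ≃ₗ[ExtRing R B'[X] A] QLin R B'[X] A P}
    (hθ : θ ∈ ETrans (ExtRing R B'[X] A) (ExtMod R B'[X] P)) :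
    ∃ N : ℕ, ∃ β ∈ ETrans (ExtRing R B[X] A) (ExtMod R B[X] P),
      extLin (Polynomial.mapAlgHom φ) β =
        extLin (dil B' (s ^ N)) θ * (extLin (dil B' (0 : R)) θ)⁻¹ := by
  have hφX := hφ.polynomial
  set Φ : B[X] →ₐ[R] B'[X] := Polynomial.mapAlgHom φ with hΦ
  set C₀ := (extRingMap R A Φ).range
  set y : ι → ExtMod R B'[X] P := fun i => ExtMod.tmul R 1 (x i) with hy
  set F := fun i => extDual₀ (R := R) (A := A) B'[X] (f i) with hF
  have hyF : ∀ i j, F i (y j) = if i = j then algebraMap R (ExtRing R B'[X] A) s else 0 :=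
    fun i j => h.ext_apply i j
  have hyΨ : ∀ (ψ : B'[X] →ₐ[R] B'[X]) (i : ι), extModMap R P ψ (y i) = y i := fun ψ i => by
    rw [hy, extModMap_tmul, map_one]
  have hU : ∀ (ψ : B'[X] →ₐ[R] B'[X]) (i : ι) (c : ExtRing R B'[X] A),
      extLin (A := A) (P := P) ψ (upper (c • y i)) =
        upper ((extRingMap R A ψ c) • y i) := fun ψ i c => by
    rw [extLin_upper, extModMap_smul, hyΨ]
  have hL : ∀ (ψ : B'[X] →ₐ[R] B'[X]) (i : ι) (c : ExtRing R B'[X] A),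
      extLin (A := A) (P := P) ψ (lower (dualMul (F i) c)) =
        lower (dualMul (F i) (extRingMap R A ψ c)) := fun ψ i c =>
    extLin_lower_dualMul ψ (f i) c
  have hfun : ∀ (ψ : B'[X] →ₐ[R] B'[X]), ∀ g ∈ linCongruence y F Set.univ (1 : R),
      extLin ψ g ∈ linCongruence y F Set.univ (1 : R) := fun ψ g hg => by
    have : linCongruence y F Set.univ (1 : R) ≤
        (linCongruence y F Set.univ (1 : R)).comap (extLin ψ) := by
      refine (Subgroup.closure_le _).2 ?_
      rintro _ (⟨i, d, -, rfl⟩ | ⟨i, d, -, rfl⟩)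
      · rw [SetLike.mem_coe, Subgroup.mem_comap, one_smul, hU, ← one_smul R (extRingMap R A ψ d)]
        exact upper_mem_linCongruence i trivial
      · rw [SetLike.mem_coe, Subgroup.mem_comap, one_smul, hL, ← one_smul R (extRingMap R A ψ d)]
        exact lower_mem_linCongruence i trivial
    exact this hg
  have hθ' : θ ∈ linCongruence y F Set.univ (1 : R) :=
    eTrans_le_linCongruence (hφX.isUnit_extRing) (fun p => h.ext_sum p) hθ
  -- The quotient `θ(s^n X) θ(0)⁻¹` lies in a given congruence subgroup for large `n`.
  have key : ∀ m : ℕ, ∃ n₀ : ℕ, ∀ n, n₀ ≤ n →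
      extLin (dil B' (s ^ n)) θ * (extLin (dil B' (0 : R)) θ)⁻¹ ∈
        linCongruence y F C₀ (s ^ m) := by
    clear hθ
    induction hθ' using Subgroup.closure_induction with
    | one =>
      exact fun m => ⟨0, fun n _ => by rw [map_one, map_one, inv_one, mul_one]; exact one_mem _⟩
    | mem g hg =>
      intro m
      rcases hg with ⟨i, c, -, rfl⟩ | ⟨i, c, -, rfl⟩
      all_goals
        obtain ⟨n₀, hn₀⟩ := exists_dil_sub_dil_zero hφ c m
        refine ⟨n₀, fun n hn => ?_⟩
        obtain ⟨d, hd, hd'⟩ := hn₀ n hn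
      · rw [one_smul, hU, hU, ← upper_neg, ← upper_add, ← neg_smul, ← add_smul, ← sub_eq_add_neg,
          hd']
        exact upper_mem_linCongruence i hd
      · rw [one_smul, hL, hL, ← lower_neg, ← lower_add]
        have : dualMul (F i) (extRingMap R A (dil B' (s ^ n)) c) +
            -dualMul (F i) (extRingMap R A (dil B' (0 : R)) c) = dualMul (F i) (s ^ m • d) := by
          rw [← hd']
          ext p
          simp only [LinearMap.add_apply, LinearMap.neg_apply, dualMul_apply,
            sub_eq_add_neg, mul_add, mul_neg]
        rw [this]
        exact lower_mem_linCongruence i hd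
    | mul g g' hg _ ih ih' =>
      -- `(g g')(s^n X) (g g')(0)⁻¹` is `g(s^n X) g(0)⁻¹` times the conjugate of
      -- `g'(s^n X) g'(0)⁻¹` by `g(0)`.
      intro m
      obtain ⟨l, hl⟩ := exists_conj_linCongruence_le hyF (fun c => hφX.extRing_surj c)
        (hfun (dil B' (0 : R)) g hg) m
      obtain ⟨n₁, h₁⟩ := ih m
      obtain ⟨n₂, h₂⟩ := ih' l
      refine ⟨n₁ + n₂, fun n hn => ?_⟩
      have := mul_mem (h₁ n (by omega)) (hl _ (h₂ n (by omega)))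
      simpa [mul_assoc] using this
    | inv g hg ih =>
      intro m
      obtain ⟨l, hl⟩ := exists_conj_linCongruence_le hyF (fun c => hφX.extRing_surj c)
        (inv_mem (hfun (dil B' (0 : R)) g hg)) m
      obtain ⟨n₁, h₁⟩ := ih l
      refine ⟨n₁, fun n hn => ?_⟩
      have := hl _ (inv_mem (h₁ n hn))
      rw [mul_inv_rev, inv_inv, inv_mul_cancel_left] at this
      rw [map_inv, map_inv, inv_inv]
      exact this
  obtain ⟨N, hN⟩ := key 0
  refine ⟨N, ?_⟩
  have hlift : linCongruence y F C₀ (s ^ 0) ≤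
      (ETrans (ExtRing R B[X] A) (ExtMod R B[X] P)).map (extLin Φ) := by
    refine (Subgroup.closure_le _).2 ?_
    rintro _ (⟨i, _, ⟨d, rfl⟩, rfl⟩ | ⟨i, _, ⟨d, rfl⟩, rfl⟩)
    · refine ⟨upper (d • ExtMod.tmul R 1 (x i)), upper_mem_eTrans _, ?_⟩
      rw [extLin_upper, extModMap_smul, extModMap_tmul, map_one, pow_zero, one_smul]
      rfl
    · refine ⟨lower (dualMul (extDual₀ B[X] (f i)) d), lower_mem_eTrans _, ?_⟩
      rw [extLin_lower_dualMul, pow_zero, one_smul]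
      rfl
  obtain ⟨β, hβ, hβ'⟩ := hlift (hN N le_rfl)
  exact ⟨β, hβ, hβ'⟩

end LinearExt

/-! ### Heisenberg groups of unitary transvections -/

section Forms

variable {S C M : Type*} [CommRing S] [Ring C] [Algebra S C] [AddCommGroup M] [Module S M]
  (h : LinearMap.BilinMap S M C)

theorem form_zsmul_left (n : ℤ) (x y : M) : h (n • x) y = n • h x y := by
  rw [map_zsmul, LinearMap.smul_apply]

theorem form_zsmul_right (n : ℤ) (x y : M) : h x (n • y) = n • h x y := map_zsmul _ _ _

end Forms

section Unitary

variable {S : Type*} {C M : Type*} [CommRing S] [Ring C] [Algebra S C]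
  [AddCommGroup M] [Module S M] [Module C M]

/-- An `ε`-symmetric form, with `ε = ± 1`, which need not be non-singular. -/
structure IsEpsForm (ε : ℤ) (j : Involution S C) (h : LinearMap.BilinMap S M C) : Prop where
  eps : ε * ε = 1
  smul_right : ∀ (a : C) (x y : M), h x (a • y) = a * h x y
  smul_left : ∀ (a : C) (x y : M), h (a • x) y = h x y * j.toLin a
  symm : ∀ x y : M, h y x = ε • j.toLin (h x y)

variable {ε : ℤ} {j : Involution S C} {h : LinearMap.BilinMap S M C}

theorem Involution.map_one (j : Involution S C) : j.toLin 1 = 1 := by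
  have h1 := j.map_mul 1 (j.toLin 1)
  rw [one_mul, j.map_map, one_mul] at h1
  exact h1.symm

theorem IsEpsForm.eps_smul_smul (hh : IsEpsForm ε j h) {G : Type*} [AddCommGroup G] (x : G) :
    ε • ε • x = x := by
  rw [smul_smul, hh.eps, one_smul]

theorem IsEpsForm.symm_eq_zero (hh : IsEpsForm ε j h) {x y : M} (hxy : h x y = 0) :
    h y x = 0 := by
  rw [hh.symm x y, hxy, map_zero, smul_zero]

/-- The map `(p, b, a) ↦ (p - ε a q, b + ⟨q, p⟩ + a l, a)` of `M ⊥ C²`. The parameter `l` is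
arbitrary here; `HeisIsometric` says when the map is an isometry. -/
def heisE (hh : IsEpsForm ε j h) (q : M) (l : C) : (M × C × C) ≃ₗ[C] (M × C × C) where
  toFun v := (v.1 - ε • v.2.2 • q, v.2.1 + h q v.1 + v.2.2 * l, v.2.2)
  invFun v := (v.1 + ε • v.2.2 • q, v.2.1 - h q (v.1 + ε • v.2.2 • q) - v.2.2 * l, v.2.2)
  map_add' v w := by
    refine Prod.ext ?_ (Prod.ext ?_ rfl)
    · simp only [Prod.fst_add, Prod.snd_add, add_smul, smul_add]; abel
    · simp only [Prod.fst_add, Prod.snd_add, map_add, add_mul]; abel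
  map_smul' c v := by
    refine Prod.ext ?_ (Prod.ext ?_ rfl)
    · simp only [Prod.smul_fst, Prod.smul_snd, smul_eq_mul, mul_smul, smul_sub, RingHom.id_apply,
        smul_comm c ε]
    · simp only [Prod.smul_fst, Prod.smul_snd, smul_eq_mul, hh.smul_right, mul_add, mul_assoc,
        RingHom.id_apply]
  left_inv v := by
    refine Prod.ext ?_ (Prod.ext ?_ rfl)
    · simp only [sub_add_cancel]
    · simp only [sub_add_cancel]; abel
  right_inv v := by
    refine Prod.ext ?_ (Prod.ext ?_ rfl)
    · simp only [add_sub_cancel_right]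
    · simp only []; abel

/-- The map `(p, b, a) ↦ (p - b q, b, a + ⟨q, p⟩ + b l)` of `M ⊥ C²`. -/
def heisF (hh : IsEpsForm ε j h) (q : M) (l : C) : (M × C × C) ≃ₗ[C] (M × C × C) where
  toFun v := (v.1 - v.2.1 • q, v.2.1, v.2.2 + h q v.1 + v.2.1 * l)
  invFun v := (v.1 + v.2.1 • q, v.2.1, v.2.2 - h q (v.1 + v.2.1 • q) - v.2.1 * l)
  map_add' v w := by
    refine Prod.ext ?_ (Prod.ext rfl ?_)
    · simp only [Prod.fst_add, Prod.snd_add, add_smul]; abel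
    · simp only [Prod.fst_add, Prod.snd_add, map_add, add_mul]; abel
  map_smul' c v := by
    refine Prod.ext ?_ (Prod.ext rfl ?_)
    · simp only [Prod.smul_fst, Prod.smul_snd, smul_eq_mul, mul_smul, smul_sub, RingHom.id_apply]
    · simp only [Prod.smul_fst, Prod.smul_snd, smul_eq_mul, hh.smul_right, mul_add, mul_assoc,
        RingHom.id_apply]
  left_inv v := by
    refine Prod.ext ?_ (Prod.ext rfl ?_)
    · simp only [sub_add_cancel]
    · simp only [sub_add_cancel]; abel
  right_inv v := by
    refine Prod.ext ?_ (Prod.ext rfl ?_)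
    · simp only [add_sub_cancel_right]
    · simp only []; abel

/-- The two opposite Heisenberg groups, `heisE` for `false` and `heisF` for `true`. -/
def heis (hh : IsEpsForm ε j h) : Bool → M → C → ((M × C × C) ≃ₗ[C] (M × C × C))
  | false => heisE hh
  | true => heisF hh

/-- The sign which occurs in the group law of `heis`. -/
def heisSign (ε : ℤ) (δ : Bool) : ℤ := if δ then 1 else ε

variable (hh : IsEpsForm ε j h)

theorem heisE_apply (q : M) (l : C) (p : M) (b a : C) :
    heisE hh q l (p, b, a) = (p - ε • a • q, b + h q p + a * l, a) := rfl

theorem heisF_apply (q : M) (l : C) (p : M) (b a : C) :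
    heisF hh q l (p, b, a) = (p - b • q, b, a + h q p + b * l) := rfl

theorem heisE_inv_apply (q : M) (l : C) (p : M) (b a : C) :
    (heisE hh q l)⁻¹ (p, b, a) =
      (p + ε • a • q, b - h q (p + ε • a • q) - a * l, a) := rfl

theorem heisF_inv_apply (q : M) (l : C) (p : M) (b a : C) :
    (heisF hh q l)⁻¹ (p, b, a) = (p + b • q, b, a - h q (p + b • q) - b * l) := rfl

theorem equiv_perp_ext {g g' : (M × C × C) ≃ₗ[C] (M × C × C)}
    (H : ∀ (p : M) (b a : C), g (p, b, a) = g' (p, b, a)) : g = g' :=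
  LinearEquiv.ext fun v => H v.1 v.2.1 v.2.2

theorem heis_mul (δ : Bool) (q q' : M) (l l' : C) :
    heis hh δ q l * heis hh δ q' l' = heis hh δ (q + q') (l + l' - heisSign ε δ • h q q') := by
  refine equiv_perp_ext fun p b a => ?_
  cases δ
  · change heisE hh q l (heisE hh q' l' (p, b, a)) = heisE hh _ _ (p, b, a)
    rw [heisE_apply, heisE_apply, heisE_apply]
    refine Prod.ext ?_ (Prod.ext ?_ rfl)
    · simp only [smul_add]; abel
    · simp only [heisSign, map_sub, map_zsmul, hh.smul_right, LinearMap.map_add₂, mul_sub, mul_add,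
        mul_smul_comm, Bool.false_eq_true, if_false]
      abel
  · change heisF hh q l (heisF hh q' l' (p, b, a)) = heisF hh _ _ (p, b, a)
    rw [heisF_apply, heisF_apply, heisF_apply]
    refine Prod.ext ?_ (Prod.ext rfl ?_)
    · simp only [smul_add]; abel
    · simp only [heisSign, map_sub, hh.smul_right, LinearMap.map_add₂, mul_sub, mul_add,
        if_true, one_smul]
      abel

theorem heis_zero (δ : Bool) : heis hh δ 0 0 = 1 := by
  refine equiv_perp_ext fun p b a => ?_
  cases δ
  · change heisE hh 0 0 (p, b, a) = (p, b, a)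
    simp [heisE_apply]
  · change heisF hh 0 0 (p, b, a) = (p, b, a)
    simp [heisF_apply]

theorem heis_mul_of_orth (δ : Bool) {q q' : M} (hq : h q q' = 0) (l l' : C) :
    heis hh δ q l * heis hh δ q' l' = heis hh δ (q + q') (l + l') := by
  rw [heis_mul, hq, smul_zero, sub_zero]

theorem heis_neg (δ : Bool) {q : M} (hq : h q q = 0) : heis hh δ (-q) 0 = (heis hh δ q 0)⁻¹ :=
  eq_inv_of_mul_eq_one_left (by
    rw [heis_mul_of_orth hh δ (by rw [LinearMap.map_neg₂, hq, neg_zero]), neg_add_cancel, add_zero,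
      heis_zero])

theorem heis_commute (δ : Bool) {q q' : M} (hq : h q q' = 0) (l l' : C) :
    heis hh δ q l * heis hh δ q' l' = heis hh δ q' l' * heis hh δ q l := by
  rw [heis_mul_of_orth hh δ hq, heis_mul_of_orth hh δ (hh.symm_eq_zero hq), add_comm q, add_comm l]

/-- The commutator of root elements from opposite Heisenberg groups. -/
theorem comm_heisE_heisF_apply {x y : M} (hx : h x x = 0) (hy : h y y = 0) (hxy : h x y = 0)
    (p : M) (b a : C) :
    (heis hh false x 0 * heis hh true y 0 * (heis hh false x 0)⁻¹ * (heis hh true y 0)⁻¹ :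
      (M × C × C) ≃ₗ[C] (M × C × C)) (p, b, a) =
      (p + h x p • y - ε • h y p • x, b, a) := by
  have hyx := hh.symm_eq_zero hxy
  change heisE hh x 0 (heisF hh y 0 ((heisE hh x 0)⁻¹ ((heisF hh y 0)⁻¹ (p, b, a)))) = _
  rw [heisF_inv_apply, heisE_inv_apply, heisF_apply, heisE_apply]
  simp only [map_add, map_sub, map_zsmul, hh.smul_right, hx, hy, hxy, hyx, mul_zero, smul_zero,
    add_zero, sub_zero, sub_add_cancel, sub_smul, smul_sub]
  refine Prod.ext ?_ rfl
  simp only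
  abel

/-- The map `p ↦ p + ⟨x, p⟩ y - ε ⟨y, p⟩ x`, an Eichler transformation of `M` if `x` and `y` are
isotropic and orthogonal. -/
def eichler (x y : M) : M →ₗ[C] M where
  toFun p := p + h x p • y - ε • h y p • x
  map_add' p q := by simp only [map_add, add_smul, smul_add]; abel
  map_smul' c p := by
    simp only [hh.smul_right, mul_smul, smul_sub, smul_add, RingHom.id_apply, smul_comm c ε]

theorem eichler_apply (x y p : M) : eichler hh x y p = p + h x p • y - ε • h y p • x := rfl

theorem eichler_isometry {x y : M} (hx : h x x = 0) (hy : h y y = 0) (hxy : h x y = 0) (p q : M) :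
    h (eichler hh x y p) (eichler hh x y q) = h p q := by
  have hyx := hh.symm_eq_zero hxy
  have e1 : h p y = ε • j.toLin (h y p) := hh.symm y p
  have e2 : h p x = ε • j.toLin (h x p) := hh.symm x p
  rw [eichler_apply, eichler_apply]
  simp only [map_add, map_sub, form_zsmul_right, form_zsmul_left, LinearMap.add_apply,
    LinearMap.sub_apply, hh.smul_right, hh.smul_left, hx, hy, hxy, hyx, zero_mul, mul_zero,
    smul_zero, add_zero, sub_zero, e1, e2, mul_smul_comm, hh.eps_smul_smul]
  abel

/-- An isometry `t₀` of `M`, extended by the identity of `C²`, normalizes both Heisenberg groups. -/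
theorem mul_heis_of_isometry {t : (M × C × C) ≃ₗ[C] (M × C × C)} {t₀ : M →ₗ[C] M}
    (ht : ∀ (p : M) (b a : C), t (p, b, a) = (t₀ p, b, a))
    (ht₀ : ∀ p q, h (t₀ p) (t₀ q) = h p q) (δ : Bool) (q : M) (l : C) :
    t * heis hh δ q l = heis hh δ (t₀ q) l * t := by
  refine equiv_perp_ext fun p b a => ?_
  cases δ
  · change t (heisE hh q l (p, b, a)) = heisE hh (t₀ q) l (t (p, b, a))
    simp only [heisE_apply, ht, ht₀, map_sub, map_zsmul, map_smul]
  · change t (heisF hh q l (p, b, a)) = heisF hh (t₀ q) l (t (p, b, a))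
    simp only [heisF_apply, ht, ht₀, map_sub, map_smul]

end Unitary

/-! ### Conjugation of unitary congruence subgroups -/

section UnitaryCongruence

variable {S C M : Type*} [CommRing S] [Ring C] [Algebra S C]
  [AddCommGroup M] [Module S M] [Module C M] {ε : ℤ} {j : Involution S C}
  {h : LinearMap.BilinMap S M C} (hh : IsEpsForm ε j h)

/-- The commutator of `heisE x` and `heisF y` depends only on the Eichler transformation. -/
theorem comm_heisE_heisF_congr {x y x' y' : M} (hx : h x x = 0) (hy : h y y = 0) (hxy : h x y = 0)
    (hx' : h x' x' = 0) (hy' : h y' y' = 0) (hxy' : h x' y' = 0)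
    (H₁ : ∀ p, h x p • y = h x' p • y') (H₂ : ∀ p, h y p • x = h y' p • x') :
    (heis hh false x 0 * heis hh true y 0 * (heis hh false x 0)⁻¹ * (heis hh true y 0)⁻¹ :
      (M × C × C) ≃ₗ[C] (M × C × C)) =
    heis hh false x' 0 * heis hh true y' 0 * (heis hh false x' 0)⁻¹ * (heis hh true y' 0)⁻¹ :=
  equiv_perp_ext fun p b a => by
    rw [comm_heisE_heisF_apply hh hx hy hxy, comm_heisE_heisF_apply hh hx' hy' hxy', H₁, H₂]

variable {R : Type*} [CommRing R] [Algebra R C] {ι : Type*} (x : Bool → ι → M)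

/-- The subgroup generated by the root elements along the isotropic vectors `x κ i` with
coefficients in `c C₀`. -/
def uniCongruence (C₀ : Set C) (c : R) : Subgroup ((M × C × C) ≃ₗ[C] (M × C × C)) :=
  Subgroup.closure {g | ∃ δ κ i, ∃ d ∈ C₀, g = heis hh δ ((c • d) • x κ i) 0}

variable {x}

theorem heis_mem_uniCongruence {C₀ : Set C} {c : R} {d : C} (δ κ : Bool) (i : ι) (hd : d ∈ C₀) :
    heis hh δ ((c • d) • x κ i) 0 ∈ uniCongruence hh x C₀ c :=
  Subgroup.subset_closure ⟨δ, κ, i, d, hd, rfl⟩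

variable {C₀ : Subalgebra R C} {s : R}

variable [Algebra R S] [IsScalarTower R S C]

theorem Involution.map_smul_of_tower (j : Involution S C) (r : R) (c : C) :
    j.toLin (r • c) = r • j.toLin c := by
  rw [← algebraMap_smul S r c, _root_.map_smul, algebraMap_smul]

/-- Conjugation of a root element along `v` by one along `w`, by means of a hyperbolic pair `y`, `z`
which is orthogonal to both: the first root element is the commutator of an Eichler
transformation in the plane of `v` and `y` and a root element along `z`. -/
theorem conj_heis_mem {H : Subgroup ((M × C × C) ≃ₗ[C] (M × C × C))} {v w y z : M}
    (hvv : h v v = 0) (hww : h w w = 0) (hyy : h y y = 0) (hzz : h z z = 0)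
    (hvy : h v y = 0) (hvz : h v z = 0) (hwy : h w y = 0) (hwz : h w z = 0)
    (hyz : h y z = algebraMap R C s) (hvw : h v w ∈ C₀) (hj : ∀ d ∈ C₀, j.toLin d ∈ C₀)
    {m k : ℕ} (hHv : ∀ δ, ∀ d ∈ C₀, heis hh δ ((s ^ m • d) • v) 0 ∈ H)
    (hHw : ∀ δ, ∀ d ∈ C₀, heis hh δ ((s ^ m • d) • w) 0 ∈ H)
    (hHy : ∀ δ, ∀ d ∈ C₀, heis hh δ ((s ^ m • d) • y) 0 ∈ H)
    (hHz : ∀ δ, ∀ d ∈ C₀, heis hh δ ((s ^ m • d) • z) 0 ∈ H)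
    {c d : C} (hc : s ^ k • c ∈ C₀) (hd : d ∈ C₀) (δ δ' : Bool) :
    heis hh δ' (c • w) 0 * heis hh δ ((s ^ (4 * m + 2 * k + 1) • d) • v) 0 *
      (heis hh δ' (c • w) 0)⁻¹ ∈ H := by
  have hyv := hh.symm_eq_zero hvy
  have hzv := hh.symm_eq_zero hvz
  have hyw := hh.symm_eq_zero hwy
  have hzw := hh.symm_eq_zero hwz
  set n := 2 * m + k with hn
  set g := heis hh δ' (c • w) 0
  set u := (s ^ n • (-(ε • d))) • v with hu
  have huu : h u u = 0 := by rw [hu, hh.smul_left, hh.smul_right, hvv, mul_zero, zero_mul]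
  have huy : h u y = 0 := by rw [hu, hh.smul_left, hvy, zero_mul]
  have huz : h u z = 0 := by rw [hu, hh.smul_left, hvz, zero_mul]
  have hcw : h (c • w) (c • w) = 0 := by rw [hh.smul_left, hh.smul_right, hww, mul_zero, zero_mul]
  set t := heis hh false u 0 * heis hh true y 0 * (heis hh false u 0)⁻¹ * (heis hh true y 0)⁻¹
    with ht
  have ht_apply : ∀ (p : M) (b a : C), t (p, b, a) = (eichler hh u y p, b, a) := fun p b a =>
    comm_heisE_heisF_apply hh huu hyy huy p b a
  have ht_conj := mul_heis_of_isometry hh ht_apply (eichler_isometry hh huu hyy huy)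
  have htH : t ∈ H := by
    have hd' : -(ε • d) ∈ C₀ := neg_mem (zsmul_mem hd _)
    have h1 : ∀ a b : C, h (a • v) (b • v) = 0 := fun a b => by
      rw [hh.smul_left, hh.smul_right, hvv, mul_zero, zero_mul]
    have h2 : ∀ a b : C, h (a • y) (b • y) = 0 := fun a b => by
      rw [hh.smul_left, hh.smul_right, hyy, mul_zero, zero_mul]
    have h3 : ∀ a b : C, h (a • v) (b • y) = 0 := fun a b => by
      rw [hh.smul_left, hh.smul_right, hvy, mul_zero, zero_mul]
    have h4 := comm_heisE_heisF_congr hh (x := u) (y := y) (x' := (s ^ m • (-(ε • d))) • v)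
      (y' := (s ^ m • s ^ k • (1 : C)) • y) huu hyy huy (h1 _ _) (h2 _ _) (h3 _ _)
      (fun p => by
        rw [hu, hh.smul_left, hh.smul_left, smul_smul]
        congr 1
        simp only [Involution.map_smul_of_tower, mul_smul_comm, smul_smul,
          ← pow_add, mul_one]
        congr 2; omega)
      (fun p => by
        rw [hu, hh.smul_left, smul_smul, smul_smul]
        congr 1
        simp only [Involution.map_smul_of_tower, Involution.map_one, mul_smul_comm,
          smul_mul_assoc, smul_smul, ← pow_add, mul_one]
        congr 2; omega)
    rw [ht, h4]
    exact comm_mem (hHv _ _ hd') (hHy _ _ (C₀.smul_mem (one_mem _) _))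
  set z' := (s ^ n • (1 : C)) • z with hz'
  have hz'z' : h z' z' = 0 := by rw [hz', hh.smul_left, hh.smul_right, hzz, mul_zero, zero_mul]
  have hzw' : h z' (c • w) = 0 := by
    rw [hz', hh.smul_left, hh.smul_right, hzw, mul_zero, zero_mul]
  have hwz' := hh.symm_eq_zero hzw'
  set f := heis hh δ z' 0
  have hf : g * f * g⁻¹ ∈ H := by
    have hfH : f ∈ H := by
      have := hHz δ _ (C₀.smul_mem (one_mem C₀) (s ^ (m + k)))
      rwa [smul_smul, ← pow_add, ← add_assoc, ← two_mul] at this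
    have h1 : ∀ a b : C, h (a • w) (b • w) = 0 := fun a b => by
      rw [hh.smul_left, hh.smul_right, hww, mul_zero, zero_mul]
    have h2 : ∀ a b : C, h (a • z) (b • z) = 0 := fun a b => by
      rw [hh.smul_left, hh.smul_right, hzz, mul_zero, zero_mul]
    have h3 : ∀ a b : C, h (a • w) (b • z) = 0 := fun a b => by
      rw [hh.smul_left, hh.smul_right, hwz, mul_zero, zero_mul]
    have e1 : ∀ p, h (c • w) p • z' =
        h ((s ^ m • s ^ k • c) • w) p • (s ^ m • (1 : C)) • z := fun p => by
      rw [hz', hh.smul_left, hh.smul_left, smul_smul, smul_smul]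
      congr 1
      simp only [Involution.map_smul_of_tower, mul_smul_comm, smul_smul,
        ← pow_add, mul_one]
      congr 2; omega
    have e2 : ∀ p, h z' p • c • w =
        h ((s ^ m • (1 : C)) • z) p • (s ^ m • s ^ k • c) • w := fun p => by
      rw [hz', hh.smul_left, hh.smul_left, smul_smul, smul_smul]
      congr 1
      simp only [Involution.map_smul_of_tower, Involution.map_one, mul_smul_comm, smul_mul_assoc,
        smul_smul, ← pow_add, mul_one]
      congr 2; omega
    by_cases hδ : δ = δ'
    · subst hδ
      rw [heis_commute hh δ hwz', mul_inv_cancel_right]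
      exact hfH
    · have h4 : g * f * g⁻¹ * f⁻¹ ∈ H := by
        cases δ <;> cases δ'
        · exact absurd rfl hδ
        · have := comm_heisE_heisF_congr hh (hz'z') hcw hzw' (h2 _ _) (h1 _ _)
            (hh.symm_eq_zero (h3 _ _)) e2 e1
          have h5 := inv_mem (comm_mem (hHz false _ (one_mem C₀)) (hHw true _ hc))
          rw [← this] at h5
          simpa [mul_assoc] using h5
        · have := comm_heisE_heisF_congr hh hcw (hz'z') hwz' (h1 _ _) (h2 _ _) (h3 _ _) e1 e2
          have h5 := comm_mem (hHw false _ hc) (hHz true _ (one_mem C₀))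
          rw [← this] at h5
          exact h5
        · exact absurd rfl hδ
      have h5 := mul_mem h4 hfH
      rwa [inv_mul_cancel_right] at h5
  have hg : g * t * g⁻¹ ∈ H := by
    have h1 : eichler hh u y (-(c • w)) = -(c • w) +
        (s ^ m • ((s ^ m • s ^ k • c) * h v w * j.toLin (ε • d))) • y := by
      rw [eichler_apply, hu]
      simp only [map_neg, hh.smul_left, hh.smul_right, hyw, mul_zero, neg_zero, zero_smul,
        smul_zero, sub_zero]
      congr 2
      simp only [Involution.map_smul_of_tower, map_neg, mul_smul_comm, smul_mul_assoc, smul_smul,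
        ← pow_add, mul_neg, neg_mul, smul_neg, neg_neg, mul_assoc]
      rw [smul_comm ε (s ^ (m + k)), smul_smul, ← pow_add]
      congr 2; omega
    have h2 : g * t * g⁻¹ =
        heis hh δ' ((s ^ m • ((s ^ m • s ^ k • c) * h v w * j.toLin (ε • d))) • y) 0 * t := by
      rw [← heis_neg hh δ' hcw, mul_assoc, ht_conj, ← mul_assoc, h1, heis_mul_of_orth,
        add_neg_cancel_left, add_zero]
      rw [map_add, map_neg, hcw, hh.smul_left, hh.smul_right, hwy]
      simp
    rw [h2]
    exact mul_mem (hHy _ _ (mul_mem (mul_mem (C₀.smul_mem hc _) hvw) (hj _ (zsmul_mem hd _)))) htH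
  have h1 : heis hh δ ((s ^ (4 * m + 2 * k + 1) • d) • v) 0 = t * f * t⁻¹ * f⁻¹ := by
    have e1 : eichler hh u y z' = z' + (s ^ (4 * m + 2 * k + 1) • d) • v := by
      have huz' : h u z' = 0 := by rw [hz', hh.smul_right, huz, mul_zero]
      rw [eichler_apply, huz', zero_smul, add_zero, hz', hh.smul_right, hyz, hu,
        sub_eq_add_neg]
      congr 1
      rw [Algebra.algebraMap_eq_smul_one, smul_smul, ← smul_neg, ← neg_smul, ← smul_assoc]
      congr 1
      simp only [mul_smul_comm, smul_mul_assoc, smul_smul, mul_one, smul_neg, mul_neg,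
        neg_neg, one_mul]
      rw [smul_comm ε, smul_smul ε ε, hh.eps, one_smul, smul_smul]
      congr 1
      rw [hn]; ring
    rw [ht_conj, mul_inv_cancel_right, ← heis_neg hh δ hz'z', heis_mul_of_orth, e1, add_zero,
      add_neg_cancel_comm]
    rw [e1, map_neg, LinearMap.map_add₂, hz'z', hz', hh.smul_left, hh.smul_right, hvz]
    simp
  have h4 := comm_mem hg hf
  rw [h1]
  simpa [mul_assoc] using h4

/-- The vectors `x false i`, `x true i` form hyperbolic pairs up to the scalar `s`. -/
structure IsHypFamily (h : LinearMap.BilinMap S M C) [DecidableEq ι] (x : Bool → ι → M)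
    (s : C) : Prop where
  isotropic : ∀ κ i k, h (x κ i) (x κ k) = 0
  pair : ∀ i k, h (x false i) (x true k) = if i = k then s else 0

include hh in
theorem IsHypFamily.orth [DecidableEq ι] {c : C} (hx : IsHypFamily h x c) {i k : ι} (hik : i ≠ k)
    (κ κ' : Bool) : h (x κ i) (x κ' k) = 0 := by
  cases κ <;> cases κ'
  · exact hx.isotropic _ _ _
  · rw [hx.pair, if_neg hik]
  · exact hh.symm_eq_zero (by rw [hx.pair, if_neg hik.symm])
  · exact hx.isotropic _ _ _

/-- Conjugation by a product of root elements maps a deep congruence subgroup into a given one. Any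
two of the hyperbolic planes must leave a third one, which provides the pair for `conj_heis_mem`. -/
theorem exists_conj_uniCongruence_le [DecidableEq ι]
    (hι : ∀ i k : ι, ∃ l, l ≠ i ∧ l ≠ k) (hx : IsHypFamily h x (algebraMap R C s))
    (hj : ∀ d ∈ C₀, j.toLin d ∈ C₀)
    (hden : ∀ c : C, ∃ k : ℕ, s ^ k • c ∈ C₀) {g : (M × C × C) ≃ₗ[C] (M × C × C)}
    (hg : g ∈ uniCongruence hh x Set.univ (1 : R)) (m : ℕ) :
    ∃ n, ∀ f ∈ uniCongruence hh x C₀ (s ^ n), g * f * g⁻¹ ∈ uniCongruence hh x C₀ (s ^ m) := by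
  have gen : ∀ δ' κ' i' (c : C) (m : ℕ),
      ∃ n, ∀ f ∈ uniCongruence hh x C₀ (s ^ n),
        heis hh δ' (c • x κ' i') 0 * f * (heis hh δ' (c • x κ' i') 0)⁻¹ ∈
          uniCongruence hh x C₀ (s ^ m) := by
    intro δ' κ' i' c m
    obtain ⟨k, hk⟩ := hden c
    refine ⟨4 * m + 2 * k + 1, ?_⟩
    have : uniCongruence hh x C₀ (s ^ (4 * m + 2 * k + 1)) ≤ (uniCongruence hh x C₀ (s ^ m)).comap
        (MulAut.conj (heis hh δ' (c • x κ' i') 0)).toMonoidHom := by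
      refine (Subgroup.closure_le _).2 ?_
      rintro _ ⟨δ, κ, i, d, hd, rfl⟩
      obtain ⟨l, hl, hl'⟩ := hι i i'
      have hmem : ∀ κ i δ, ∀ d ∈ C₀, heis hh δ ((s ^ m • d) • x κ i) 0 ∈
          uniCongruence hh x C₀ (s ^ m) := fun κ i δ d hd => heis_mem_uniCongruence hh δ κ i hd
      refine conj_heis_mem hh (v := x κ i) (w := x κ' i') (y := x false l) (z := x true l)
        (hx.isotropic _ _ _) (hx.isotropic _ _ _) (hx.isotropic _ _ _) (hx.isotropic _ _ _)
        (hx.orth hh hl.symm _ _) (hx.orth hh hl.symm _ _) (hx.orth hh hl'.symm _ _)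
        (hx.orth hh hl'.symm _ _) (by rw [hx.pair, if_pos rfl]) ?_ hj (hmem _ _) (hmem _ _)
        (hmem _ _) (hmem _ _) hk hd δ δ'
      by_cases hii : i = i'
      · subst hii
        cases κ <;> cases κ'
        · rw [hx.isotropic]; exact zero_mem _
        · rw [hx.pair, if_pos rfl]; exact C₀.algebraMap_mem s
        · rw [hh.symm (x false i), hx.pair, if_pos rfl]
          exact zsmul_mem (hj _ (C₀.algebraMap_mem s)) _
        · rw [hx.isotropic]; exact zero_mem _
      · rw [hx.orth hh hii]; exact zero_mem _
    exact fun f hf => this hf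
  induction hg using Subgroup.closure_induction'' generalizing m with
  | mem g hg =>
    obtain ⟨δ, κ, i, d, -, rfl⟩ := hg
    exact gen δ κ i _ m
  | inv_mem g hg =>
    obtain ⟨δ, κ, i, d, -, rfl⟩ := hg
    rw [← heis_neg hh δ (by rw [hh.smul_left, hh.smul_right, hx.isotropic, mul_zero, zero_mul]),
      ← neg_smul]
    exact gen δ κ i _ m
  | one => exact ⟨m, fun h hh => by simpa using hh⟩
  | mul g g' _ _ hg hg' =>
    obtain ⟨n, hn⟩ := hg m
    obtain ⟨n', hn'⟩ := hg' n
    refine ⟨n', fun h hh => ?_⟩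
    have := hn _ (hn' h hh)
    simpa [mul_assoc] using this

end UnitaryCongruence

/-! ### Generation of the unitary transvection groups by root elements -/

section UnitaryGeneration

variable {S C M : Type*} [CommRing S] [Ring C] [Algebra S C]
  [AddCommGroup M] [Module S M] [Module C M] {ε : ℤ} {j : Involution S C}
  {h : LinearMap.BilinMap S M C} (hh : IsEpsForm ε j h)

/-- The condition for `heis hh δ q l` to be an isometry. -/
def HeisIsometric (ε : ℤ) (j : Involution S C) (h : LinearMap.BilinMap S M C) (δ : Bool) (q : M)
    (l : C) : Prop :=
  heisSign ε δ • h q q + l + ε • j.toLin l = 0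

omit [Module C M] in
theorem heisIsometric_zero (δ : Bool) {q : M} (hq : h q q = 0) : HeisIsometric ε j h δ q 0 := by
  rw [HeisIsometric, hq, map_zero, smul_zero, smul_zero, add_zero, add_zero]

include hh in
theorem HeisIsometric.mul {δ : Bool} {q q' : M} {l l' : C} (H : HeisIsometric ε j h δ q l)
    (H' : HeisIsometric ε j h δ q' l') :
    HeisIsometric ε j h δ (q + q') (l + l' - heisSign ε δ • h q q') := by
  unfold HeisIsometric at *
  have h1 : h q' q = ε • j.toLin (h q q') := hh.symm q q'
  rw [map_add, LinearMap.map_add₂, LinearMap.map_add₂, h1, map_sub, map_add, map_zsmul]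
  calc _ = (heisSign ε δ • h q q + l + ε • j.toLin l) +
      (heisSign ε δ • h q' q' + l' + ε • j.toLin l') := by
        simp only [smul_add, smul_sub, smul_comm (heisSign ε δ) ε]; abel
    _ = 0 := by rw [H, H', add_zero]

include hh in
theorem heisSign_smul_smul (δ : Bool) (c : C) : heisSign ε δ • heisSign ε δ • c = c := by
  cases δ
  · exact hh.eps_smul_smul c
  · simp [heisSign]

theorem heis_zero_mul (δ : Bool) (q : M) (m l : C) :
    heis hh δ 0 m * heis hh δ q l = heis hh δ q (m + l) := by
  rw [heis_mul_of_orth hh δ (by rw [map_zero, LinearMap.zero_apply]), zero_add]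

variable {ι : Type*} [Fintype ι] [DecidableEq ι] {x : Bool → ι → M}

/-- If a hyperbolic family spans the module up to a unit and `2` is invertible, then the root
elements generate both Heisenberg groups. -/
theorem heis_mem_uniCongruence_univ [Nonempty ι] (h2 : IsUnit (2 : S)) {s : S}
    (hs : IsUnit (algebraMap S C s)) (hx : IsHypFamily h x (algebraMap S C s))
    (hsum : ∀ p, algebraMap S C s • p =
      ∑ i, (h (x false i) p • x true i + ε • h (x true i) p • x false i))
    (δ : Bool) {q : M} {l : C} (hql : HeisIsometric ε j h δ q l) :
    heis hh δ q l ∈ uniCongruence hh x Set.univ (1 : S) := by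
  set K := uniCongruence hh x Set.univ (1 : S)
  obtain ⟨u, hu⟩ := hs
  have hroot : ∀ (κ : Bool) (i : ι) (c : C), heis hh δ (c • x κ i) 0 ∈ K := fun κ i c => by
    have := heis_mem_uniCongruence (c := (1 : S)) hh (x := x) δ κ i (Set.mem_univ c)
    rwa [one_smul] at this
  have hiso : ∀ (κ : Bool) (i : ι) (a b : C), h (a • x κ i) (b • x κ i) = 0 := fun κ i a b => by
    rw [hh.smul_left, hh.smul_right, hx.isotropic, mul_zero, zero_mul]
  -- The vectors which occur as first parameter of an isometric element of `K`.
  let T : Set M := {q | ∃ l, HeisIsometric ε j h δ q l ∧ heis hh δ q l ∈ K}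
  have hTroot : ∀ (κ : Bool) (i : ι) (c : C), c • x κ i ∈ T := fun κ i c =>
    ⟨0, heisIsometric_zero δ (hiso κ i c c), hroot κ i c⟩
  have hTadd : ∀ {q q'}, q ∈ T → q' ∈ T → q + q' ∈ T := fun {q q'} ⟨l, H, hl⟩ ⟨l', H', hl'⟩ =>
    ⟨_, H.mul hh H', by rw [← heis_mul]; exact mul_mem hl hl'⟩
  have hTsum : ∀ (t : Finset ι) (g : ι → M), (∀ i, g i ∈ T) → ∑ i ∈ t, g i ∈ T := fun t g hg => by
    induction t using Finset.induction_on with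
    | empty =>
      rw [Finset.sum_empty]
      exact ⟨0, heisIsometric_zero δ (map_zero _), by rw [heis_zero]; exact one_mem _⟩
    | insert i t hi ih => rw [Finset.sum_insert hi]; exact hTadd (hg i) ih
  have hqT : q ∈ T := by
    have h1 : q = ∑ i, (((↑u⁻¹ : C) * h (x false i) q) • x true i +
        ((↑u⁻¹ : C) * ε • h (x true i) q) • x false i) := by
      have h2 := congrArg ((↑u⁻¹ : C) • ·) (hsum q)
      simp only [← hu, smul_smul, Units.inv_mul, one_smul, Finset.smul_sum] at h2
      refine h2.trans (Finset.sum_congr rfl fun i _ => ?_)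
      rw [smul_add, mul_smul, mul_smul_comm, smul_assoc, mul_smul, smul_comm ε (↑u⁻¹ : C)]
    rw [h1]
    exact hTsum _ _ fun i => hTadd (hTroot _ _ _) (hTroot _ _ _)
  obtain ⟨l', H', hl'⟩ := hqT
  set m := l - l' with hm
  have hmj : ε • j.toLin m = -m := by
    unfold HeisIsometric at hql H'
    have h1 := hql.trans H'.symm
    rw [add_assoc, add_assoc, add_right_inj] at h1
    rw [hm, map_sub, smul_sub, sub_eq_iff_eq_add, ← add_right_inj l, h1]
    abel
  have hl : heis hh δ q l = heis hh δ 0 m * heis hh δ q l' := by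
    rw [heis_zero_mul, hm, sub_add_cancel]
  rw [hl]
  refine mul_mem ?_ hl'
  -- The centre of the Heisenberg group consists of commutators.
  obtain ⟨i⟩ := ‹Nonempty ι›
  obtain ⟨w, hw⟩ := h2
  set t : S := ↑w⁻¹
  have ht : t • m + t • m = m := by
    rw [← two_smul S, smul_smul, ← hw, Units.mul_inv, one_smul]
  set c : C := ε • heisSign ε δ • t • m with hc
  have e1 : h (c • x false i) ((↑u⁻¹ : C) • x true i) = j.toLin c := by
    rw [hh.smul_left, hh.smul_right, hx.pair, if_pos rfl, ← hu, Units.inv_mul, one_mul]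
  have e2 : h ((↑u⁻¹ : C) • x true i) (c • x false i) = ε • c := by
    rw [hh.symm, e1, j.map_map]
  have e3 : heisSign ε δ • ε • c = t • m := by
    rw [hc, hh.eps_smul_smul, heisSign_smul_smul hh]
  have e4 : heisSign ε δ • j.toLin c = -(t • m) := by
    rw [hc, map_zsmul, map_zsmul, smul_comm ε, heisSign_smul_smul hh, map_smul, smul_comm ε, hmj,
      smul_neg]
  have e5 : heis hh δ 0 m * (heis hh δ ((↑u⁻¹ : C) • x true i) 0 * heis hh δ (c • x false i) 0) =
      heis hh δ (c • x false i) 0 * heis hh δ ((↑u⁻¹ : C) • x true i) 0 := by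
    rw [heis_mul hh δ (_ • x true i), heis_zero_mul, heis_mul, e1, e2, e3, e4,
      add_comm (c • x false i)]
    congr 1
    rw [zero_add, zero_sub, zero_sub, neg_neg, ← sub_eq_add_neg, sub_eq_iff_eq_add, ht]
  rw [eq_mul_inv_of_mul_eq e5]
  exact mul_mem (mul_mem (hroot _ _ _) (hroot _ _ _)) (inv_mem (mul_mem (hroot _ _ _)
    (hroot _ _ _)))

end UnitaryGeneration

section Generators

variable {S C M : Type*} [CommRing S] [Ring C] [Algebra S C]
  [AddCommGroup M] [Module S M] [Module C M] {j : Involution S C}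
  {h : LinearMap.BilinMap S M C}

theorem heis_mem_isometryGroup {ε : ℤ} (hh : IsEpsForm ε j h) {δ : Bool} {q : M} {l : C}
    (H : HeisIsometric ε j h δ q l) :
    heis hh δ q l ∈ isometryGroup (C := C) (perpForm ε j h) := by
  rintro ⟨p, b, a⟩ ⟨p', b', a'⟩
  have h1 : h p q = ε • j.toLin (h q p) := hh.symm q p
  cases δ
  · have H' : ε • h q q = -l - ε • j.toLin l := by
      have := H
      rw [HeisIsometric, add_assoc, add_eq_zero_iff_eq_neg] at this
      rw [← neg_add']; simpa [heisSign] using this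
    have H'' : h q q = - ε • l - j.toLin l := by
      rw [← hh.eps_smul_smul (h q q), H', smul_sub, hh.eps_smul_smul, smul_neg, neg_smul]
    simp only [heis, heisE_apply, perpForm, map_sub, LinearMap.sub_apply, form_zsmul_left,
      form_zsmul_right, hh.smul_left, hh.smul_right, h1, H'', map_add, j.map_mul, mul_add, add_mul,
      smul_add, smul_sub, mul_sub, sub_mul, neg_smul, mul_neg, neg_mul, smul_neg,
      smul_mul_assoc, mul_smul_comm, hh.eps_smul_smul, mul_assoc]
    abel
  · have H' : h q q = -l - ε • j.toLin l := by
      have := H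
      rw [HeisIsometric, add_assoc, add_eq_zero_iff_eq_neg] at this
      rw [← neg_add']; simpa [heisSign] using this
    simp only [heis, heisF_apply, perpForm, map_sub, LinearMap.sub_apply,
      hh.smul_left, hh.smul_right, h1, H', map_add, j.map_mul, mul_add, add_mul,
      smul_add, mul_sub, sub_mul, mul_neg, neg_mul,
      smul_mul_assoc, mul_smul_comm, mul_assoc]
    abel

theorem heisIsometric_of_mem {ε : ℤ} (hh : IsEpsForm ε j h) {δ : Bool} {q : M} {l : C}
    (H : heis hh δ q l ∈ isometryGroup (C := C) (perpForm ε j h)) :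
    HeisIsometric ε j h δ q l := by
  cases δ
  · have := H (0, 0, 1) (0, 0, 1)
    simp only [heis, heisE_apply, perpForm, form_zsmul_left, map_zero,
      form_zsmul_right, hh.smul_left, hh.smul_right, Involution.map_one, one_mul, mul_one,
      zero_add, zero_sub, LinearMap.neg_apply, map_neg, neg_neg, hh.eps_smul_smul, mul_zero,
      smul_zero] at this
    have h2 := congrArg (ε • ·) this
    simp only [smul_add, hh.eps_smul_smul, smul_zero] at h2
    rw [HeisIsometric]
    simp only [heisSign, Bool.false_eq_true, if_false]
    rw [← h2]; abel
  · have := H (0, 1, 0) (0, 1, 0)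
    simp only [heis, heisF_apply, perpForm, map_zero,
      hh.smul_left, hh.smul_right, Involution.map_one, one_mul, mul_one,
      zero_add, zero_sub, LinearMap.neg_apply, map_neg, neg_neg, mul_zero,
      smul_zero] at this
    rw [HeisIsometric]
    simp only [heisSign, if_true, one_smul]
    rw [← this]; abel

/-- The transvections of the orthogonal case are the elements `heis hh δ q 0` for isotropic `q`. -/
theorem eTransO_le_iff (hh : IsEpsForm 1 j h) (H : Subgroup ((M × C × C) ≃ₗ[C] (M × C × C))) :
    ETransO j h ≤ H ↔ ∀ δ q, h q q = 0 → heis hh δ q 0 ∈ H := by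
  constructor
  · intro hle δ q hq
    refine hle (Subgroup.subset_closure
      ⟨heis_mem_isometryGroup hh (heisIsometric_zero δ hq), q, hq, ?_⟩)
    cases δ
    · exact Or.inl fun p b a => by simp only [heis, heisE_apply, one_smul, mul_zero, add_zero]
    · exact Or.inr fun p b a => by simp only [heis, heisF_apply, mul_zero, add_zero]
  · intro H'
    refine (Subgroup.closure_le _).2 ?_
    rintro g ⟨-, q, hq, hg | hg⟩
    · have : g = heis hh false q 0 := equiv_perp_ext fun p b a => by
        simp only [hg, heis, heisE_apply, one_smul, mul_zero, add_zero]
      exact this ▸ H' false q hq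
    · have : g = heis hh true q 0 := equiv_perp_ext fun p b a => by
        simp only [hg, heis, heisF_apply, mul_zero, add_zero]
      exact this ▸ H' true q hq

/-- The central parameter of the transvections of the symplectic case. -/
def spSign (δ : Bool) : ℤ := if δ then -1 else 1

/-- The transvections of the symplectic case are the isometries `heis hh δ q (±1)`, where the sign
depends on `δ`. They are isometries for the isotropic vectors `q`. -/
theorem eTransSp_le_iff (hh : IsEpsForm (-1) j h)
    (H : Subgroup ((M × C × C) ≃ₗ[C] (M × C × C))) :
    ETransSp j h ≤ H ↔ ∀ δ q, h q q = 0 → heis hh δ q (spSign δ • (1 : C)) ∈ H := by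
  constructor
  · intro hle δ q hq
    have hiso : HeisIsometric (-1) j h δ q (spSign δ • (1 : C)) := by
      rw [HeisIsometric, hq, map_zsmul, Involution.map_one]
      simp
    refine hle (Subgroup.subset_closure ⟨heis_mem_isometryGroup hh hiso, ?_⟩)
    cases δ
    · exact ⟨q, Or.inl fun p b a => by simp [heis, heisE_apply, spSign]⟩
    · exact ⟨-q, Or.inr fun p b a => by
        simp [heis, heisF_apply, spSign, sub_eq_add_neg]⟩
  · intro H'
    have key : ∀ δ q, heis hh δ q (spSign δ • (1 : C)) ∈
        isometryGroup (C := C) (perpForm (-1) j h) → h q q = 0 := fun δ q hq => by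
      have := heisIsometric_of_mem hh hq
      rw [HeisIsometric, map_zsmul, Involution.map_one] at this
      cases δ <;> simpa [heisSign] using this
    refine (Subgroup.closure_le _).2 ?_
    rintro g ⟨hgi, q, hg | hg⟩
    · have : g = heis hh false q (spSign false • (1 : C)) := equiv_perp_ext fun p b a => by
        simp [hg, heis, heisE_apply, spSign]
      subst this
      exact H' false q (key _ _ hgi)
    · have : g = heis hh true (-q) (spSign true • (1 : C)) := equiv_perp_ext fun p b a => by
        simp [hg, heis, heisF_apply, spSign, sub_eq_add_neg]
      subst this
      exact H' true _ (key _ _ hgi)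

/-- The group of transvections in the symplectic (`ε = -1`) and the orthogonal (`ε = 1`) case. -/
def EUnitary (ε : ℤ) (j : Involution S C) (h : LinearMap.BilinMap S M C) :
    Subgroup ((M × C × C) ≃ₗ[C] (M × C × C)) :=
  if ε = 1 then ETransO j h else ETransSp j h

/-- The central parameter of the generators of `EUnitary`. -/
def uniSign (ε : ℤ) (δ : Bool) : ℤ := if ε = 1 then 0 else spSign δ

theorem IsEpsForm.eps_eq {ε : ℤ} (hh : IsEpsForm ε j h) : ε = 1 ∨ ε = -1 :=
  Int.eq_one_or_neg_one_of_mul_eq_one hh.eps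

theorem eUnitary_le_iff {ε : ℤ} (hh : IsEpsForm ε j h)
    (H : Subgroup ((M × C × C) ≃ₗ[C] (M × C × C))) :
    EUnitary ε j h ≤ H ↔ ∀ δ q, h q q = 0 → heis hh δ q (uniSign ε δ • (1 : C)) ∈ H := by
  rcases hh.eps_eq with rfl | rfl
  · simp only [EUnitary, uniSign, if_true, zero_smul]
    exact eTransO_le_iff hh H
  · simp only [EUnitary, uniSign]
    exact eTransSp_le_iff hh H

/-- The root elements along isotropic vectors belong to `EUnitary`; in the symplectic case as
quotients of two generators with the same central parameter. -/
theorem heis_mem_eUnitary {ε : ℤ} (hh : IsEpsForm ε j h) (δ : Bool) {q : M} (hq : h q q = 0) :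
    heis hh δ q 0 ∈ EUnitary ε j h := by
  have h1 := (eUnitary_le_iff hh (EUnitary ε j h)).1 le_rfl δ
  have h2 := mul_mem (inv_mem (h1 0 (map_zero _))) (h1 q hq)
  have h3 : heis hh δ q (uniSign ε δ • (1 : C)) =
      heis hh δ 0 (uniSign ε δ • (1 : C)) * heis hh δ q 0 := by
    rw [heis_zero_mul, add_zero]
  rwa [h3, inv_mul_cancel_left] at h2

theorem heisIsometric_uniSign {ε : ℤ} (hh : IsEpsForm ε j h) (δ : Bool) {q : M} (hq : h q q = 0) :
    HeisIsometric ε j h δ q (uniSign ε δ • (1 : C)) := by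
  rw [HeisIsometric, hq, map_zsmul, Involution.map_one]
  rcases hh.eps_eq with rfl | rfl <;> simp [uniSign]

end Generators

/-! ### Extension of scalars for forms, and dilation of unitary transvections -/

section UnitaryExt

variable {R : Type*} [CommRing R] {A : Type*} [Ring A] [Algebra R A]
  {P : Type*} [AddCommGroup P] [Module R P] [Module A P] [IsScalarTower R A P]
  {B : Type*} [CommRing B] [Algebra R B] {B' : Type*} [CommRing B'] [Algebra R B']

theorem Involution.ext_tmul (j : Involution R A) (b : B) (a : A) :
    (j.ext B).toLin (b ⊗ₜ[R] a) = b ⊗ₜ[R] j.toLin a := rfl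

theorem Involution.ext_extRingMap (j : Involution R A) (φ : B →ₐ[R] B') (c : ExtRing R B A) :
    (j.ext B').toLin (extRingMap R A φ c) = extRingMap R A φ ((j.ext B).toLin c) := by
  induction c using TensorProduct.induction_on with
  | zero => simp only [map_zero]
  | add x y hx hy => simp only [map_add, hx, hy]
  | tmul b a => rw [extRingMap_tmul, ext_tmul, ext_tmul, extRingMap_tmul]

omit [Module A P] [IsScalarTower R A P] in
theorem extForm_tmul (h : LinearMap.BilinMap R P A) (b b' : B) (p p' : P) :
    extForm B h (ExtMod.tmul R b p) (ExtMod.tmul R b' p') = (b * b') ⊗ₜ[R] h p p' := rfl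

omit [Module A P] [IsScalarTower R A P] in
theorem extForm_map (h : LinearMap.BilinMap R P A) (φ : B →ₐ[R] B') (x y : ExtMod R B P) :
    extForm B' h (extModMap R P φ x) (extModMap R P φ y) = extRingMap R A φ (extForm B h x y) := by
  induction x using ExtMod.induction with
  | zero => rw [extModMap_zero, map_zero, map_zero, LinearMap.zero_apply, LinearMap.zero_apply,
      map_zero]
  | add x x' hx hx' => rw [extModMap_add, LinearMap.map_add₂, hx, hx', LinearMap.map_add₂, map_add]
  | tmul b p =>
    induction y using ExtMod.induction with
    | zero => rw [extModMap_zero, map_zero, map_zero, map_zero]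
    | add y y' hy hy' => rw [extModMap_add, map_add, hy, hy', map_add, map_add]
    | tmul b' p' =>
      rw [extModMap_tmul, extModMap_tmul, extForm_tmul, extForm_tmul, extRingMap_tmul, map_mul]

variable {ε : ℤ} {j : Involution R A} {h : LinearMap.BilinMap R P A}

theorem IsEpsForm.ext (hh : IsEpsForm ε j h) (B : Type*) [CommRing B] [Algebra R B] :
    IsEpsForm ε (j.ext B) (extForm B h) where
  eps := hh.eps
  smul_right a x y := by
    induction x using ExtMod.induction with
    | zero => rw [map_zero, LinearMap.zero_apply, LinearMap.zero_apply, mul_zero]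
    | add x x' hx hx' => rw [LinearMap.map_add₂, hx, hx', LinearMap.map_add₂, mul_add]
    | tmul b p =>
      induction y using ExtMod.induction with
      | zero => rw [smul_zero, map_zero, mul_zero]
      | add y y' hy hy' => rw [smul_add, map_add, hy, hy', map_add, mul_add]
      | tmul b' p' =>
        induction a using TensorProduct.induction_on with
        | zero => rw [zero_smul, map_zero, zero_mul]
        | add a a' ha ha' => rw [add_smul, map_add, ha, ha', add_mul]
        | tmul c a =>
          rw [ext_smul_tmul, extForm_tmul, extForm_tmul, hh.smul_right,
            Algebra.TensorProduct.tmul_mul_tmul, mul_left_comm]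
  smul_left a x y := by
    induction x using ExtMod.induction with
    | zero => rw [smul_zero, map_zero, LinearMap.zero_apply, zero_mul]
    | add x x' hx hx' => rw [smul_add, LinearMap.map_add₂, hx, hx', LinearMap.map_add₂, add_mul]
    | tmul b p =>
      induction y using ExtMod.induction with
      | zero => rw [map_zero, map_zero, zero_mul]
      | add y y' hy hy' => rw [map_add, hy, hy', map_add, add_mul]
      | tmul b' p' =>
        induction a using TensorProduct.induction_on with
        | zero => rw [zero_smul, map_zero, LinearMap.zero_apply, map_zero, mul_zero]
        | add a a' ha ha' => rw [add_smul, LinearMap.map_add₂, ha, ha', map_add, mul_add]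
        | tmul c a =>
          rw [ext_smul_tmul, extForm_tmul, extForm_tmul, hh.smul_left, Involution.ext_tmul,
            Algebra.TensorProduct.tmul_mul_tmul, mul_assoc, mul_comm c]
  symm x y := by
    induction x using ExtMod.induction with
    | zero => rw [map_zero, map_zero, LinearMap.zero_apply, map_zero, smul_zero]
    | add x x' hx hx' => rw [map_add, LinearMap.map_add₂, hx, hx', map_add, smul_add]
    | tmul b p =>
      induction y using ExtMod.induction with
      | zero => rw [map_zero, LinearMap.zero_apply, map_zero, map_zero, smul_zero]
      | add y y' hy hy' =>
        rw [LinearMap.map_add₂, hy, hy', map_add, map_add, smul_add]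
      | tmul b' p' =>
        rw [extForm_tmul, extForm_tmul, hh.symm p p', Involution.ext_tmul, mul_comm b,
          ← TensorProduct.tmul_smul]

theorem extPerp_heis (hh : IsEpsForm ε j h) (φ : B →ₐ[R] B') (δ : Bool) (q : ExtMod R B P)
    (l : ExtRing R B A) :
    extPerp φ (heis (hh.ext B) δ q l) =
      heis (hh.ext B') δ (extModMap R P φ q) (extRingMap R A φ l) := by
  refine IsExtPerp.eq_extPerp ?_
  have hz : ∀ x : ExtMod R B P, extModMap R P φ (ε • x) = ε • extModMap R P φ x :=
    fun x => map_zsmul (extModMapHom φ) ε x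
  rintro ⟨p, b, a⟩
  cases δ
  · simp only [qPerpMap, heis, heisE_apply, Prod.map_apply, extModMap_sub, extModMap_smul, hz,
      extForm_map, map_add, map_mul]
  · simp only [qPerpMap, heis, heisF_apply, Prod.map_apply, extModMap_sub, extModMap_smul,
      extForm_map, map_add, map_mul]

theorem extPerp_mem_eUnitary (hh : IsEpsForm ε j h) (φ : B →ₐ[R] B')
    (g : QPerp R B A P ≃ₗ[ExtRing R B A] QPerp R B A P)
    (hg : g ∈ EUnitary ε (j.ext B) (extForm B h)) :
    extPerp φ g ∈ EUnitary ε (j.ext B') (extForm B' h) := by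
  have : EUnitary ε (j.ext B) (extForm B h) ≤
      (EUnitary ε (j.ext B') (extForm B' h)).comap (extPerp φ) := by
    rw [eUnitary_le_iff (hh.ext B)]
    intro δ q hq
    rw [Subgroup.mem_comap, extPerp_heis hh, map_zsmul, map_one]
    exact (eUnitary_le_iff (hh.ext B') _).1 le_rfl _ _ (by rw [extForm_map, hq, map_zero])
  exact this hg

/-- Vectors `x κ i` of `P`, for `i` in a finite set, which form hyperbolic pairs and a basis up to
the scalar `s`. Such data exhibit `P_s` as a hyperbolic module. -/
structure IsHypBasisAway (ε : ℤ) (h : LinearMap.BilinMap R P A) (s : R) {ι : Type*} [Fintype ι]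
    [DecidableEq ι] (x : Bool → ι → P) : Prop where
  family : IsHypFamily h x (algebraMap R A s)
  sum : ∀ p : P, s • p = ∑ i, (h (x false i) p • x true i + ε • h (x true i) p • x false i)

variable {s : R} {ι : Type*} [Fintype ι] [DecidableEq ι] {x : Bool → ι → P}

omit [IsScalarTower R A P] in
theorem IsHypBasisAway.ext_family (hx : IsHypBasisAway ε h s x) :
    IsHypFamily (extForm B h) (fun κ i => ExtMod.tmul R (1 : B) (x κ i))
      (algebraMap R (ExtRing R B A) s) where
  isotropic κ i k := by
    rw [extForm_tmul, hx.family.isotropic, TensorProduct.tmul_zero]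
  pair i k := by
    rw [extForm_tmul, hx.family.pair, one_mul]
    split_ifs
    · rw [algebraMap_extRing]
    · rw [TensorProduct.tmul_zero]

theorem IsHypBasisAway.ext_sum (hh : IsEpsForm ε j h) (hx : IsHypBasisAway ε h s x)
    (p : ExtMod R B P) :
    algebraMap R (ExtRing R B A) s • p =
      ∑ i, (extForm B h (ExtMod.tmul R (1 : B) (x false i)) p • ExtMod.tmul R (1 : B) (x true i) +
        ε • extForm B h (ExtMod.tmul R (1 : B) (x true i)) p •
          ExtMod.tmul R (1 : B) (x false i)) := by
  induction p using ExtMod.induction with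
  | zero => simp
  | add p q hp hq =>
    rw [smul_add, hp, hq, ← Finset.sum_add_distrib]
    exact Finset.sum_congr rfl fun i _ => by
      rw [map_add, map_add, add_smul, add_smul, smul_add]; abel
  | tmul b q =>
    rw [tmul_eq_smul (A := A)]
    rw [smul_smul, Algebra.commutes, mul_smul, algebraMap_extRing, smul_tmul_one, algebraMap_smul,
      hx.sum]
    have h1 : ExtMod.tmul R (1 : B)
      (∑ i, (h (x false i) q • x true i + ε • h (x true i) q • x false i)) = _ :=
        map_sum (tmulOne R B P) _ _
    rw [h1, Finset.smul_sum]
    refine Finset.sum_congr rfl fun i _ => ?_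
    rw [map_add, map_zsmul, tmulOne_apply, tmulOne_apply, ← smul_tmul_one, ← smul_tmul_one,
      (hh.ext B).smul_right, (hh.ext B).smul_right, extForm_tmul, extForm_tmul, mul_one, smul_add,
      mul_smul, mul_smul, smul_comm ε (b ⊗ₜ[R] (1 : A)), smul_comm ε (_ ⊗ₜ[R] h _ _)]

/-- The dilation property of the unitary transvection groups where `P` is hyperbolic of rank at
least six: there are three hyperbolic planes, whence the condition on `ι`. -/
theorem exists_dilation_perp (hh : IsEpsForm ε j h) (h2 : IsUnit (2 : R))
    (hι : ∀ i k : ι, ∃ l, l ≠ i ∧ l ≠ k) [Nonempty ι] (hx : IsHypBasisAway ε h s x)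
    {φ : B →ₐ[R] B'} (hφ : IsLocAway s φ)
    {θ : QPerp R B'[X] A P ≃ₗ[ExtRing R B'[X] A] QPerp R B'[X] A P}
    (hθ : θ ∈ EUnitary ε (j.ext B'[X]) (extForm B'[X] h)) :
    ∃ N : ℕ, ∃ β ∈ EUnitary ε (j.ext B[X]) (extForm B[X] h),
      extPerp (Polynomial.mapAlgHom φ) β =
        extPerp (dil B' (s ^ N)) θ * (extPerp (dil B' (0 : R)) θ)⁻¹ := by
  have hφX := hφ.polynomial
  set Φ : B[X] →ₐ[R] B'[X] := Polynomial.mapAlgHom φ with hΦ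
  set C₀ := (extRingMap R A Φ).range
  have hh' := hh.ext B'[X]
  set y : Bool → ι → ExtMod R B'[X] P := fun κ i => ExtMod.tmul R 1 (x κ i) with hy
  have hyf : IsHypFamily (extForm B'[X] h) y (algebraMap R (ExtRing R B'[X] A) s) := hx.ext_family
  have hyiso : ∀ κ i (c : ExtRing R B'[X] A), extForm B'[X] h (c • y κ i) (c • y κ i) = 0 :=
    fun κ i c => by rw [hh'.smul_left, hh'.smul_right, hyf.isotropic, mul_zero, zero_mul]
  have hX : ∀ (ψ : B'[X] →ₐ[R] B'[X]) (δ κ : Bool) (i : ι) (c : ExtRing R B'[X] A),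
      extPerp ψ (heis hh' δ (c • y κ i) 0) = heis hh' δ (extRingMap R A ψ c • y κ i) 0 :=
    fun ψ δ κ i c => by
      rw [extPerp_heis hh, extModMap_smul, hy, extModMap_tmul, map_one, map_zero]
  have hfun : ∀ (ψ : B'[X] →ₐ[R] B'[X]), ∀ g ∈ uniCongruence hh' y Set.univ (1 : R),
      extPerp ψ g ∈ uniCongruence hh' y Set.univ (1 : R) := fun ψ g hg => by
    have : uniCongruence hh' y Set.univ (1 : R) ≤
        (uniCongruence hh' y Set.univ (1 : R)).comap (extPerp ψ) := by
      refine (Subgroup.closure_le _).2 ?_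
      rintro _ ⟨δ, κ, i, d, -, rfl⟩
      rw [SetLike.mem_coe, Subgroup.mem_comap, one_smul, hX, ← one_smul R (extRingMap R A ψ d)]
      exact heis_mem_uniCongruence hh' δ κ i trivial
    exact this hg
  have hθ' : θ ∈ uniCongruence hh' y Set.univ (1 : R) := by
    refine (eUnitary_le_iff hh' _).2 (fun δ q hq => ?_) hθ
    have h3 : IsUnit (2 : B'[X]) := by
      simpa only [map_ofNat] using h2.map (algebraMap R B'[X])
    have hs : IsUnit (algebraMap B'[X] (ExtRing R B'[X] A) (algebraMap R B'[X] s)) :=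
      hφX.unit.map _
    have hs' : algebraMap B'[X] (ExtRing R B'[X] A) (algebraMap R B'[X] s) =
        algebraMap R (ExtRing R B'[X] A) s := (IsScalarTower.algebraMap_apply _ _ _ _).symm
    have := heis_mem_uniCongruence_univ hh' h3 hs (hs'.symm ▸ hyf)
      (fun p => by rw [hs']; exact hx.ext_sum hh p) δ (heisIsometric_uniSign hh' δ hq)
    simpa [uniCongruence] using this
  -- The quotient `θ(s^n X) θ(0)⁻¹` lies in a given congruence subgroup for large `n`.
  have key : ∀ m : ℕ, ∃ n₀ : ℕ, ∀ n, n₀ ≤ n →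
      extPerp (dil B' (s ^ n)) θ * (extPerp (dil B' (0 : R)) θ)⁻¹ ∈
        uniCongruence hh' y C₀ (s ^ m) := by
    have hconj := fun {g} (hg : g ∈ uniCongruence hh' y Set.univ (1 : R)) (m : ℕ) =>
      exists_conj_uniCongruence_le (C₀ := C₀) hh' hι hyf
        (by
          rintro _ ⟨d, rfl⟩
          exact ⟨(j.ext B[X]).toLin d, (Involution.ext_extRingMap j Φ d).symm⟩)
        (fun c => hφX.extRing_surj c) hg m
    clear hθ
    induction hθ' using Subgroup.closure_induction with
    | one =>
      exact fun m => ⟨0, fun n _ => by rw [map_one, map_one, inv_one, mul_one]; exact one_mem _⟩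
    | mem g hg =>
      intro m
      obtain ⟨δ, κ, i, c, -, rfl⟩ := hg
      obtain ⟨n₀, hn₀⟩ := exists_dil_sub_dil_zero hφ c m
      refine ⟨n₀, fun n hn => ?_⟩
      obtain ⟨d, hd, hd'⟩ := hn₀ n hn
      rw [one_smul, hX, hX, ← heis_neg hh' δ (hyiso _ _ _), heis_mul_of_orth, ← neg_smul,
        ← add_smul, ← sub_eq_add_neg, hd', add_zero]
      · exact heis_mem_uniCongruence hh' δ κ i hd
      · rw [map_neg, hh'.smul_left, hh'.smul_right, hyf.isotropic, mul_zero, zero_mul, neg_zero]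
    | mul g g' hg _ ih ih' =>
      intro m
      obtain ⟨l, hl⟩ := hconj (hfun (dil B' (0 : R)) g hg) m
      obtain ⟨n₁, h₁⟩ := ih m
      obtain ⟨n₂, h₂⟩ := ih' l
      refine ⟨n₁ + n₂, fun n hn => ?_⟩
      have := mul_mem (h₁ n (by omega)) (hl _ (h₂ n (by omega)))
      simpa [mul_assoc] using this
    | inv g hg ih =>
      intro m
      obtain ⟨l, hl⟩ := hconj (inv_mem (hfun (dil B' (0 : R)) g hg)) m
      obtain ⟨n₁, h₁⟩ := ih l
      refine ⟨n₁, fun n hn => ?_⟩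
      have := hl _ (inv_mem (h₁ n hn))
      rw [mul_inv_rev, inv_inv, inv_mul_cancel_left] at this
      rw [map_inv, map_inv, inv_inv]
      exact this
  obtain ⟨N, hN⟩ := key 0
  refine ⟨N, ?_⟩
  have hlift : uniCongruence hh' y C₀ (s ^ 0) ≤
      (EUnitary ε (j.ext B[X]) (extForm B[X] h)).map (extPerp Φ) := by
    refine (Subgroup.closure_le _).2 ?_
    rintro _ ⟨δ, κ, i, _, ⟨d, rfl⟩, rfl⟩
    refine ⟨heis (hh.ext B[X]) δ (d • ExtMod.tmul R 1 (x κ i)) 0,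
      heis_mem_eUnitary (hh.ext B[X]) δ ?_, ?_⟩
    · rw [(hh.ext B[X]).smul_left, (hh.ext B[X]).smul_right, hx.ext_family.isotropic, mul_zero,
        zero_mul]
    · rw [extPerp_heis hh, extModMap_smul, extModMap_tmul, map_one, map_zero, pow_zero, one_smul]
      rfl
  obtain ⟨β, hβ, hβ'⟩ := hlift (hN N le_rfl)
  exact ⟨β, hβ, hβ'⟩

end UnitaryExt

/-! ### Left ideals in semisimple rings and units of algebras over local rings -/

section Semisimple

/-- In a semisimple ring, a principal left ideal `C a` which does not contain `b` can be enlarged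
by adding a multiple of `b` to the generator `a`. The reason: the left annihilator of `a` contains
a copy of every simple left ideal which meets `C a` trivially. -/
theorem exists_span_lt_span_add_mul {C : Type*} [Ring C] [IsSemisimpleRing C] {a b : C}
    (hb : b ∉ Ideal.span {a}) : ∃ c : C, Ideal.span {a} < Ideal.span {a + c * b} := by
  obtain ⟨K, hKb, hKa, hK⟩ : ∃ K : Ideal C, K ≤ Ideal.span {b} ∧ K ⊓ Ideal.span {a} = ⊥ ∧
      IsSimpleModule C K := by
    obtain ⟨V, hV⟩ := exists_isCompl (Ideal.span {b} ⊓ Ideal.span {a})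
    have hbot : Ideal.span {b} ⊓ V ≠ ⊥ := fun h => by
      apply hb
      have h1 : Ideal.span {b} = Ideal.span {b} ⊓ Ideal.span {a} := by
        have h2 := sup_inf_assoc_of_le V (inf_le_left : Ideal.span {b} ⊓ Ideal.span {a} ≤ _)
        rwa [hV.sup_eq_top, top_inf_eq, inf_comm V, h, sup_bot_eq] at h2
      exact (h1.le (Ideal.mem_span_singleton_self b)).2
    obtain ⟨K, hKle, hK⟩ := (IsSemisimpleModule.eq_bot_or_exists_simple_le _).resolve_left hbot
    refine ⟨K, hKle.trans inf_le_left, ?_, hK⟩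
    rw [eq_bot_iff, ← hV.inf_eq_bot]
    exact fun x hx => ⟨⟨(hKle hx.1).1, hx.2⟩, (hKle hx.1).2⟩
  set f : C →ₗ[C] C := LinearMap.toSpanSingleton C C a with hf
  have hfa : ∀ x, f x = x * a := fun x => rfl
  set Y := isotypicComponent C C K with hY
  have hfY : ∀ x ∈ Y, f x ∈ Y := fun x hx => LinearMap.le_comap_isotypicComponent K f hx
  -- If right multiplication by `a` were injective on the isotypic component `Y` of `K`, it would be
  -- surjective on `Y`, and `K` would lie in `C a`.
  have hne : LinearMap.ker f ⊓ Y ≠ ⊥ := fun h => by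
    have hinj : Function.Injective (f.restrict hfY) := by
      rw [← LinearMap.ker_eq_bot, LinearMap.ker_eq_bot']
      rintro ⟨x, hx⟩ hx0
      have : f x = 0 := congrArg Subtype.val hx0
      exact Subtype.ext ((h.le ⟨this, hx⟩ : x ∈ (⊥ : Ideal C)))
    have hsurj := IsArtinian.surjective_of_injective_endomorphism _ hinj
    have hKle : K ≤ Ideal.span {a} := fun k hk => by
      obtain ⟨⟨x, hx⟩, hxk⟩ := hsurj ⟨k, Submodule.le_isotypicComponent K hk⟩
      have h1 : f x = k := congrArg Subtype.val hxk
      exact h1 ▸ Ideal.mul_mem_left _ x (Ideal.mem_span_singleton_self a)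
    have := IsSimpleModule.nontrivial C K
    exact (Submodule.nontrivial_iff_ne_bot.1 this) (by rwa [inf_eq_left.2 hKle] at hKa)
  obtain ⟨K', hK'le, hK'⟩ := (IsSemisimpleModule.eq_bot_or_exists_simple_le _).resolve_left hne
  obtain ⟨e⟩ := isIsotypicOfType_submodule_iff.1 (IsIsotypicOfType.isotypicComponent C C K) K'
    (hK'le.trans inf_le_right)
  obtain ⟨W, hW⟩ := exists_isCompl K'
  set θ : C →ₗ[C] C := K.subtype ∘ₗ e.toLinearMap ∘ₗ K'.projectionOnto W hW with hθ
  have hθK : θ 1 ∈ K := Subtype.mem _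
  obtain ⟨c, hc⟩ := Ideal.mem_span_singleton'.1 (hKb hθK)
  have hx : ∀ x, x * (a + c * b) = f x + θ x := fun x => by
    rw [mul_add, hc, hfa, ← smul_eq_mul x (θ 1), ← map_smul, smul_eq_mul, mul_one]
  have hθW : ∀ w ∈ W, θ w = 0 := fun w hw => by
    have : K'.projectionOnto W hW w = 0 := (Submodule.projectionOnto_apply_eq_zero_iff hW).2 hw
    rw [hθ, LinearMap.comp_apply, LinearMap.comp_apply, this, map_zero, map_zero]
  have hmem : ∀ x, x * (a + c * b) ∈ Ideal.span {a + c * b} := fun x =>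
    Ideal.mul_mem_left _ x (Ideal.mem_span_singleton_self _)
  refine ⟨c, lt_of_le_of_ne ?_ fun heq => ?_⟩
  · rw [Ideal.span_singleton_le_iff_mem]
    obtain ⟨y, hy, w, hw, hyw⟩ := Submodule.mem_sup.1
      (hW.sup_eq_top.ge (Submodule.mem_top (x := (1 : C))))
    have h1 : f y = 0 := (hK'le hy).1
    have h2 := hmem w
    rw [hx, hθW w hw, add_zero, ← zero_add (f w), ← h1, ← map_add, hyw, hfa, one_mul] at h2
    exact h2
  · have hKle : K ≤ Ideal.span {a} := fun k hk => by
      obtain ⟨k', hk'⟩ := e.surjective ⟨k, hk⟩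
      have h1 : f (k' : C) = 0 := (hK'le k'.2).1
      have h2 : θ (k' : C) = k := by
        rw [hθ, LinearMap.comp_apply, LinearMap.comp_apply, Submodule.projectionOnto_apply_left,
          LinearEquiv.coe_coe, hk']
        rfl
      have h3 := hmem (k' : C)
      rwa [hx, h1, h2, zero_add, ← heq] at h3
    have := IsSimpleModule.nontrivial C K
    exact (Submodule.nontrivial_iff_ne_bot.1 this) (by rwa [inf_eq_left.2 hKle] at hKa)

end Semisimple

section LocalAlgebra

universe u v

/-- A finite algebra `C` over a local ring has a semisimple quotient which detects units. It is the
quotient of `k ⊗ C`, for `k` the residue field, by its Jacobson radical. -/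
theorem exists_semisimple_quotient (S : Type v) [CommRing S] [IsLocalRing S] (C : Type u)
    [Ring C] [Algebra S C] [Module.Finite S C] :
    ∃ (D : Type (max u v)) (_ : Ring D) (_ : IsSemisimpleRing D) (π : C →+* D),
      Function.Surjective π ∧ ∀ v, Ideal.span {π v} = ⊤ → IsUnit v := by
  let k := IsLocalRing.ResidueField S
  let D₁ := k ⊗[S] C
  have : IsArtinianRing D₁ := IsArtinianRing.of_finite k D₁
  let π₁ : C →+* D₁ := (Algebra.TensorProduct.includeRight : C →ₐ[S] k ⊗[S] C)
  have hπ₁ : Function.Surjective π₁ :=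
    TensorProduct.mk_surjective S C k Ideal.Quotient.mk_surjective
  refine ⟨D₁ ⧸ Ring.jacobson D₁, inferInstance, inferInstance,
    (Ideal.Quotient.mk _).comp π₁, Ideal.Quotient.mk_surjective.comp hπ₁, fun v hv => ?_⟩
  obtain ⟨x', hx'⟩ := Ideal.mem_span_singleton'.1 (hv.ge (Submodule.mem_top (x := 1)))
  obtain ⟨x, rfl⟩ := (Ideal.Quotient.mk_surjective.comp hπ₁) x'
  have h1 : π₁ (x * v) - 1 ∈ Ring.jacobson D₁ := by
    rw [← Ideal.Quotient.eq]
    simpa using hx'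
  have h2 : IsNilpotent (π₁ (x * v) - 1) := by
    obtain ⟨n, hn⟩ := IsSemiprimaryRing.isNilpotent (R := D₁)
    exact ⟨n, by have := Ideal.pow_mem_pow h1 n; rwa [hn] at this⟩
  have h3 : IsUnit (π₁ (x * v)) := by
    have := h2.isUnit_add_one
    rwa [sub_add_cancel] at this
  obtain ⟨w, hw⟩ := h3
  -- Right multiplication by `v` is onto modulo the maximal ideal, hence onto, hence bijective.
  have h4 : Function.Surjective (LinearMap.mulRight S v) := by
    rw [← LinearMap.range_eq_top, ← IsLocalRing.map_tensorProduct_mk_eq_top, eq_top_iff]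
    rintro z -
    obtain ⟨c, hc⟩ := hπ₁ (z * ↑w⁻¹ * π₁ x)
    refine ⟨c * v, ⟨c, rfl⟩, ?_⟩
    change π₁ (c * v) = z
    rw [map_mul, hc, mul_assoc, ← map_mul, ← hw, mul_assoc, Units.inv_mul, mul_one]
  have h5 : Function.Injective (LinearMap.mulRight S v) :=
    OrzechProperty.injective_of_surjective_endomorphism _ h4
  obtain ⟨y, hy⟩ := h4 1
  have hy' : y * v = 1 := hy
  refine ⟨⟨v, y, h5 ?_, hy'⟩, rfl⟩
  change v * y * v = 1 * v
  rw [mul_assoc, hy', mul_one, one_mul]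

end LocalAlgebra

/-! ### Cancellation of a hyperbolic plane -/

section PerpBilin

variable {S C M : Type*} [CommRing S] [Ring C] [Algebra S C]
  [AddCommGroup M] [Module S M]

/-- `perpForm` as a bilinear map. -/
def perpBilin (ε : ℤ) (j : Involution S C) (h : LinearMap.BilinMap S M C) :
    LinearMap.BilinMap S (M × C × C) C :=
  LinearMap.mk₂ S (perpForm ε j h)
    (fun x x' y => by
      simp only [perpForm, Prod.fst_add, Prod.snd_add, map_add, LinearMap.add_apply, mul_add,
        smul_add]; abel)
    (fun c x y => by
      simp only [perpForm, Prod.smul_fst, Prod.smul_snd, map_smul, LinearMap.smul_apply,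
        mul_smul_comm, smul_add, smul_comm ε])
    (fun x y y' => by
      simp only [perpForm, Prod.fst_add, Prod.snd_add, map_add, add_mul, smul_add]; abel)
    (fun c x y => by
      simp only [perpForm, Prod.smul_fst, Prod.smul_snd, map_smul, smul_mul_assoc, smul_add,
        smul_comm ε])

theorem perpBilin_apply (ε : ℤ) (j : Involution S C) (h : LinearMap.BilinMap S M C)
    (x y : M × C × C) : perpBilin ε j h x y = perpForm ε j h x y := rfl

end PerpBilin

section Cancellation

variable {S C M : Type*} [CommRing S] [Ring C] [Algebra S C]
  [AddCommGroup M] [Module S M] [Module C M] {ε : ℤ} {j : Involution S C}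
  {h : LinearMap.BilinMap S M C}

theorem IsEpsForm.perp (hh : IsEpsForm ε j h) : IsEpsForm ε j (perpBilin ε j h) where
  eps := hh.eps
  smul_right a x y := by
    simp only [perpBilin_apply, perpForm, Prod.smul_fst, Prod.smul_snd, hh.smul_right, smul_eq_mul,
      mul_add, mul_assoc, mul_smul_comm]
  smul_left a x y := by
    simp only [perpBilin_apply, perpForm, Prod.smul_fst, Prod.smul_snd, hh.smul_left, smul_eq_mul,
      add_mul, mul_assoc, smul_mul_assoc, j.map_mul]
  symm x y := by
    simp only [perpBilin_apply, perpForm, map_add, map_zsmul, j.map_mul, j.map_map, smul_add,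
      hh.eps_smul_smul, hh.symm x.1 y.1]
    rw [add_comm (ε • (x.2.1 * _))]

/-- The vectors `x false i`, `x true i` form a hyperbolic basis. -/
structure IsHypBasis (ε : ℤ) (h : LinearMap.BilinMap S M C) {ι : Type*} [Fintype ι]
    [DecidableEq ι] (x : Bool → ι → M) : Prop where
  family : IsHypFamily h x 1
  sum : ∀ p, p = ∑ i, (h (x false i) p • x true i + ε • h (x true i) p • x false i)

variable (hh : IsEpsForm ε j h) {ι : Type*} [Fintype ι] [DecidableEq ι] {x : Bool → ι → M}

theorem eichler_surjective {a b : M} (ha : h a a = 0) (hb : h b b = 0) (hab : h a b = 0) :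
    Function.Surjective (eichler hh a b) := fun p => by
  have hba := hh.symm_eq_zero hab
  have e1 : eichler hh a b a = a := by
    rw [eichler_apply, ha, hba, zero_smul, zero_smul, smul_zero, add_zero, sub_zero]
  have e2 : eichler hh a b b = b := by
    rw [eichler_apply, hb, hab, zero_smul, zero_smul, smul_zero, add_zero, sub_zero]
  refine ⟨p - h a p • b + ε • h b p • a, ?_⟩
  rw [map_add, map_sub, map_zsmul, map_smul, map_smul, e1, e2, eichler_apply]
  abel

theorem IsHypBasis.eichler (hx : IsHypBasis ε h x) {a b : M} (ha : h a a = 0) (hb : h b b = 0)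
    (hab : h a b = 0) : IsHypBasis ε h (fun κ i => Transvection.eichler hh a b (x κ i)) where
  family :=
    { isotropic := fun κ i k => by rw [eichler_isometry hh ha hb hab, hx.family.isotropic]
      pair := fun i k => by rw [eichler_isometry hh ha hb hab, hx.family.pair] }
  sum p := by
    obtain ⟨q, rfl⟩ := eichler_surjective hh ha hb hab p
    conv_lhs => rw [hx.sum q]
    simp only [eichler_isometry hh ha hb hab, map_sum, map_add, map_smul, map_zsmul]

omit [Fintype ι] in
include hh in
theorem IsHypFamily.pair_symm (hx : IsHypFamily h x 1) (i : ι) :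
    h (x true i) (x false i) = ε • (1 : C) := by
  rw [hh.symm, hx.pair, if_pos rfl, Involution.map_one]

include hh in
/-- If `⟨u, v⟩ = 1` for some `v`, then some hyperbolic basis has a first vector `e` such that
`⟨u, e⟩` is a unit. Among all hyperbolic bases, one for which the left ideal generated by the image
of `⟨u, e⟩` in the semisimple quotient is maximal will do: otherwise Eichler transformations would
enlarge it. -/
theorem exists_isHypBasis_isUnit {D : Type*} [Ring D] [IsSemisimpleRing D] {π : C →+* D}
    (hπ : Function.Surjective π) (hunit : ∀ v, Ideal.span {π v} = ⊤ → IsUnit v)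
    (hx : IsHypBasis ε h x) {i₀ i₁ : ι} (hi : i₁ ≠ i₀) {u v : M} (huv : h u v = 1) :
    ∃ y : Bool → ι → M, IsHypBasis ε h y ∧ IsUnit (h u (y false i₀)) := by
  obtain ⟨_, ⟨y, hy, rfl⟩, hmax⟩ := WellFounded.has_min (wellFounded_gt (α := Ideal D))
    {K | ∃ y : Bool → ι → M, IsHypBasis ε h y ∧ K = Ideal.span {π (h u (y false i₀))}}
    ⟨_, x, hx, rfl⟩
  set K := Ideal.span {π (h u (y false i₀))} with hK
  have hmax' : ∀ z : Bool → ι → M, IsHypBasis ε h z →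
      ¬ K < Ideal.span {π (h u (z false i₀))} := fun z hz => hmax _ ⟨z, hz, rfl⟩
  refine ⟨y, hy, hunit _ ?_⟩
  have horth : ∀ {z : Bool → ι → M}, IsHypBasis ε h z → ∀ {i k : ι}, i ≠ k → ∀ κ κ' (c : C),
      h (z κ i) (z κ i) = 0 ∧ h (c • z κ' k) (c • z κ' k) = 0 ∧ h (z κ i) (c • z κ' k) = 0 :=
    fun {z} hz {i k} hik κ κ' c => by
      rw [hh.smul_left, hh.smul_right, hh.smul_right, hz.family.isotropic, hz.family.isotropic,
        hz.family.orth hh hik, mul_zero, zero_mul]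
      exact ⟨rfl, rfl, rfl⟩
  -- By maximality, all coefficients away from the first plane lie in `K`.
  have step : ∀ z : Bool → ι → M, IsHypBasis ε h z → π (h u (z false i₀)) = π (h u (y false i₀)) →
      ∀ κ i, i ≠ i₀ → π (h u (z κ i)) ∈ K := fun z hz hzy κ i hii => by
    by_contra hb
    obtain ⟨c', hc⟩ := exists_span_lt_span_add_mul hb
    obtain ⟨c, rfl⟩ := hπ c'
    obtain ⟨h1, h2, h3⟩ := horth hz hii.symm true κ (ε • c)
    refine hmax' _ (hz.eichler hh h1 h2 h3) ?_
    simp only [eichler_apply, map_add, hz.family.pair_symm hh, hh.smul_right, hh.smul_left,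
      hz.family.orth hh hii, zero_mul, zero_smul, smul_zero, sub_zero, smul_mul_assoc, one_mul]
    rw [hh.eps_smul_smul, map_mul, hzy]
    exact hc
  obtain ⟨c', hc'⟩ := Ideal.mem_span_singleton'.1 (step y hy rfl false i₁ hi)
  obtain ⟨c, rfl⟩ := hπ c'
  -- Clear the coefficient of `y false i₁`, then add that vector to `y false i₀`.
  obtain ⟨h1, h2, h3⟩ := horth hy hi true false (-(ε • c))
  have hz := hy.eichler hh h1 h2 h3
  set z : Bool → ι → M := fun κ i =>
    Transvection.eichler hh (y true i₁) (-(ε • c) • y false i₀) (y κ i) with hzdef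
  have z1 : z false i₀ = y false i₀ := by
    simp only [hzdef, eichler_apply, hy.family.orth hh hi, hh.smul_left, hy.family.isotropic,
      zero_smul, zero_mul, smul_zero, add_zero, sub_zero]
  have z2 : π (h u (z false i₁)) = 0 := by
    simp only [hzdef, eichler_apply, hy.family.pair_symm hh, hh.smul_left, hy.family.isotropic,
      zero_smul, zero_mul, smul_zero, sub_zero, map_add, hh.smul_right]
    rw [← hc']
    simp only [smul_mul_assoc, neg_mul, one_mul, smul_neg, hh.eps_smul_smul, map_neg, map_mul]
    rw [add_neg_cancel]
  have z3 : ∃ d : C, z true i₀ = y true i₀ + d • y true i₁ := by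
    refine ⟨-(ε • j.toLin (-(ε • c))), ?_⟩
    simp only [hzdef]
    rw [eichler_apply, hy.family.isotropic, hh.smul_left, hy.family.pair, if_pos rfl, zero_smul,
      add_zero, one_mul, neg_smul, smul_assoc, sub_eq_add_neg]
  have z4 : z true i₁ = y true i₁ := by
    simp only [hzdef, eichler_apply, hy.family.isotropic, hh.smul_left, hy.family.orth hh hi.symm,
      zero_smul, zero_mul, smul_zero, add_zero, sub_zero]
  obtain ⟨h1', h2', h3'⟩ := horth hz hi.symm true false (ε • (1 : C))
  have hw := hz.eichler hh h1' h2' h3'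
  have w1 : Transvection.eichler hh (z true i₀) ((ε • (1 : C)) • z false i₁) (z false i₀) =
      z false i₀ + z false i₁ := by
    rw [eichler_apply, hh.smul_left, hz.family.isotropic, hz.family.pair_symm hh, zero_mul,
      zero_smul, smul_zero, sub_zero, smul_smul, smul_mul_assoc, one_mul, smul_smul, hh.eps,
      one_smul, one_smul]
  have w2 : Transvection.eichler hh (z true i₀) ((ε • (1 : C)) • z false i₁) (z true i₁) =
      z true i₁ - z true i₀ := by
    rw [eichler_apply, hh.smul_left, hz.family.isotropic, hz.family.pair, if_pos rfl, zero_smul,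
      add_zero, one_mul, map_zsmul, Involution.map_one, smul_assoc, one_smul, smul_smul, hh.eps,
      one_smul]
  have w3 := step _ hw (by
    rw [w1, map_add, map_add, z1, z2, add_zero]) true i₁ hi
  rw [w2, map_sub, map_sub, z4] at w3
  have hKall : ∀ κ i, π (h u (y κ i)) ∈ K := fun κ i => by
    by_cases hii : i = i₀
    · subst hii
      cases κ
      · exact Ideal.mem_span_singleton_self _
      · obtain ⟨d, hd⟩ := z3
        have e1 := step y hy rfl true i₁ hi
        have e2 := K.sub_mem e1 w3
        rw [sub_sub_cancel, hd, map_add, map_add, hh.smul_right, map_mul] at e2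
        have e3 := K.sub_mem e2 (K.mul_mem_left (π d) e1)
        rwa [add_sub_cancel_right] at e3
    · exact step y hy rfl κ i hii
  rw [Ideal.eq_top_iff_one, ← map_one π, ← huv, hy.sum v]
  simp only [map_sum, map_add, map_zsmul, hh.smul_right, map_mul]
  exact sum_mem fun i _ => add_mem (K.mul_mem_left _ (hKall _ _))
    (zsmul_mem (K.mul_mem_left _ (hKall _ _)) _)

include hh in
/-- Cancellation of a hyperbolic plane: a hyperbolic basis of `M ⊥ C²` yields a
hyperbolic basis of `M` if `C` has a semisimple quotient which detects units. -/
theorem exists_isHypBasis_of_perp {D : Type*} [Ring D] [IsSemisimpleRing D] {π : C →+* D}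
    (hπ : Function.Surjective π) (hunit : ∀ v, Ideal.span {π v} = ⊤ → IsUnit v)
    {x : Bool → ι → M × C × C} (hx : IsHypBasis ε (perpBilin ε j h) x) {i₀ i₁ : ι} (hi : i₁ ≠ i₀) :
    ∃ y : Bool → {i // i ≠ i₀} → M, IsHypBasis ε h y := by
  have hp := hh.perp
  have hu : ∀ y : M × C × C, perpBilin ε j h (0, 1, 0) y = y.2.2 := fun y => by
    simp only [perpBilin_apply, perpForm, map_zero, LinearMap.zero_apply, Involution.map_one,
      mul_one, mul_zero, smul_zero, add_zero, zero_add]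
  obtain ⟨z, hz, hzu⟩ := exists_isHypBasis_isUnit hp hπ hunit hx hi (u := (0, 1, 0))
    (v := (0, 0, 1)) (hu _)
  rw [hu] at hzu
  obtain ⟨a, ha⟩ := hzu
  set e := z false i₀ with he
  -- Subtract multiples of `e` so that the last coordinate vanishes.
  let w : Bool → {i // i ≠ i₀} → M × C × C := fun κ i =>
    z κ i - ((z κ i).2.2 * (↑a⁻¹ : C)) • e
  have hw0 : ∀ κ i, (w κ i).2.2 = 0 := fun κ i => by
    simp only [w, Prod.snd_sub, Prod.smul_snd, smul_eq_mul, ← ha, mul_assoc, Units.inv_mul, mul_one,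
      sub_self]
  have hform : ∀ {y y' : M × C × C}, y.2.2 = 0 → y'.2.2 = 0 → perpBilin ε j h y y' = h y.1 y'.1 :=
    fun {y y'} h0 h0' => by
      simp only [perpBilin_apply, perpForm, h0, h0', map_zero, zero_mul, mul_zero, smul_zero,
        add_zero]
  have hee : perpBilin ε j h e e = 0 := hz.family.isotropic _ _ _
  have hez : ∀ κ (i : {i // i ≠ i₀}), perpBilin ε j h e (z κ i) = 0 := fun κ i =>
    hz.family.orth hp i.2.symm _ _
  have hze : ∀ κ (i : {i // i ≠ i₀}), perpBilin ε j h (z κ i) e = 0 := fun κ i =>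
    hz.family.orth hp i.2 _ _
  have hww : ∀ κ κ' i k, h (w κ i).1 (w κ' k).1 = perpBilin ε j h (z κ i) (z κ' k) :=
    fun κ κ' i k => by
      rw [← hform (hw0 _ _) (hw0 _ _)]
      simp only [w, map_sub, LinearMap.sub_apply, hp.smul_left, hp.smul_right, hee, hez, hze,
        mul_zero, zero_mul, sub_zero]
  have hfam : IsHypFamily h (fun κ i => (w κ i).1) 1 :=
    { isotropic := fun κ i k => by rw [hww, hz.family.isotropic]
      pair := fun i k => by rw [hww, hz.family.pair]; simp only [Subtype.ext_iff] }
  refine ⟨fun κ i => (w κ i).1, hfam, fun p => ?_⟩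
  -- A vector orthogonal to the new family vanishes.
  have hnd : ∀ p : M, (∀ κ i, h (w κ i).1 p = 0) → p = 0 := fun p hp0 => by
    have hja : j.toLin (↑a⁻¹ : C) * j.toLin (e.2.2) = 1 := by
      rw [← j.map_mul, ← ha, Units.mul_inv, Involution.map_one]
    set q : M × C × C := (p, -(ε • (h e.1 p * j.toLin (↑a⁻¹ : C))), 0) with hq
    have hqe : perpBilin ε j h e q = 0 := by
      simp only [perpBilin_apply, perpForm, hq, zero_mul, zero_add, neg_mul, smul_mul_assoc,
        mul_assoc, hja, mul_one, smul_neg, hh.eps_smul_smul, add_neg_cancel]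
    have hqz : ∀ κ i, i ≠ i₀ → perpBilin ε j h (z κ i) q = 0 := fun κ i hii => by
      have h1 : perpBilin ε j h (w κ ⟨i, hii⟩) q = 0 := by
        rw [hform (hw0 _ _) rfl]; exact hp0 _ _
      simpa only [w, map_sub, LinearMap.sub_apply, hp.smul_left, hqe, zero_mul, sub_zero] using h1
    have hqs := hz.sum q
    rw [Finset.sum_eq_single i₀ (fun i _ hii => by
      rw [hqz _ _ hii, hqz _ _ hii, zero_smul, zero_smul, smul_zero, add_zero])
      (fun h => absurd (Finset.mem_univ _) h), ← he, hqe, zero_smul, zero_add] at hqs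
    have h2 : ε • perpBilin ε j h (z true i₀) q = 0 := by
      have h3 := congrArg (fun v : M × C × C => v.2.2 * (↑a⁻¹ : C)) hqs
      simp only [hq, Prod.smul_snd, smul_eq_mul, ← ha, zero_mul, smul_mul_assoc, mul_assoc,
        Units.mul_inv, mul_one] at h3
      exact h3.symm
    rw [← smul_assoc, h2, zero_smul] at hqs
    exact congrArg Prod.fst hqs
  rw [← sub_eq_zero]
  refine hnd _ fun κ i => ?_
  simp only [map_sub, map_sum, map_add, map_zsmul, hh.smul_right]
  rw [Finset.sum_eq_single i (fun k _ hk => by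
    rw [hfam.orth hh hk.symm, hfam.orth hh hk.symm, mul_zero, mul_zero, smul_zero, add_zero])
    (fun h => absurd (Finset.mem_univ _) h)]
  cases κ
  · rw [hfam.pair, if_pos rfl, hfam.isotropic, mul_one, mul_zero, smul_zero, add_zero, sub_self]
  · rw [hfam.pair_symm hh, hfam.isotropic, mul_zero, mul_smul_comm, mul_one, hh.eps_smul_smul,
      zero_add, sub_self]

end Cancellation

/-! ### From a localization at a prime to a localization at an element -/

section AtPrime

variable {R : Type*} [CommRing R] (m : Ideal R) [m.IsPrime]
  {Q : Type*} [AddCommGroup Q] [Module R Q] {κ : Type*} [Finite κ]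

theorem isLocalizedModule_tmul_one :
    IsLocalizedModule m.primeCompl (TensorProduct.mk R (Localization.AtPrime m) Q 1) :=
  (isLocalizedModule_iff_isBaseChange m.primeCompl (Localization.AtPrime m) _).2
    (TensorProduct.isBaseChange R Q (Localization.AtPrime m))

/-- A finite family in `Q_m` has a common denominator outside `m`. -/
theorem exists_smul_eq_tmul_one (y : κ → Localization.AtPrime m ⊗[R] Q) :
    ∃ s ∉ m, ∃ q : κ → Q, ∀ i, s • y i = 1 ⊗ₜ[R] q i := by
  classical
  cases nonempty_fintype κ
  have := isLocalizedModule_tmul_one m (Q := Q)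
  have h1 : ∀ i, ∃ s ∈ m.primeCompl, ∃ q, s • y i = 1 ⊗ₜ[R] q := fun i => by
    obtain ⟨⟨q, s⟩, hs⟩ := IsLocalizedModule.surj m.primeCompl
      (TensorProduct.mk R (Localization.AtPrime m) Q 1) (y i)
    exact ⟨s, s.2, q, hs⟩
  choose s hs q hq using h1
  refine ⟨∏ i, s i, prod_mem fun i _ => hs i, fun i => (∏ k ∈ Finset.univ.erase i, s k) • q i,
    fun i => ?_⟩
  rw [← Finset.prod_erase_mul _ s (Finset.mem_univ i), mul_smul, hq, TensorProduct.tmul_smul]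

/-- Finitely many equalities in `Q_m` hold in `Q` after multiplication by a scalar outside `m`. -/
theorem exists_smul_eq_of_tmul_one_eq {q q' : κ → Q}
    (h : ∀ i, (1 : Localization.AtPrime m) ⊗ₜ[R] q i = 1 ⊗ₜ[R] q' i) :
    ∃ s ∉ m, ∀ i, s • q i = s • q' i := by
  classical
  cases nonempty_fintype κ
  have := isLocalizedModule_tmul_one m (Q := Q)
  have h1 : ∀ i, ∃ s ∈ m.primeCompl, s • q i = s • q' i := fun i => by
    obtain ⟨s, hs⟩ := IsLocalizedModule.exists_of_eq (S := m.primeCompl)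
      (f := TensorProduct.mk R (Localization.AtPrime m) Q 1) (h i)
    exact ⟨s, s.2, hs⟩
  choose s hs hq using h1
  refine ⟨∏ i, s i, prod_mem fun i _ => hs i, fun i => ?_⟩
  rw [← Finset.prod_erase_mul _ s (Finset.mem_univ i), mul_smul, hq, mul_smul]

theorem mul_notMem {s t : R} (hs : s ∉ m) (ht : t ∉ m) : s * t ∉ m :=
  m.primeCompl.mul_mem hs ht

end AtPrime

section SpreadOut

variable {R : Type*} [CommRing R] {A : Type*} [Ring A] [Algebra R A]
  {P : Type*} [AddCommGroup P] [Module R P] [Module A P] [IsScalarTower R A P]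
  {B : Type*} [CommRing B] [Algebra R B]

theorem algebraMap_smul_extMod (s : R) (y : ExtMod R B P) :
    algebraMap R (ExtRing R B A) s • y = (s • (show B ⊗[R] P from y) : B ⊗[R] P) := by
  induction y using ExtMod.induction with
  | zero => rw [smul_zero]; exact (smul_zero (A := B ⊗[R] P) s).symm
  | add x y hx hy => rw [smul_add, hx, hy]; exact (smul_add (A := B ⊗[R] P) s x y).symm
  | tmul b p =>
    rw [algebraMap_extRing, ext_smul_tmul, one_mul, algebraMap_smul]
    exact TensorProduct.tmul_smul s b p

theorem algebraMap_smul_tmul_one (s : R) (p : P) :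
    algebraMap R (ExtRing R B A) s • ExtMod.tmul R (1 : B) p = ExtMod.tmul R 1 (s • p) := by
  rw [algebraMap_extRing, smul_tmul_one, algebraMap_smul]

theorem tmul_one_sum {κ : Type*} (t : Finset κ) (g : κ → P) :
    ExtMod.tmul R (1 : B) (∑ i ∈ t, g i) = ∑ i ∈ t, ExtMod.tmul R (1 : B) (g i) :=
  map_sum (tmulOne R B P) _ _

theorem tmul_one_add (p q : P) :
    ExtMod.tmul R (1 : B) (p + q) = ExtMod.tmul R (1 : B) p + ExtMod.tmul R (1 : B) q :=
  map_add (tmulOne R B P) _ _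

theorem tmul_one_zsmul (n : ℤ) (p : P) :
    ExtMod.tmul R (1 : B) (n • p) = n • ExtMod.tmul R (1 : B) p :=
  map_zsmul (tmulOne R B P) _ _

variable {ι : Type*} [Fintype ι] [DecidableEq ι]

theorem IsDualBasisAway.smul {s : R} {x : ι → P} {f : ι → P →ₗ[A] A} (h : IsDualBasisAway s x f)
    (t : R) : IsDualBasisAway (t * s) (fun i => t • x i) f where
  apply i k := by
    rw [← algebraMap_smul A t (x k), map_smul, h.apply, smul_eq_mul, mul_ite, mul_zero, map_mul]
  sum p := by
    rw [mul_smul, h.sum, Finset.smul_sum]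
    exact Finset.sum_congr rfl fun i _ => smul_comm t _ _

/-- If `P` has rank `n`, then around every maximal ideal there is a dual basis of `n` elements up to
a scalar. -/
theorem HasRank.exists_isDualBasisAway [Module.Finite A P] [Module.Projective A P] {n : ℕ}
    (hrank : HasRank R A P n) (m : Ideal R) [m.IsMaximal] :
    ∃ s ∉ m, ∃ (x : Fin n → P) (f : Fin n → P →ₗ[A] A), IsDualBasisAway s x f := by
  obtain ⟨e⟩ := hrank m
  obtain ⟨N, F, g, -, -, hFg⟩ := Module.Finite.exists_comp_eq_id_of_projective A P
  set G : Fin N → P := fun k => F (Pi.single k 1) with hG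
  have hFgp : ∀ p, p = ∑ k, g p k • G k := fun p => by
    conv_lhs => rw [← LinearMap.id_apply (R := A) p, ← hFg, LinearMap.comp_apply,
      pi_eq_sum_univ' (g p)]
    rw [map_sum]
    refine Finset.sum_congr rfl fun k _ => ?_
    rw [map_smul, hG]
  obtain ⟨s₁, hs₁, x, hx⟩ := exists_smul_eq_tmul_one (Q := P) m fun i => e.symm (Pi.single i 1)
  have hx' : ∀ i, algebraMap R (ExtRing R (Localization.AtPrime m) A) s₁ • e.symm (Pi.single i 1) =
      ExtMod.tmul R 1 (x i) := fun i => (algebraMap_smul_extMod _ _).trans (hx i)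
  obtain ⟨s₂, hs₂, a, ha⟩ := exists_smul_eq_tmul_one (Q := A) m
    fun ik : Fin n × Fin N => e (ExtMod.tmul R 1 (G ik.2)) ik.1
  let f : Fin n → P →ₗ[A] A := fun i => ∑ k, dualMul (LinearMap.proj k ∘ₗ g) (a (i, k))
  have hf : ∀ i p, s₂ • e (ExtMod.tmul R 1 p) i = 1 ⊗ₜ[R] f i p := fun i p => by
    have h1 : f i p = ∑ k, g p k * a (i, k) := by
      simp only [f, LinearMap.sum_apply, dualMul_apply, LinearMap.comp_apply, LinearMap.proj_apply]
    rw [h1, TensorProduct.tmul_sum]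
    conv_lhs => rw [hFgp p]
    rw [tmul_one_sum, map_sum, Finset.sum_apply, Finset.smul_sum]
    refine Finset.sum_congr rfl fun k _ => ?_
    rw [← smul_tmul_one, map_smul, Pi.smul_apply, smul_eq_mul, ← mul_smul_comm, ha (i, k),
      Algebra.TensorProduct.tmul_mul_tmul, mul_one]
  obtain ⟨t₁, ht₁, h₁⟩ := exists_smul_eq_of_tmul_one_eq m (κ := Fin n × Fin n)
    (q := fun ik => f ik.1 (x ik.2))
    (q' := fun ik => if ik.1 = ik.2 then algebraMap R A (s₁ * s₂) else 0) fun ik => by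
      rw [← hf, ← hx', map_smul, e.apply_symm_apply, Pi.smul_apply, Pi.single_apply, smul_eq_mul]
      split_ifs
      · rw [mul_one, ← algebraMap_extRing, mul_comm s₁, map_mul, Algebra.smul_def]
      · rw [mul_zero, smul_zero, TensorProduct.tmul_zero]
  obtain ⟨t₂, ht₂, h₂⟩ := exists_smul_eq_of_tmul_one_eq m (κ := Fin N)
    (q := fun k => (s₁ * s₂) • G k) (q' := fun k => ∑ i, f i (G k) • x i) fun k => by
      change ExtMod.tmul R 1 ((s₁ * s₂) • G k) = ExtMod.tmul R 1 (∑ i, f i (G k) • x i)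
      rw [tmul_one_sum, ← algebraMap_smul_tmul_one (A := A)]
      have h3 : ExtMod.tmul R 1 (G k) =
          ∑ i, e (ExtMod.tmul R 1 (G k)) i • e.symm (Pi.single i 1) := by
        apply e.injective
        rw [map_sum]
        ext i
        simp [Finset.sum_apply, Pi.single_apply]
      conv_lhs => rw [h3]
      rw [Finset.smul_sum]
      refine Finset.sum_congr rfl fun i _ => ?_
      rw [← smul_tmul_one, ← hf, ← hx', smul_smul, smul_smul, map_mul, Algebra.smul_def]
      congr 1
      rw [← Algebra.commutes s₁, ← mul_assoc]
  refine ⟨t₁ * t₂ * (s₁ * s₂), mul_notMem m (mul_notMem m ht₁ ht₂) (mul_notMem m hs₁ hs₂),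
    fun i => (t₁ * t₂) • x i, f, fun i k => ?_, fun p => ?_⟩
  · rw [← algebraMap_smul A (t₁ * t₂) (x k), map_smul, algebraMap_smul, mul_comm t₁, mul_smul,
      h₁ (i, k)]
    split_ifs
    · rw [Algebra.smul_def, Algebra.smul_def, ← map_mul, ← map_mul, mul_assoc]
    · rw [smul_zero, smul_zero]
  · have h4 : ∀ k, (t₁ * t₂ * (s₁ * s₂)) • G k = ∑ i, f i (G k) • (t₁ * t₂) • x i := fun k => by
      rw [mul_smul, mul_smul, h₂ k, Finset.smul_sum, Finset.smul_sum]
      refine Finset.sum_congr rfl fun i _ => ?_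
      rw [mul_smul, smul_comm t₂, smul_comm t₁]
    conv_lhs => rw [hFgp p]
    conv_rhs => rw [hFgp p]
    simp only [map_sum, map_smul, Finset.sum_smul, Finset.smul_sum, smul_eq_mul, mul_smul _ (f _ _)]
    rw [Finset.sum_comm]
    refine Finset.sum_congr rfl fun k _ => ?_
    rw [← Finset.smul_sum, ← h4, smul_comm]

variable {ε : ℤ} {j : Involution R A} {h : LinearMap.BilinMap R P A}

theorem IsHypBasisAway.smul {s : R} {x : Bool → ι → P} (hx : IsHypBasisAway ε h s x) (t : R) :
    IsHypBasisAway ε h (t * t * s) (fun κ i => t • x κ i) where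
  family :=
    { isotropic := fun κ i k => by
        rw [map_smul, LinearMap.map_smul₂, hx.family.isotropic, smul_zero, smul_zero]
      pair := fun i k => by
        rw [map_smul, LinearMap.map_smul₂, hx.family.pair]
        split_ifs
        · rw [Algebra.smul_def, Algebra.smul_def, ← map_mul, ← map_mul, mul_assoc]
        · rw [smul_zero, smul_zero] }
  sum p := by
    rw [mul_smul, mul_smul, hx.sum, Finset.smul_sum, Finset.smul_sum]
    refine Finset.sum_congr rfl fun i _ => ?_
    simp only [LinearMap.map_smul₂, smul_add, smul_assoc, smul_comm _ t]

/-- A hyperbolic basis of `P_m` comes from data over `R`, up to a scalar outside `m`. -/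
theorem exists_isHypBasisAway_of_atPrime (hh : IsEpsForm ε j h) [Module.Finite A P] (m : Ideal R)
    [m.IsPrime] {X : Bool → ι → ExtMod R (Localization.AtPrime m) P}
    (hX : IsHypBasis ε (extForm (Localization.AtPrime m) h) X) :
    ∃ s ∉ m, ∃ x : Bool → ι → P, IsHypBasisAway ε h s x := by
  have hh' := hh.ext (Localization.AtPrime m)
  obtain ⟨N, G, hG⟩ := Module.Finite.exists_fin (R := A) (M := P)
  obtain ⟨s, hs, x', hx'⟩ := exists_smul_eq_tmul_one (Q := P) m fun ki : Bool × ι => X ki.1 ki.2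
  set x : Bool → ι → P := fun κ i => x' (κ, i) with hxdef
  set σ := algebraMap R (ExtRing R (Localization.AtPrime m) A) s with hσ
  have hx : ∀ κ i, ExtMod.tmul R 1 (x κ i) = σ • X κ i :=
    fun κ i => ((algebraMap_smul_extMod _ _).trans (hx' (κ, i))).symm
  have hjσ : (j.ext (Localization.AtPrime m)).toLin σ = σ := by
    rw [hσ, algebraMap_extRing, Involution.ext_tmul, Algebra.algebraMap_eq_smul_one, map_smul,
      Involution.map_one]
  have hgram : ∀ κ κ' i k, (1 : Localization.AtPrime m) ⊗ₜ[R] h (x κ i) (x κ' k) =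
      σ * (extForm (Localization.AtPrime m) h (X κ i) (X κ' k) * σ) := fun κ κ' i k => by
    rw [← one_mul (1 : Localization.AtPrime m), ← extForm_tmul, hx, hx, hh'.smul_right,
      hh'.smul_left, hjσ]
  obtain ⟨t₁, ht₁, h₁⟩ := exists_smul_eq_of_tmul_one_eq m (κ := Bool × ι × ι)
    (q := fun z => h (x z.1 z.2.1) (x z.1 z.2.2)) (q' := fun _ => 0) fun z => by
      rw [hgram, hX.family.isotropic, zero_mul, mul_zero, TensorProduct.tmul_zero]
  obtain ⟨t₂, ht₂, h₂⟩ := exists_smul_eq_of_tmul_one_eq m (κ := ι × ι)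
    (q := fun z => h (x false z.1) (x true z.2))
    (q' := fun z => if z.1 = z.2 then algebraMap R A (s * s) else 0) fun z => by
      rw [hgram, hX.family.pair]
      split_ifs
      · rw [one_mul, ← algebraMap_extRing, map_mul]
      · rw [zero_mul, mul_zero, TensorProduct.tmul_zero]
  obtain ⟨t₃, ht₃, h₃⟩ := exists_smul_eq_of_tmul_one_eq m (κ := Fin N)
    (q := fun k => (s * s) • G k)
    (q' := fun k => ∑ i, (h (x false i) (G k) • x true i + ε • h (x true i) (G k) • x false i))
    fun k => by
      change ExtMod.tmul R 1 ((s * s) • G k) = ExtMod.tmul R 1 (∑ i, _)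
      rw [tmul_one_sum, ← algebraMap_smul_tmul_one (A := A), map_mul, ← hσ]
      conv_lhs => rw [hX.sum (ExtMod.tmul R 1 (G k))]
      rw [Finset.smul_sum]
      refine Finset.sum_congr rfl fun i _ => ?_
      have h4 : ∀ κ, (1 : Localization.AtPrime m) ⊗ₜ[R] h (x κ i) (G k) =
          extForm (Localization.AtPrime m) h (X κ i) (ExtMod.tmul R 1 (G k)) * σ := fun κ => by
        have h5 := extForm_tmul h (1 : Localization.AtPrime m) 1 (x κ i) (G k)
        rw [one_mul] at h5
        rw [← h5, hx, hh'.smul_left, hjσ]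
      rw [tmul_one_add, tmul_one_zsmul, ← smul_tmul_one, ← smul_tmul_one, h4, h4, hx, hx, smul_add,
        smul_comm (σ * σ) ε]
      simp only [smul_smul]
      rw [hσ]
      simp only [mul_assoc, Algebra.commutes s]
  obtain ⟨t, ht⟩ : ∃ t, t = t₁ * t₂ * t₃ := ⟨_, rfl⟩
  have hst : ∀ κ i (p : P), h (t • x κ i) p = t • h (x κ i) p := fun κ i p => by
    rw [LinearMap.map_smul₂]
  refine ⟨t * t * (s * s), ?_, fun κ i => t • x κ i, ⟨fun κ i k => ?_, fun i k => ?_⟩, fun p => ?_⟩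
  · have := ht ▸ mul_notMem m (mul_notMem m ht₁ ht₂) ht₃
    exact mul_notMem m (mul_notMem m this this) (mul_notMem m hs hs)
  · have h5 : t • h (x κ i) (x κ k) = 0 := by
      rw [ht, mul_assoc, mul_comm, mul_smul, h₁ (κ, i, k), smul_zero, smul_zero]
    rw [hst, map_smul, h5, smul_zero]
  · have h5 : t • h (x false i) (x true k) =
        t • if i = k then algebraMap R A (s * s) else 0 := by
      rw [ht, mul_right_comm, mul_smul, h₂ (i, k), ← mul_smul]
    rw [hst, map_smul, h5]
    split_ifs
    · rw [Algebra.smul_def, Algebra.smul_def, ← map_mul, ← map_mul, mul_assoc]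
    · rw [smul_zero, smul_zero]
  · have h6 : p ∈ Submodule.span A (Set.range G) := hG ▸ Submodule.mem_top
    induction h6 using Submodule.span_induction with
    | zero => simp
    | add p q _ _ hp hq =>
      rw [smul_add, hp, hq, ← Finset.sum_add_distrib]
      exact Finset.sum_congr rfl fun i _ => by
        rw [map_add, map_add, add_smul, add_smul, smul_add]; abel
    | smul a p _ hp =>
      rw [smul_comm, hp, Finset.smul_sum]
      refine Finset.sum_congr rfl fun i _ => ?_
      rw [hh.smul_right, hh.smul_right, smul_add, mul_smul, mul_smul, smul_comm a ε]
    | mem p hp =>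
      obtain ⟨k, rfl⟩ := hp
      have h7 : t • (s * s) • G k = t • ∑ i, (h (x false i) (G k) • x true i +
          ε • h (x true i) (G k) • x false i) := by
        rw [ht, mul_smul, h₃ k, ← mul_smul]
      rw [mul_smul, mul_smul, h7, Finset.smul_sum, Finset.smul_sum]
      refine Finset.sum_congr rfl fun i _ => ?_
      simp only [hst, smul_add, smul_assoc, smul_comm _ t]

end SpreadOut

/-! ### Hyperbolic bases around a maximal ideal -/

section Transfer

variable {R : Type*} [CommRing R] {A : Type*} [Ring A] [Algebra R A]
  {P : Type*} [AddCommGroup P] [Module R P] [Module A P] [IsScalarTower R A P]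
  {B : Type*} [CommRing B] [Algebra R B] {B' : Type*} [CommRing B'] [Algebra R B']
  {ε : ℤ} {j : Involution R A} {h : LinearMap.BilinMap R P A}
  {ι : Type*} [Fintype ι] [DecidableEq ι]

theorem qPerpMap_smul (φ : B →ₐ[R] B') (c : ExtRing R B A) (y : QPerp R B A P) :
    qPerpMap R A P φ (c • y) = extRingMap R A φ c • qPerpMap R A P φ y :=
  Prod.ext (extModMap_smul φ c y.1) (Prod.ext (map_mul _ _ _) (map_mul _ _ _))

/-- `qPerpMap` as an additive homomorphism. -/
def qPerpMapHom (φ : B →ₐ[R] B') : QPerp R B A P →+ QPerp R B' A P :=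
  AddMonoidHom.mk' (qPerpMap R A P φ) (qPerpMap_add φ)

omit [Module A P] [IsScalarTower R A P] in
theorem qPerpMapHom_apply (φ : B →ₐ[R] B') (y : QPerp R B A P) :
    qPerpMapHom φ y = qPerpMap R A P φ y := rfl

omit [Module A P] [IsScalarTower R A P] in
theorem perpBilin_map (φ : B →ₐ[R] B') (y z : QPerp R B A P) :
    perpBilin ε (j.ext B') (extForm B' h) (qPerpMap R A P φ y) (qPerpMap R A P φ z) =
      extRingMap R A φ (perpBilin ε (j.ext B) (extForm B h) y z) := by
  simp only [perpBilin_apply, perpForm, qPerpMap, Prod.map_fst, Prod.map_snd, extForm_map,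
    Involution.ext_extRingMap, map_add, map_mul, map_zsmul]

/-- Hyperbolic bases of `P_B ⊥ A_B²` are preserved under extension of scalars. -/
theorem IsHypBasis.map_perp (hh : IsEpsForm ε j h) (φ : B →ₐ[R] B') {X : Bool → ι → QPerp R B A P}
    (hX : IsHypBasis ε (perpBilin ε (j.ext B) (extForm B h)) X) :
    IsHypBasis ε (perpBilin ε (j.ext B') (extForm B' h)) (fun κ i => qPerpMap R A P φ (X κ i)) where
  family :=
    { isotropic := fun κ i k => by rw [perpBilin_map, hX.family.isotropic, map_zero]
      pair := fun i k => by
        rw [perpBilin_map, hX.family.pair]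
        split_ifs
        · rw [map_one]
        · rw [map_zero] }
  sum y := by
    have hp := (hh.ext B').perp
    -- The vectors with the required expansion form a submodule, which contains the image of `Q_B`.
    let N : Submodule (ExtRing R B' A) (QPerp R B' A P) :=
      { carrier := {y | y = ∑ i, (perpBilin ε (j.ext B') (extForm B' h)
          (qPerpMap R A P φ (X false i)) y • qPerpMap R A P φ (X true i) +
          ε • perpBilin ε (j.ext B') (extForm B' h) (qPerpMap R A P φ (X true i)) y •
            qPerpMap R A P φ (X false i))}
        zero_mem' := by simp only [Set.mem_ofPred_eq, map_zero, zero_smul, smul_zero, add_zero,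
          Finset.sum_const_zero]
        add_mem' := fun {y z} hy hz => by
          rw [Set.mem_ofPred_eq] at hy hz ⊢
          conv_lhs => rw [hy, hz]
          rw [← Finset.sum_add_distrib]
          exact Finset.sum_congr rfl fun i _ => by
            rw [map_add, map_add, add_smul, add_smul, smul_add]; abel
        smul_mem' := fun c y hy => by
          rw [Set.mem_ofPred_eq] at hy ⊢
          conv_lhs => rw [hy]
          rw [Finset.smul_sum]
          exact Finset.sum_congr rfl fun i _ => by
            rw [hp.smul_right, hp.smul_right, smul_add, mul_smul, mul_smul, smul_comm c ε] }
    have hmap : ∀ y, qPerpMap R A P φ y ∈ N := fun y => by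
      change _ = _
      conv_lhs => rw [hX.sum y, ← qPerpMapHom_apply, map_sum]
      refine Finset.sum_congr rfl fun i _ => ?_
      rw [map_add, map_zsmul, qPerpMapHom_apply, qPerpMapHom_apply, qPerpMap_smul, qPerpMap_smul,
        perpBilin_map, perpBilin_map]
    have h1 : ∀ p : ExtMod R B' P, (p, 0, 0) ∈ N := fun p => by
      induction p using ExtMod.induction with
      | zero => exact N.zero_mem
      | add p q hp hq =>
        have := N.add_mem hp hq
        rwa [Prod.mk_add_mk, Prod.mk_add_mk, add_zero] at this
      | tmul b q =>
        have := N.smul_mem (b ⊗ₜ[R] (1 : A)) (hmap (ExtMod.tmul R 1 q, 0, 0))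
        rw [qPerpMap, Prod.map_apply, Prod.map_apply, extModMap_tmul, map_one, map_zero,
          Prod.smul_mk, Prod.smul_mk, smul_zero, ← tmul_eq_smul] at this
        exact this
    have h2 : ∀ b : ExtRing R B' A, (0, b, 0) ∈ N := fun b => by
      have := N.smul_mem b (hmap (0, 1, 0))
      rwa [qPerpMap, Prod.map_apply, Prod.map_apply, extModMap_zero, map_one, map_zero,
          Prod.smul_mk, Prod.smul_mk, smul_zero, smul_zero, smul_eq_mul, mul_one] at this
    have h3 : ∀ b : ExtRing R B' A, (0, 0, b) ∈ N := fun b => by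
      have := N.smul_mem b (hmap (0, 0, 1))
      rwa [qPerpMap, Prod.map_apply, Prod.map_apply, extModMap_zero, map_one, map_zero,
          Prod.smul_mk, Prod.smul_mk, smul_zero, smul_zero, smul_eq_mul, mul_one] at this
    have h4 := N.add_mem (h1 y.1) (N.add_mem (h2 y.2.1) (h3 y.2.2))
    simp only [Prod.mk_add_mk, add_zero, zero_add] at h4
    exact h4

/-- A dual basis up to `s` shows that `P_B` is free over every `B` in which `s` is invertible. -/
theorem IsDualBasisAway.free {s : R} {x : ι → P} {f : ι → P →ₗ[A] A} (hx : IsDualBasisAway s x f)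
    (hs : IsUnit (algebraMap R B s)) : Module.Free (ExtRing R B A) (ExtMod R B P) := by
  have hs' : IsUnit (algebraMap R (ExtRing R B A) s) := by
    rw [IsScalarTower.algebraMap_apply R B (ExtRing R B A)]
    exact hs.map _
  obtain ⟨u, hu⟩ := hs'
  refine Module.Free.of_basis (Module.Basis.mk (v := fun i => ExtMod.tmul R (1 : B) (x i)) ?_ ?_)
  · rw [Fintype.linearIndependent_iff]
    intro c hc i
    have h1 := congrArg (extDual₀ B (f i)) hc
    simp only [map_sum, map_smul, hx.ext_apply, smul_eq_mul, mul_ite, mul_zero, map_zero,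
      Finset.sum_ite_eq, Finset.mem_univ, if_true, ← hu] at h1
    exact (Units.mul_left_eq_zero u).1 h1
  · rintro p -
    have h1 : p = (↑u⁻¹ : ExtRing R B A) • algebraMap R (ExtRing R B A) s • p := by
      rw [smul_smul, ← hu, Units.inv_mul, one_smul]
    rw [h1, hx.ext_sum]
    exact Submodule.smul_mem _ _ (sum_mem fun i _ =>
      Submodule.smul_mem _ _ (Submodule.subset_span ⟨i, rfl⟩))

end Transfer

section Isometry

variable {S C M : Type*} [CommRing S] [Ring C] [Algebra S C]
  [AddCommGroup M] [Module S M] [Module C M] {ε : ℤ} {j : Involution S C}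
  {h : LinearMap.BilinMap S M C}

/-- An isometry with a standard hyperbolic module provides a hyperbolic basis. -/
theorem exists_isHypBasis_of_isometry (hε : ε * ε = 1) {k : ℕ} (e : M ≃ₗ[C] (Fin k → C × C))
    (he : ∀ x y, hyperbolicForm ε j k (e x) (e y) = h x y) :
    ∃ X : Bool → Fin k → M, IsHypBasis ε h X := by
  have hx : ∀ (i : Fin k) (a b : C) (y : M), h (e.symm (Pi.single i (a, b))) y =
      (e y i).2 * j.toLin a + ε • ((e y i).1 * j.toLin b) := fun i a b y => by
    rw [← he, e.apply_symm_apply, hyperbolicForm, Finset.sum_eq_single i]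
    · rw [Pi.single_eq_same]
    · intro l _ hl
      rw [Pi.single_eq_of_ne hl]
      simp
    · exact fun h => absurd (Finset.mem_univ _) h
  refine ⟨fun κ i => e.symm (Pi.single i (if κ then (0, 1) else (1, 0))), ⟨fun κ i k => ?_,
    fun i k => ?_⟩, fun p => ?_⟩
  · cases κ <;> by_cases hik : i = k <;>
      simp [hx, hik]
  · by_cases hik : i = k <;> simp [hx, hik, Involution.map_one]
  · apply e.injective
    rw [map_sum]
    simp only [map_add, map_zsmul, map_smul, e.apply_symm_apply, hx, Bool.false_eq_true, if_false,
      if_true, Involution.map_one, map_zero, mul_zero, mul_one, smul_zero, add_zero, zero_add]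
    funext l
    rw [Finset.sum_apply, Finset.sum_eq_single l]
    · rw [Pi.add_apply, Pi.smul_apply, Pi.smul_apply, Pi.smul_apply, Pi.single_eq_same,
        Pi.single_eq_same, smul_assoc, smul_smul, hε, one_smul]
      simp
    · intro i _ hi
      simp [Pi.single_eq_of_ne hi.symm]
    · exact fun h => absurd (Finset.mem_univ _) h

end Isometry

section AroundMaximal

variable {R : Type*} [CommRing R] {A : Type*} [Ring A] [Algebra R A]
  {P : Type*} [AddCommGroup P] [Module R P] [Module A P] [IsScalarTower R A P]
  {ε : ℤ} {j : Involution R A} {h : LinearMap.BilinMap R P A}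

/-- If `P` has constant rank and `P ⊥ A²` is hyperbolic where it is free, then around every maximal
ideal `P` itself is hyperbolic, up to a scalar. -/
theorem HyperbolicWhereFree.exists_isHypBasisAway [Module.Finite R A] [Module.Finite A P]
    [Module.Projective A P] (hh : IsEpsForm ε j h) {n k : ℕ} (hrank : HasRank R A P n)
    (hfree : HyperbolicWhereFree ε j h (k + 2)) (m : Ideal R) [m.IsMaximal] :
    ∃ s ∉ m, ∃ x : Bool → {i : Fin (k + 2) // i ≠ 0} → P, IsHypBasisAway ε h s x := by
  obtain ⟨u, hu, x, f, hx⟩ := hrank.exists_isDualBasisAway m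
  -- If `u` is nilpotent in `A`, a power of `u` kills `P`, and the zero vectors serve as a basis.
  by_cases hnil : IsNilpotent (algebraMap R A u)
  · obtain ⟨l, hl⟩ := hnil
    rw [← map_pow] at hl
    refine ⟨u ^ l, fun hm => hu (Ideal.IsPrime.mem_of_pow_mem inferInstance l hm), 0,
      ⟨fun κ i k => ?_, fun i k => ?_⟩, fun p => ?_⟩
    · exact map_zero _
    · rw [hl, ite_self]; exact map_zero _
    · rw [← algebraMap_smul A, hl, zero_smul]
      simp
  · have hunit : IsUnit (algebraMap R (Localization.Away u) u) :=
      IsLocalization.Away.algebraMap_isUnit u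
    have hP := hx.free (B := Localization.Away u) hunit
    obtain ⟨e, he⟩ := hfree u hnil inferInstance
    obtain ⟨X, hX⟩ := exists_isHypBasis_of_isometry
      (h := perpBilin ε (j.ext (Localization.Away u)) (extForm (Localization.Away u) h)) hh.eps e he
    let φ : Localization.Away u →ₐ[R] Localization.AtPrime m :=
      IsLocalization.liftAlgHom (M := Submonoid.powers u)
        (f := Algebra.ofId R (Localization.AtPrime m)) (by
          rintro ⟨_, l, rfl⟩
          exact IsLocalization.map_units (Localization.AtPrime m)
            (⟨u ^ l, m.primeCompl.pow_mem hu l⟩ : m.primeCompl))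
    obtain ⟨D, _, _, π, hπ, hD⟩ := exists_semisimple_quotient (Localization.AtPrime m)
      (ExtRing R (Localization.AtPrime m) A)
    obtain ⟨y, hy⟩ := exists_isHypBasis_of_perp (hh.ext (Localization.AtPrime m)) hπ hD
      (hX.map_perp hh φ) (i₀ := 0) (i₁ := 1) (by simp)
    exact exists_isHypBasisAway_of_atPrime hh m hy

end AroundMaximal

/-! ### Two comaximal elements -/

section Comaximal

universe u

variable {R : Type u} [CommRing R] {A : Type*} [Ring A] [Algebra R A]
  {P : Type*} [AddCommGroup P] [Module R P] [Module A P] [IsScalarTower R A P]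
  [Module.Finite A P] [Module.Projective A P]

/-- The map to `R_s'[X]` factors through `R_s[X]` if `s` divides `s'`. -/
theorem exists_comp_polyLoc {s s' : R} (h : s ∣ s') :
    ∃ ψ : (Localization.Away s)[X] →ₐ[R] (Localization.Away s')[X],
      polyLoc R s' = ψ.comp (polyLoc R s) := by
  let ψ₀ : Localization.Away s →ₐ[R] Localization.Away s' :=
    IsLocalization.liftAlgHom (M := Submonoid.powers s)
      (f := Algebra.ofId R (Localization.Away s')) (by
        rintro ⟨_, l, rfl⟩
        have h1 : IsUnit (algebraMap R (Localization.Away s') s') :=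
          IsLocalization.Away.algebraMap_isUnit s'
        have h2 := isUnit_of_dvd_unit (map_dvd (algebraMap R (Localization.Away s')) h) h1
        change IsUnit (algebraMap R (Localization.Away s') (s ^ l))
        rw [map_pow]
        exact h2.pow l)
  refine ⟨Polynomial.mapAlgHom ψ₀, ?_⟩
  rw [polyLoc, polyLoc, Polynomial.mapAlgHom_comp]
  congr 1
  exact Subsingleton.elim _ _

theorem notMem_or_notMem_of_span_sup_eq_top {s t : R} (hst : Ideal.span {s} ⊔ Ideal.span {t} = ⊤)
    (m : Ideal R) [hm : m.IsMaximal] : s ∉ m ∨ t ∉ m := by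
  by_contra! H
  exact hm.ne_top (top_unique (hst ▸ sup_le ((Ideal.span_singleton_le_iff_mem m).2 H.1)
    ((Ideal.span_singleton_le_iff_mem m).2 H.2)))

/-- The local-global principle for the linear transvection groups: around a maximal ideal which does
not contain `s`, say, the multiple `s * u` of `s` inverts enough for `P` to have a dual basis. -/
theorem mem_eTrans_of_comaximal {s t : R} (hst : Ideal.span {s} ⊔ Ideal.span {t} = ⊤) {n : ℕ}
    (hn : 2 ≤ n) (hrank : HasRank R A P n)
    (τ : QLin R R[X] A P ≃ₗ[ExtRing R R[X] A] QLin R R[X] A P)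
    (hτ : extLin (evalZero R) τ = 1)
    (hs : extLin (polyLoc R s) τ ∈ ETrans (ExtRing R (Localization.Away s)[X] A)
      (ExtMod R (Localization.Away s)[X] P))
    (ht : extLin (polyLoc R t) τ ∈ ETrans (ExtRing R (Localization.Away t)[X] A)
      (ExtMod R (Localization.Away t)[X] P)) :
    τ ∈ ETrans (ExtRing R R[X] A) (ExtMod R R[X] P) := by
  have : Nontrivial (Fin n) := Fin.nontrivial_iff_two_le.2 hn
  refine mem_of_locally_mem_lin (fun B _ _ => ETrans (ExtRing R B A) (ExtMod R B P))
    (fun B B' _ _ _ _ φ g hg => extLin_mem_eTrans φ g hg) τ hτ fun m hm => ?_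
  obtain ⟨u, hu, x, f, hx⟩ := hrank.exists_isDualBasisAway m
  have key : ∀ r ∉ m, extLin (polyLoc R r) τ ∈ ETrans (ExtRing R (Localization.Away r)[X] A)
      (ExtMod R (Localization.Away r)[X] P) → ∃ s, s ∉ m ∧
      extLin (polyLoc R s) τ ∈ ETrans (ExtRing R (Localization.Away s)[X] A)
        (ExtMod R (Localization.Away s)[X] P) ∧
      ∀ θ ∈ ETrans (ExtRing R (Localization.Away s)[X][X] A)
        (ExtMod R (Localization.Away s)[X][X] P), ∃ N : ℕ,
        ∃ β ∈ ETrans (ExtRing R R[X][X] A) (ExtMod R R[X][X] P),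
        extLin (polyLoc₂ R s) β = extLin (dil _ (s ^ N)) θ * (extLin (dil _ (0 : R)) θ)⁻¹ := by
    intro r hr hrτ
    refine ⟨r * u, mul_notMem m hr hu, ?_, fun θ hθ => ?_⟩
    · obtain ⟨ψ, hψ⟩ := exists_comp_polyLoc (Dvd.intro u rfl : r ∣ r * u)
      rw [hψ, extLin_comp]
      exact extLin_mem_eTrans ψ _ hrτ
    · exact exists_dilation_lin (hx.smul r) (isLocAway_localization (r * u)).polynomial hθ
  rcases notMem_or_notMem_of_span_sup_eq_top hst m with h | h
  exacts [key s h hs, key t h ht]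

/-- The local-global principle for the unitary transvection groups, in the symplectic and in the
orthogonal case. Finiteness of `A` over `R` serves to pass from `P ⊥ A²` to `P` around a maximal
ideal. -/
theorem mem_eUnitary_of_comaximal [Module.Finite R A] {s t : R}
    (hst : Ideal.span {s} ⊔ Ideal.span {t} = ⊤) {ε : ℤ} {j : Involution R A}
    {h : LinearMap.BilinMap R P A} (hh : IsEpsForm ε j h)
    (h2 : IsUnit (2 : R)) {n k : ℕ} (hk : 2 ≤ k) (hrank : HasRank R A P n)
    (hfree : HyperbolicWhereFree ε j h (k + 2))
    (τ : QPerp R R[X] A P ≃ₗ[ExtRing R R[X] A] QPerp R R[X] A P)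
    (hτ : extPerp (evalZero R) τ = 1)
    (hs : extPerp (polyLoc R s) τ ∈ EUnitary ε (j.ext (Localization.Away s)[X])
      (extForm (Localization.Away s)[X] h))
    (ht : extPerp (polyLoc R t) τ ∈ EUnitary ε (j.ext (Localization.Away t)[X])
      (extForm (Localization.Away t)[X] h)) :
    τ ∈ EUnitary ε (j.ext R[X]) (extForm R[X] h) := by
  refine mem_of_locally_mem_perp (fun B _ _ => EUnitary ε (j.ext B) (extForm B h))
    (fun B B' _ _ _ _ φ g hg => extPerp_mem_eUnitary hh φ g hg) τ hτ fun m hm => ?_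
  obtain ⟨u, hu, x, hx⟩ := hfree.exists_isHypBasisAway hh hrank m
  have : Nonempty {i : Fin (k + 2) // i ≠ 0} := ⟨⟨1, by simp⟩⟩
  -- There are at least three hyperbolic planes, so any two of them leave a third one.
  have hι : ∀ i i' : {i : Fin (k + 2) // i ≠ 0}, ∃ l, l ≠ i ∧ l ≠ i' := fun i i' => by
    have hcard : ({i, i'} : Finset {i : Fin (k + 2) // i ≠ 0}).card <
        Fintype.card {i : Fin (k + 2) // i ≠ 0} := by
      have h3 : Fintype.card {i : Fin (k + 2) // i ≠ 0} = k + 1 := by simp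
      have h4 := Finset.card_le_two (a := i) (b := i')
      omega
    obtain ⟨l, hl⟩ := Finset.exists_mem_notMem_of_card_lt_card
      (hcard.trans_eq Finset.card_univ.symm)
    exact ⟨l, by simpa using hl.2⟩
  have key : ∀ r ∉ m, extPerp (polyLoc R r) τ ∈ EUnitary ε (j.ext (Localization.Away r)[X])
      (extForm (Localization.Away r)[X] h) → ∃ s, s ∉ m ∧
      extPerp (polyLoc R s) τ ∈ EUnitary ε (j.ext (Localization.Away s)[X])
        (extForm (Localization.Away s)[X] h) ∧
      ∀ θ ∈ EUnitary ε (j.ext (Localization.Away s)[X][X])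
        (extForm (Localization.Away s)[X][X] h), ∃ N : ℕ,
        ∃ β ∈ EUnitary ε (j.ext R[X][X]) (extForm R[X][X] h),
        extPerp (polyLoc₂ R s) β = extPerp (dil _ (s ^ N)) θ * (extPerp (dil _ (0 : R)) θ)⁻¹ := by
    intro r hr hrτ
    refine ⟨r * r * u, mul_notMem m (mul_notMem m hr hr) hu, ?_, fun θ hθ => ?_⟩
    · obtain ⟨ψ, hψ⟩ := exists_comp_polyLoc
        (Dvd.intro (r * u) (mul_assoc r r u).symm : r ∣ r * r * u)
      rw [hψ, extPerp_comp]
      exact extPerp_mem_eUnitary hh ψ _ hrτ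
    · exact exists_dilation_perp hh h2 hι (hx.smul r)
        (isLocAway_localization (r * r * u)).polynomial hθ
  rcases notMem_or_notMem_of_span_sup_eq_top hst m with h | h
  exacts [key s h hs, key t h ht]

omit [Module.Finite A P] [Module.Projective A P] [IsScalarTower R A P] in
theorem IsNonsingularForm.isEpsForm {ε : ℤ} (hε : ε * ε = 1) {j : Involution R A}
    {h : LinearMap.BilinMap R P A} (hh : IsNonsingularForm ε j h) : IsEpsForm ε j h :=
  ⟨hε, hh.smul_right, hh.smul_left, hh.symm⟩

end Comaximal

end Transvection

end

theorem corollary3p7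
    {R : Type*} [CommRing R] {A : Type*} [Ring A] [Algebra R A] [Module.Finite R A]
    {P : Type*} [AddCommGroup P] [Module R P] [Module A P] [IsScalarTower R A P]
    [Module.Finite A P] [Module.Projective A P]
    (s t : R) (hst : Ideal.span {s} ⊔ Ideal.span {t} = ⊤) :
    -- linear case
    (∀ n : ℕ, 2 ≤ n → Transvection.HasRank R A P n →
      ∀ τ : Transvection.QLin R R[X] A P ≃ₗ[Transvection.ExtRing R R[X] A]
          Transvection.QLin R R[X] A P,
        Transvection.IsExtLin R A P (Transvection.evalZero R) τ (LinearEquiv.refl _ _) →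
        (∃ σ ∈ Transvection.ETrans (Transvection.ExtRing R (Localization.Away s)[X] A)
            (Transvection.ExtMod R (Localization.Away s)[X] P),
          Transvection.IsExtLin R A P (Transvection.polyLoc R s) τ σ) →
        (∃ σ ∈ Transvection.ETrans (Transvection.ExtRing R (Localization.Away t)[X] A)
            (Transvection.ExtMod R (Localization.Away t)[X] P),
          Transvection.IsExtLin R A P (Transvection.polyLoc R t) τ σ) →
        τ ∈ Transvection.ETrans (Transvection.ExtRing R R[X] A) (Transvection.ExtMod R R[X] P)) ∧
    -- symplectic case
    (IsUnit (2 : R) → ∀ r : ℕ, 6 ≤ 2 * r → Transvection.HasRank R A P (2 * r) →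
      ∀ (j : Transvection.Involution R A) (h : LinearMap.BilinMap R P A),
        Transvection.IsNonsingularForm (-1) j h → Transvection.HyperbolicWhereFree (-1) j h (r + 1) →
      ∀ τ ∈ Transvection.isometryGroup
          (Transvection.perpForm (-1) (j.ext R[X]) (Transvection.extForm R[X] h)),
        Transvection.IsExtPerp R A P (Transvection.evalZero R) τ (LinearEquiv.refl _ _) →
        (∃ σ ∈ Transvection.ETransSp (j.ext (Localization.Away s)[X])
            (Transvection.extForm (Localization.Away s)[X] h),
          Transvection.IsExtPerp R A P (Transvection.polyLoc R s) τ σ) →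
        (∃ σ ∈ Transvection.ETransSp (j.ext (Localization.Away t)[X])
            (Transvection.extForm (Localization.Away t)[X] h),
          Transvection.IsExtPerp R A P (Transvection.polyLoc R t) τ σ) →
        τ ∈ Transvection.ETransSp (j.ext R[X]) (Transvection.extForm R[X] h)) ∧
    -- orthogonal case
    (IsUnit (2 : R) → ∀ r : ℕ, 6 ≤ 2 * r → Transvection.HasRank R A P (2 * r) →
      ∀ (j : Transvection.Involution R A) (h : LinearMap.BilinMap R P A),
        Transvection.IsNonsingularForm 1 j h → Transvection.HyperbolicWhereFree 1 j h (r + 1) →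
      ∀ τ ∈ Transvection.isometryGroup
          (Transvection.perpForm 1 (j.ext R[X]) (Transvection.extForm R[X] h)),
        Transvection.IsExtPerp R A P (Transvection.evalZero R) τ (LinearEquiv.refl _ _) →
        (∃ σ ∈ Transvection.ETransO (j.ext (Localization.Away s)[X])
            (Transvection.extForm (Localization.Away s)[X] h),
          Transvection.IsExtPerp R A P (Transvection.polyLoc R s) τ σ) →
        (∃ σ ∈ Transvection.ETransO (j.ext (Localization.Away t)[X])
            (Transvection.extForm (Localization.Away t)[X] h),
          Transvection.IsExtPerp R A P (Transvection.polyLoc R t) τ σ) →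
        τ ∈ Transvection.ETransO (j.ext R[X]) (Transvection.extForm R[X] h)) := by
  refine ⟨fun n hn hrank τ hτ ⟨σ, hσ, hσ'⟩ ⟨ρ, hρ, hρ'⟩ => ?_,
    fun h2 r hr hrank j h hns hfree τ _ hτ ⟨σ, hσ, hσ'⟩ ⟨ρ, hρ, hρ'⟩ => ?_,
    fun h2 r hr hrank j h hns hfree τ _ hτ ⟨σ, hσ, hσ'⟩ ⟨ρ, hρ, hρ'⟩ => ?_⟩
  · exact Transvection.mem_eTrans_of_comaximal hst hn hrank τ hτ.eq_extLin (hσ'.eq_extLin ▸ hσ)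
      (hρ'.eq_extLin ▸ hρ)
  · obtain ⟨k, rfl⟩ : ∃ k, r = k + 1 := ⟨r - 1, by omega⟩
    have := Transvection.mem_eUnitary_of_comaximal hst (hns.isEpsForm (by norm_num)) h2
      (by omega) hrank hfree τ hτ.eq_extPerp (hσ'.eq_extPerp ▸ hσ) (hρ'.eq_extPerp ▸ hρ)
    exact this
  · obtain ⟨k, rfl⟩ : ∃ k, r = k + 1 := ⟨r - 1, by omega⟩
    have := Transvection.mem_eUnitary_of_comaximal hst (hns.isEpsForm (by norm_num)) h2
      (by omega) hrank hfree τ hτ.eq_extPerp (hσ'.eq_extPerp ▸ hσ) (hρ'.eq_extPerp ▸ hρ)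
    exact this
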